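/- Let $p>3$ be a prime and let $k$ be an algebraically closed field of characteristic $p$. Let $C_p=\langle\sigma\rangle$ be the cyclic group of order $p$ and let $\mathrm{Ver}_p$ be the quotient of the $k$-linear symmetric tensor category $\mathrm{Rep}_k(C_p)$ of finite-dimensional representations by the negligible morphisms, i.e. those $f\colon X\to Y$ such that $\mathrm{Tr}(f\circ u)=0$ for every $u\colon Y\to X$. For $1\le s\le p-1$ let $\bar L_s\in\mathrm{Ver}_p$ be the image of the representation $L_s=k[C_p]/(1-\sigma)^s$. A fusion subcategory is a full subcategory that contains the unit object and is closed under tensor products, direct sums and direct summands. Let $\mathrm{Vec}$, $\mathrm{sVec}$ and $\mathrm{Ver}_p^+$ denote the full subcategories of $\mathrm{Ver}_p$ consisting of the objects isomorphic to finite direct sums of copies of, respectively, the unit $\bar L_1$; $\bar L_1$ and $\bar L_{p-1}$; and the $\bar L_s$ with $s$ odd, $1\le s\le p-2$. Then: (i) $\mathrm{Ver}_p^+$ is the fusion subcategory of $\mathrm{Ver}_p$ generated by $\bar L_3$, i.e. the smallest fusion subcategory containing $\bar L_3$. (ii) $\mathrm{Ver}_p$ has precisely four fusion subcategories, namely $\mathrm{Vec}$,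 $\mathrm{sVec}$, $\mathrm{Ver}_p^+$ and $\mathrm{Ver}_p$ itself; these four are pairwise distinct. (iii) There is an equivalence of $k$-linear symmetric tensor categories $\mathrm{Ver}_p\simeq\mathrm{Ver}_p^+\boxtimes\mathrm{sVec}$, where $\mathcal C\boxtimes\mathcal D$ is the Karoubian envelope of the category whose objects are pairs $(X,Y)$ with $X\in\mathcal C$, $Y\in\mathcal D$, and whose morphisms are $\mathrm{Hom}((X_1,Y_1),(X_2,Y_2))=\mathrm{Hom}_{\mathcal C}(X_1,X_2)\otimes_k\mathrm{Hom}_{\mathcal D}(Y_1,Y_2)$, with the componentwise symmetric tensor structure. -/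

import Mathlib

universe w v v₁ v₂ u u₁ u₂

noncomputable section

open CategoryTheory MonoidalCategory
open scoped TensorProduct

namespace Verlinde

section Trace

variable {C : Type u} [Category.{v} C] [MonoidalCategory C] [SymmetricCategory C]
  [RightRigidCategory C]

/-- The trace of an endomorphism in a rigid symmetric monoidal category, an endomorphism of the
unit object: coevaluation, then `f ⊗ id`, then the braiding, then evaluation. -/
def symTrace {X : C} (f : X ⟶ X) : 𝟙_ C ⟶ 𝟙_ C :=
  η_ X Xᘁ ≫ f ▷ Xᘁ ≫ (β_ X Xᘁ).hom ≫ ε_ X Xᘁ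

variable [Preadditive C]

/-- A morphism `f : X ⟶ Y` is negligible if the trace of `f ≫ u` vanishes for every
`u : Y ⟶ X`. -/
def IsNegligible {X Y : C} (f : X ⟶ Y) : Prop :=
  ∀ u : Y ⟶ X, symTrace (f ≫ u) = 0

/-- A morphism is negligible iff it is killed by every way of closing it up to an endomorphism
of the unit. This makes it clear that negligible morphisms form a tensor ideal. -/
lemma isNegligible_iff {X Y : C} (f : X ⟶ Y) :
    IsNegligible f ↔ ∀ (T : C) (a : 𝟙_ C ⟶ X ⊗ T) (b : Y ⊗ T ⟶ 𝟙_ C), a ≫ f ▷ T ≫ b = 0 := by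
  constructor
  · intro hf
    have key : ∀ v : Y ⊗ Xᘁ ⟶ 𝟙_ C, η_ X Xᘁ ≫ f ▷ Xᘁ ≫ v = 0 := by
      intro v
      let : ExactPairing Xᘁ X := BraidedCategory.exactPairing_swap X Xᘁ
      obtain ⟨u, hu⟩ : ∃ u : Y ⟶ X, u = (tensorRightHomEquiv Y Xᘁ X (𝟙_ C)) v ≫ (λ_ X).hom :=
        ⟨_, rfl⟩
      have e : v = u ▷ Xᘁ ≫ (β_ X Xᘁ).hom ≫ ε_ X Xᘁ := by
        rw [← (tensorRightHomEquiv Y Xᘁ X (𝟙_ C)).symm_apply_apply v]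
        have h1 : (tensorRightHomEquiv Y Xᘁ X (𝟙_ C)) v = u ≫ (λ_ X).inv := by simp [hu]
        rw [h1, tensorRightHomEquiv_symm_naturality]
        congr 1
        change (λ_ X).inv ▷ Xᘁ ≫ (α_ (𝟙_ C) X Xᘁ).hom ≫ 𝟙_ C ◁ ((β_ X Xᘁ).hom ≫ ε_ X Xᘁ) ≫
          (ρ_ (𝟙_ C)).hom = _
        rw [← unitors_equal, leftUnitor_naturality]
        simp
      rw [e, ← comp_whiskerRight_assoc]
      exact hf u
    intro T a b
    have ha : a = η_ X Xᘁ ≫ X ◁ ((ρ_ Xᘁ).inv ≫ (tensorLeftHomEquiv (𝟙_ C) X Xᘁ T).symm a) := by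
      apply (tensorLeftHomEquiv (𝟙_ C) X Xᘁ T).symm.injective
      rw [tensorLeftHomEquiv_symm_coevaluation_comp_whiskerLeft]
      simp
    rw [ha, Category.assoc, whisker_exchange_assoc]
    exact key _
  · intro h u
    have := h Xᘁ (η_ X Xᘁ) (u ▷ Xᘁ ≫ (β_ X Xᘁ).hom ≫ ε_ X Xᘁ)
    simpa [symTrace] using this

lemma IsNegligible.comp_right {X Y Z : C} {f : X ⟶ Y} (hf : IsNegligible f) (g : Y ⟶ Z) :
    IsNegligible (f ≫ g) := by
  rw [isNegligible_iff] at *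
  intro T a b
  simpa using hf T a (g ▷ T ≫ b)

lemma IsNegligible.comp_left {X Y Z : C} {f : Y ⟶ Z} (hf : IsNegligible f) (g : X ⟶ Y) :
    IsNegligible (g ≫ f) := by
  rw [isNegligible_iff] at *
  intro T a b
  simpa using hf T (a ≫ g ▷ T) b

lemma IsNegligible.whiskerRight {X Y : C} {f : X ⟶ Y} (hf : IsNegligible f) (Z : C) :
    IsNegligible (f ▷ Z) := by
  rw [isNegligible_iff] at *
  intro T a b
  simpa using hf (Z ⊗ T) (a ≫ (α_ X Z T).hom) ((α_ Y Z T).inv ≫ b)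

lemma IsNegligible.whiskerLeft {X Y : C} {f : X ⟶ Y} (hf : IsNegligible f) (Z : C) :
    IsNegligible (Z ◁ f) := by
  have h : Z ◁ f = (β_ Z X).hom ≫ f ▷ Z ≫ (β_ Z Y).inv := by
    rw [← BraidedCategory.braiding_naturality_right_assoc]; simp
  rw [h]
  exact ((hf.whiskerRight Z).comp_right _).comp_left _

end Trace

section Quotient

variable (k : Type w) [CommRing k]
variable (C : Type u) [Category.{v} C] [MonoidalCategory C] [SymmetricCategory C]
  [RightRigidCategory C] [Preadditive C] [MonoidalPreadditive C] [Linear k C] [MonoidalLinear k C]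

/-- The subspace of negligible morphisms. -/
def negligible {C : Type u} [Category.{v} C] [MonoidalCategory C] [SymmetricCategory C]
    [RightRigidCategory C] [Preadditive C] [MonoidalPreadditive C] [Linear k C]
    [MonoidalLinear k C] (X Y : C) : Submodule k (X ⟶ Y) where
  carrier := {f | IsNegligible f}
  zero_mem' := by
    intro u; simp [symTrace]
  add_mem' := by
    intro f g hf hg u
    have h := congrArg₂ (· + ·) (hf u) (hg u)
    simpa [symTrace] using h
  smul_mem' := by
    intro a f hf u
    have h := congrArg (a • ·) (hf u)
    simpa [symTrace] using h

@[simp]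
lemma mem_negligible {X Y : C} (f : X ⟶ Y) : f ∈ negligible k X Y ↔ IsNegligible f := Iff.rfl

/-- The quotient of a rigid symmetric monoidal `k`-linear category by its negligible morphisms.
The objects are the same. -/
structure NegQuotient (k : Type w) (C : Type u) where
  /-- the underlying object -/
  as : C

variable {C}

namespace NegQuotient

variable {k}

/-- Composition of classes of morphisms. -/
def comp {X Y Z : C} : ((X ⟶ Y) ⧸ negligible k X Y) →ₗ[k] ((Y ⟶ Z) ⧸ negligible k Y Z) →ₗ[k]
    ((X ⟶ Z) ⧸ negligible k X Z) :=
  Submodule.liftQ _ (LinearMap.flip (Submodule.liftQ _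
    (LinearMap.flip ((Linear.comp X Y Z).compr₂ (negligible k X Z).mkQ)) (by
      intro g hg
      ext f
      exact (Submodule.Quotient.mk_eq_zero _).2 (IsNegligible.comp_left hg f)))) (by
    intro f hf
    ext g
    exact (Submodule.Quotient.mk_eq_zero _).2 (IsNegligible.comp_right hf g))

instance : Category (NegQuotient k C) where
  Hom X Y := (X.as ⟶ Y.as) ⧸ negligible k X.as Y.as
  id X := Submodule.Quotient.mk (𝟙 X.as)
  comp f g := comp f g
  id_comp f := by
    obtain ⟨f, rfl⟩ := Submodule.Quotient.mk_surjective _ f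
    exact congrArg Submodule.Quotient.mk (Category.id_comp f)
  comp_id f := by
    obtain ⟨f, rfl⟩ := Submodule.Quotient.mk_surjective _ f
    exact congrArg Submodule.Quotient.mk (Category.comp_id f)
  assoc f g h := by
    obtain ⟨f, rfl⟩ := Submodule.Quotient.mk_surjective _ f
    obtain ⟨g, rfl⟩ := Submodule.Quotient.mk_surjective _ g
    obtain ⟨h, rfl⟩ := Submodule.Quotient.mk_surjective _ h
    exact congrArg Submodule.Quotient.mk (Category.assoc f g h)

variable (k) in
/-- The quotient functor. -/
def proj : C ⥤ NegQuotient k C where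
  obj X := ⟨X⟩
  map f := Submodule.Quotient.mk f

lemma proj_map_surjective {X Y : NegQuotient k C} (f : X ⟶ Y) :
    ∃ g : X.as ⟶ Y.as, (proj k).map g = f :=
  Submodule.Quotient.mk_surjective _ f

lemma proj_map_eq_iff {X Y : C} (f g : X ⟶ Y) :
    (proj k).map f = (proj k).map g ↔ IsNegligible (f - g) :=
  Submodule.Quotient.eq _

instance : Preadditive (NegQuotient k C) where
  homGroup X Y := inferInstanceAs (AddCommGroup ((X.as ⟶ Y.as) ⧸ negligible k X.as Y.as))
  add_comp X Y Z f f' g := by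
    exact LinearMap.map_add₂ (comp (k := k) (X := X.as) (Y := Y.as) (Z := Z.as)) f f' g
  comp_add X Y Z f g g' := by
    exact (comp (k := k) (X := X.as) (Y := Y.as) (Z := Z.as) f).map_add g g'

instance : Linear k (NegQuotient k C) where
  homModule X Y := inferInstanceAs (Module k ((X.as ⟶ Y.as) ⧸ negligible k X.as Y.as))
  smul_comp X Y Z a f g := by
    exact LinearMap.map_smul₂ (comp (k := k) (X := X.as) (Y := Y.as) (Z := Z.as)) a f g
  comp_smul X Y Z f a g := by
    exact (comp (k := k) (X := X.as) (Y := Y.as) (Z := Z.as) f).map_smul a g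

instance : (proj k : C ⥤ NegQuotient k C).Additive where
  map_add := rfl

instance : (proj k : C ⥤ NegQuotient k C).Linear k where
  map_smul _ _ := rfl

/-- Left whiskering of classes of morphisms. -/
def whiskerLeft (Z : C) (X Y : C) : ((X ⟶ Y) ⧸ negligible k X Y) →ₗ[k]
    ((Z ⊗ X ⟶ Z ⊗ Y) ⧸ negligible k (Z ⊗ X) (Z ⊗ Y)) :=
  Submodule.mapQ _ _ ((tensorLeft Z).mapLinearMap k) (fun _ hf => IsNegligible.whiskerLeft hf Z)

/-- Right whiskering of classes of morphisms. -/
def whiskerRight (X Y : C) (Z : C) : ((X ⟶ Y) ⧸ negligible k X Y) →ₗ[k]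
    ((X ⊗ Z ⟶ Y ⊗ Z) ⧸ negligible k (X ⊗ Z) (Y ⊗ Z)) :=
  Submodule.mapQ _ _ ((tensorRight Z).mapLinearMap k) (fun _ hf => IsNegligible.whiskerRight hf Z)

instance : MonoidalCategoryStruct (NegQuotient k C) where
  tensorObj X Y := ⟨X.as ⊗ Y.as⟩
  whiskerLeft Z X Y f := whiskerLeft Z.as X.as Y.as f
  whiskerRight {X Y} f Z := whiskerRight X.as Y.as Z.as f
  tensorUnit := ⟨𝟙_ C⟩
  associator X Y Z := (proj k).mapIso (α_ X.as Y.as Z.as)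
  leftUnitor X := (proj k).mapIso (λ_ X.as)
  rightUnitor X := (proj k).mapIso (ρ_ X.as)

instance : MonoidalCategory (NegQuotient k C) where
  tensorHom_def _ _ := rfl
  id_tensorHom_id X Y := by
    change (proj k).map (𝟙 X.as ▷ Y.as ≫ X.as ◁ 𝟙 Y.as) = (proj k).map (𝟙 (X.as ⊗ Y.as))
    simp
  tensorHom_comp_tensorHom f₁ f₂ g₁ g₂ := by
    obtain ⟨f₁, rfl⟩ := proj_map_surjective f₁
    obtain ⟨f₂, rfl⟩ := proj_map_surjective f₂
    obtain ⟨g₁, rfl⟩ := proj_map_surjective g₁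
    obtain ⟨g₂, rfl⟩ := proj_map_surjective g₂
    have h := MonoidalCategory.tensorHom_comp_tensorHom f₁ f₂ g₁ g₂
    simp only [MonoidalCategory.tensorHom_def] at h
    exact congrArg (proj k).map h
  whiskerLeft_id X Y := congrArg (proj k).map (MonoidalCategory.whiskerLeft_id X.as Y.as)
  id_whiskerRight X Y := congrArg (proj k).map (MonoidalCategory.id_whiskerRight X.as Y.as)
  associator_naturality f₁ f₂ f₃ := by
    obtain ⟨f₁, rfl⟩ := proj_map_surjective f₁
    obtain ⟨f₂, rfl⟩ := proj_map_surjective f₂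
    obtain ⟨f₃, rfl⟩ := proj_map_surjective f₃
    have h := MonoidalCategory.associator_naturality f₁ f₂ f₃
    simp only [MonoidalCategory.tensorHom_def] at h
    exact congrArg (proj k).map h
  leftUnitor_naturality f := by
    obtain ⟨f, rfl⟩ := proj_map_surjective f
    exact congrArg (proj k).map (MonoidalCategory.leftUnitor_naturality f)
  rightUnitor_naturality f := by
    obtain ⟨f, rfl⟩ := proj_map_surjective f
    exact congrArg (proj k).map (MonoidalCategory.rightUnitor_naturality f)
  pentagon W X Y Z :=
    congrArg (proj k).map (MonoidalCategory.pentagon W.as X.as Y.as Z.as)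
  triangle X Y := congrArg (proj k).map (MonoidalCategory.triangle X.as Y.as)

instance : BraidedCategory (NegQuotient k C) where
  braiding X Y := (proj k).mapIso (β_ X.as Y.as)
  braiding_naturality_right X Y Z f := by
    obtain ⟨f, rfl⟩ := proj_map_surjective f
    exact congrArg (proj k).map (BraidedCategory.braiding_naturality_right X.as f)
  braiding_naturality_left f Z := by
    obtain ⟨f, rfl⟩ := proj_map_surjective f
    exact congrArg (proj k).map (BraidedCategory.braiding_naturality_left f Z.as)
  hexagon_forward X Y Z :=
    congrArg (proj k).map (BraidedCategory.hexagon_forward X.as Y.as Z.as)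
  hexagon_reverse X Y Z :=
    congrArg (proj k).map (BraidedCategory.hexagon_reverse X.as Y.as Z.as)

instance : SymmetricCategory (NegQuotient k C) where
  symmetry X Y := congrArg (proj k).map (SymmetricCategory.symmetry X.as Y.as)

instance : MonoidalPreadditive (NegQuotient k C) where
  whiskerLeft_zero {X Y Z} := map_zero (whiskerLeft X.as Y.as Z.as)
  zero_whiskerRight {X Y Z} := map_zero (whiskerRight Y.as Z.as X.as)
  whiskerLeft_add {X Y Z} f g := map_add (whiskerLeft X.as Y.as Z.as) f g
  add_whiskerRight {X Y Z} f g := map_add (whiskerRight Y.as Z.as X.as) f g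

instance : MonoidalLinear k (NegQuotient k C) where
  whiskerLeft_smul X Y Z a f := map_smul (whiskerLeft X.as Y.as Z.as) a f
  smul_whiskerRight a X Y f Z := map_smul (whiskerRight X.as Y.as Z.as) a f

end NegQuotient

end Quotient

section ExternalProduct

/-- Objects of the naive product `C ×ₖ D`: pairs of objects. -/
structure PreProd (k : Type w) (C : Type u₁) (D : Type u₂) where
  /-- first component -/
  fst : C
  /-- second component -/
  snd : D

variable (k : Type w) [CommRing k]
variable (C : Type u₁) [Category.{v₁} C] [Preadditive C] [Linear k C]
variable (D : Type u₂) [Category.{v₂} D] [Preadditive D] [Linear k D]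

namespace PreProd

variable {k C D}

/-- Morphisms of `C ×ₖ D`. -/
abbrev Hom (X Y : PreProd k C D) := (X.fst ⟶ Y.fst) ⊗[k] (X.snd ⟶ Y.snd)

/-- Composition in `C ×ₖ D`, componentwise on pure tensors. -/
def comp {X Y Z : PreProd k C D} : Hom X Y →ₗ[k] Hom Y Z →ₗ[k] Hom X Z :=
  TensorProduct.map₂ (Linear.comp X.fst Y.fst Z.fst) (Linear.comp X.snd Y.snd Z.snd)

@[simp]
lemma comp_tmul {X Y Z : PreProd k C D} (f : X.fst ⟶ Y.fst) (g : X.snd ⟶ Y.snd)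
    (f' : Y.fst ⟶ Z.fst) (g' : Y.snd ⟶ Z.snd) :
    comp (X := X) (Y := Y) (Z := Z) (f ⊗ₜ g) (f' ⊗ₜ g') = (f ≫ f') ⊗ₜ (g ≫ g') :=
  by
  simp [comp]

lemma id_comp' {X Y : PreProd k C D} :
    comp (X := X) (Y := X) (Z := Y) (𝟙 X.fst ⊗ₜ 𝟙 X.snd) = LinearMap.id := by
  ext f g; simp

lemma comp_id' {X Y : PreProd k C D} :
    (comp (X := X) (Y := Y) (Z := Y)).flip (𝟙 Y.fst ⊗ₜ 𝟙 Y.snd) = LinearMap.id := by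
  ext f g; simp

lemma comp_assoc' {W X Y Z : PreProd k C D} (f : Hom W X) (g : Hom X Y) (h : Hom Y Z) :
    comp (comp f g) h = comp f (comp g h) := by
  induction f using TensorProduct.induction_on with
  | zero => simp
  | add f f' hf hf' => simp [hf, hf']
  | tmul f f' =>
    induction g using TensorProduct.induction_on with
    | zero => simp
    | add g g' hg hg' => simp [hg, hg']
    | tmul g g' =>
      induction h using TensorProduct.induction_on with
      | zero => simp
      | add h h' hh hh' => simp only [map_add, hh, hh']
      | tmul h h' => simp

instance : Category (PreProd k C D) where
  Hom X Y := Hom X Y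
  id X := 𝟙 X.fst ⊗ₜ 𝟙 X.snd
  comp f g := comp f g
  id_comp f := LinearMap.congr_fun id_comp' f
  comp_id f := LinearMap.congr_fun comp_id' f
  assoc f g h := comp_assoc' f g h

variable (k) in
/-- The morphism `f ⊗ g` of `C ×ₖ D`. -/
def pure {X Y : PreProd k C D} (f : X.fst ⟶ Y.fst) (g : X.snd ⟶ Y.snd) : X ⟶ Y :=
  (f ⊗ₜ[k] g : Hom X Y)

lemma pure_comp {X Y Z : PreProd k C D} (f : X.fst ⟶ Y.fst) (g : X.snd ⟶ Y.snd)
    (f' : Y.fst ⟶ Z.fst) (g' : Y.snd ⟶ Z.snd) :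
    (pure k f g : X ⟶ Y) ≫ (pure k f' g' : Y ⟶ Z) = pure k (f ≫ f') (g ≫ g') :=
  comp_tmul f g f' g'

lemma pure_id (X : PreProd k C D) : (pure k (𝟙 X.fst) (𝟙 X.snd) : X ⟶ X) = 𝟙 X := rfl

/-- An isomorphism of pairs gives an isomorphism in `C ×ₖ D`. -/
def mkIso {X Y : PreProd k C D} (e : X.fst ≅ Y.fst) (e' : X.snd ≅ Y.snd) : X ≅ Y where
  hom := pure k e.hom e'.hom
  inv := pure k e.inv e'.inv
  hom_inv_id := by rw [pure_comp, e.hom_inv_id, e'.hom_inv_id, pure_id]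
  inv_hom_id := by rw [pure_comp, e.inv_hom_id, e'.inv_hom_id, pure_id]

instance : Preadditive (PreProd k C D) where
  homGroup X Y := inferInstanceAs (AddCommGroup (Hom X Y))
  add_comp X Y Z f f' g := LinearMap.map_add₂ (comp (X := X) (Y := Y) (Z := Z)) f f' g
  comp_add X Y Z f g g' := (comp (X := X) (Y := Y) (Z := Z) f).map_add g g'

instance : Linear k (PreProd k C D) where
  homModule X Y := inferInstanceAs (Module k (Hom X Y))
  smul_comp X Y Z a f g := LinearMap.map_smul₂ (comp (X := X) (Y := Y) (Z := Z)) a f g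
  comp_smul X Y Z f a g := (comp (X := X) (Y := Y) (Z := Z) f).map_smul a g

/-- Every morphism of `C ×ₖ D` is a sum of pure tensors. -/
lemma hom_induction {X Y : PreProd k C D} {P : (X ⟶ Y) → Prop} 
    (zero : P 0) (pure : ∀ (g : X.fst ⟶ Y.fst) (h : X.snd ⟶ Y.snd), P (pure k g h))
    (add : ∀ f g, P f → P g → P (f + g)) (f : X ⟶ Y) : P f :=
  TensorProduct.induction_on (motive := P) f zero pure add

variable [MonoidalCategory C] [MonoidalPreadditive C] [MonoidalLinear k C]
variable [MonoidalCategory D] [MonoidalPreadditive D] [MonoidalLinear k D]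

/-- Left whiskering in `C ×ₖ D`, componentwise on pure tensors. -/
def whiskerLeft (Z X Y : PreProd k C D) :
    Hom X Y →ₗ[k] (Z.fst ⊗ X.fst ⟶ Z.fst ⊗ Y.fst) ⊗[k] (Z.snd ⊗ X.snd ⟶ Z.snd ⊗ Y.snd) :=
  TensorProduct.map ((tensorLeft Z.fst).mapLinearMap k) ((tensorLeft Z.snd).mapLinearMap k)

/-- Right whiskering in `C ×ₖ D`, componentwise on pure tensors. -/
def whiskerRight (X Y Z : PreProd k C D) :
    Hom X Y →ₗ[k] (X.fst ⊗ Z.fst ⟶ Y.fst ⊗ Z.fst) ⊗[k] (X.snd ⊗ Z.snd ⟶ Y.snd ⊗ Z.snd) :=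
  TensorProduct.map ((tensorRight Z.fst).mapLinearMap k) ((tensorRight Z.snd).mapLinearMap k)

instance : MonoidalCategoryStruct (PreProd k C D) where
  tensorObj X Y := ⟨X.fst ⊗ Y.fst, X.snd ⊗ Y.snd⟩
  whiskerLeft Z X Y f := whiskerLeft Z X Y f
  whiskerRight {X Y} f Z := whiskerRight X Y Z f
  tensorUnit := ⟨𝟙_ C, 𝟙_ D⟩
  associator X Y Z := mkIso (α_ X.fst Y.fst Z.fst) (α_ X.snd Y.snd Z.snd)
  leftUnitor X := mkIso (λ_ X.fst) (λ_ X.snd)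
  rightUnitor X := mkIso (ρ_ X.fst) (ρ_ X.snd)

lemma whiskerLeft_pure (Z : PreProd k C D) {X Y : PreProd k C D} (f : X.fst ⟶ Y.fst)
    (g : X.snd ⟶ Y.snd) :
    Z ◁ (pure k f g : X ⟶ Y) = (pure k (Z.fst ◁ f) (Z.snd ◁ g) : Z ⊗ X ⟶ Z ⊗ Y) :=
  rfl

lemma whiskerRight_pure {X Y : PreProd k C D} (f : X.fst ⟶ Y.fst)
    (g : X.snd ⟶ Y.snd) (Z : PreProd k C D) :
    (pure k f g : X ⟶ Y) ▷ Z = (pure k (f ▷ Z.fst) (g ▷ Z.snd) : X ⊗ Z ⟶ Y ⊗ Z) :=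
  rfl

lemma whiskerLeft_add' (Z : PreProd k C D) {X Y : PreProd k C D} (f g : X ⟶ Y) :
    Z ◁ (f + g) = Z ◁ f + Z ◁ g :=
  (whiskerLeft Z X Y).map_add f g

lemma whiskerRight_add' {X Y : PreProd k C D} (f g : X ⟶ Y) (Z : PreProd k C D) :
    (f + g) ▷ Z = f ▷ Z + g ▷ Z :=
  (whiskerRight X Y Z).map_add f g

lemma whiskerLeft_zero' (Z X Y : PreProd k C D) : Z ◁ (0 : X ⟶ Y) = 0 :=
  (whiskerLeft Z X Y).map_zero

lemma whiskerRight_zero' (X Y Z : PreProd k C D) : (0 : X ⟶ Y) ▷ Z = 0 :=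
  (whiskerRight X Y Z).map_zero

lemma tensorHom_eq {X₁ Y₁ X₂ Y₂ : PreProd k C D} (f : X₁ ⟶ Y₁) (g : X₂ ⟶ Y₂) :
    f ⊗ₘ g = f ▷ X₂ ≫ Y₁ ◁ g := rfl

lemma tensorHom_pure {X₁ Y₁ X₂ Y₂ : PreProd k C D}
    (f : X₁.fst ⟶ Y₁.fst) (f' : X₁.snd ⟶ Y₁.snd) (g : X₂.fst ⟶ Y₂.fst) (g' : X₂.snd ⟶ Y₂.snd) :
    (pure k f f' : X₁ ⟶ Y₁) ⊗ₘ (pure k g g' : X₂ ⟶ Y₂) =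
      (pure k (f ⊗ₘ g) (f' ⊗ₘ g') : X₁ ⊗ X₂ ⟶ Y₁ ⊗ Y₂) := by
  rw [tensorHom_eq, whiskerRight_pure, whiskerLeft_pure, pure_comp, MonoidalCategory.tensorHom_def,
    MonoidalCategory.tensorHom_def]

lemma whisker_exchange' {W X Y Z : PreProd k C D} (f : W ⟶ X) (g : Y ⟶ Z) :
    W ◁ g ≫ f ▷ Z = f ▷ Y ≫ X ◁ g := by
  induction f using hom_induction with
  | zero =>
    simp [whiskerRight_zero']
  | pure f f' =>
    induction g using hom_induction with
    | zero =>
      simp [whiskerLeft_zero']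
    | pure g g' =>
      rw [whiskerRight_pure, whiskerLeft_pure, whiskerRight_pure, whiskerLeft_pure, pure_comp,
        pure_comp, whisker_exchange, whisker_exchange]
    | add g g' h h' =>
      simp [whiskerLeft_add', h, h']
  | add f f' h h' =>
    simp [whiskerRight_add', h, h']

lemma whiskerLeft_comp' (W : PreProd k C D) {X Y Z : PreProd k C D} (f : X ⟶ Y) (g : Y ⟶ Z) :
    W ◁ (f ≫ g) = W ◁ f ≫ W ◁ g := by
  induction f using hom_induction with
  | zero =>
    simp [whiskerLeft_zero']
  | pure f f' =>
    induction g using hom_induction with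
    | zero =>
      simp [whiskerLeft_zero']
    | pure g g' =>
      simp only [pure_comp, whiskerLeft_pure, MonoidalCategory.whiskerLeft_comp]
    | add g g' h h' =>
      simp [whiskerLeft_add', h, h']
  | add f f' h h' =>
    simp [whiskerLeft_add', h, h']

lemma comp_whiskerRight' {X Y Z : PreProd k C D} (f : X ⟶ Y) (g : Y ⟶ Z) (W : PreProd k C D) :
    (f ≫ g) ▷ W = f ▷ W ≫ g ▷ W := by
  induction f using hom_induction with
  | zero =>
    simp [whiskerRight_zero']
  | pure f f' =>
    induction g using hom_induction with
    | zero =>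
      simp [whiskerRight_zero']
    | pure g g' =>
      simp only [pure_comp, whiskerRight_pure, MonoidalCategory.comp_whiskerRight]
    | add g g' h h' =>
      simp [whiskerRight_add', h, h']
  | add f f' h h' =>
    simp [whiskerRight_add', h, h']

lemma associator_naturality' {X₁ X₂ X₃ Y₁ Y₂ Y₃ : PreProd k C D} (f₁ : X₁ ⟶ Y₁) (f₂ : X₂ ⟶ Y₂)
    (f₃ : X₃ ⟶ Y₃) :
    ((f₁ ⊗ₘ f₂) ⊗ₘ f₃) ≫ (α_ Y₁ Y₂ Y₃).hom = (α_ X₁ X₂ X₃).hom ≫ (f₁ ⊗ₘ (f₂ ⊗ₘ f₃)) := by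
  induction f₁ using hom_induction with
  | zero =>
    simp [tensorHom_eq, whiskerRight_zero']
  | pure f f' =>
    induction f₂ using hom_induction with
    | zero =>
      simp [tensorHom_eq, whiskerRight_zero', whiskerLeft_zero']
    | pure g g' =>
      induction f₃ using hom_induction with
      | zero =>
        simp [tensorHom_eq, whiskerLeft_zero']
      | pure l l' =>
        simp only [tensorHom_pure]
        change pure k _ _ ≫ pure k _ _ = pure k _ _ ≫ pure k _ _
        rw [pure_comp, pure_comp, MonoidalCategory.associator_naturality,
          MonoidalCategory.associator_naturality]
      | add l l' h h' =>
        simp only [tensorHom_eq, whiskerLeft_add', Preadditive.comp_add, Preadditive.add_comp]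
          at h h' ⊢
        rw [h, h']
    | add g g' h h' =>
      simp only [tensorHom_eq, whiskerLeft_add', whiskerRight_add', Preadditive.comp_add,
        Preadditive.add_comp] at h h' ⊢
      rw [h, h']
  | add f f' h h' =>
    simp only [tensorHom_eq, whiskerRight_add', Preadditive.comp_add,
      Preadditive.add_comp] at h h' ⊢
    rw [h, h']

instance : MonoidalCategory (PreProd k C D) where
  tensorHom_def _ _ := rfl
  id_tensorHom_id X Y := by
    rw [← pure_id, ← pure_id, tensorHom_pure, ← pure_id]
    simp only [MonoidalCategory.id_tensorHom_id]
    rfl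
  tensorHom_comp_tensorHom f₁ f₂ g₁ g₂ := by
    simp only [tensorHom_eq, whiskerLeft_comp', comp_whiskerRight', Category.assoc]
    rw [← Category.assoc (_ ◁ f₂), whisker_exchange', Category.assoc]
  whiskerLeft_id X Y := by
    rw [← pure_id, whiskerLeft_pure, MonoidalCategory.whiskerLeft_id,
      MonoidalCategory.whiskerLeft_id]
    rfl
  id_whiskerRight X Y := by
    rw [← pure_id, whiskerRight_pure, MonoidalCategory.id_whiskerRight,
      MonoidalCategory.id_whiskerRight]
    rfl
  associator_naturality f₁ f₂ f₃ := associator_naturality' f₁ f₂ f₃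
  leftUnitor_naturality f := by
    induction f using hom_induction with
    | zero =>
      simp [whiskerLeft_zero']
    | pure f f' =>
      rw [whiskerLeft_pure]
      change pure k _ _ ≫ pure k _ _ = pure k _ _ ≫ pure k _ _
      rw [pure_comp, pure_comp]
      exact congrArg₂ (pure k) (MonoidalCategory.leftUnitor_naturality _)
        (MonoidalCategory.leftUnitor_naturality _)
    | add f f' h h' =>
      simp [whiskerLeft_add', h, h']
  rightUnitor_naturality f := by
    induction f using hom_induction with
    | zero =>
      simp [whiskerRight_zero']
    | pure f f' =>
      rw [whiskerRight_pure]
      change pure k _ _ ≫ pure k _ _ = pure k _ _ ≫ pure k _ _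
      rw [pure_comp, pure_comp]
      exact congrArg₂ (pure k) (MonoidalCategory.rightUnitor_naturality _)
        (MonoidalCategory.rightUnitor_naturality _)
    | add f f' h h' =>
      simp [whiskerRight_add', h, h']
  pentagon W X Y Z := by
    change pure k _ _ ≫ pure k _ _ ≫ pure k _ _ = pure k _ _ ≫ pure k _ _
    simp only [pure_comp]
    exact congrArg₂ (pure k) (MonoidalCategory.pentagon _ _ _ _)
      (MonoidalCategory.pentagon _ _ _ _)
  triangle X Y := by
    change pure k _ _ ≫ pure k _ _ = pure k _ _
    simp only [pure_comp]
    exact congrArg₂ (pure k) (MonoidalCategory.triangle _ _) (MonoidalCategory.triangle _ _)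

instance : MonoidalPreadditive (PreProd k C D) where
  whiskerLeft_zero := whiskerLeft_zero' _ _ _
  zero_whiskerRight := whiskerRight_zero' _ _ _
  whiskerLeft_add f g := whiskerLeft_add' _ f g
  add_whiskerRight f g := whiskerRight_add' f g _

instance : MonoidalLinear k (PreProd k C D) where
  whiskerLeft_smul X _ _ a f := (whiskerLeft X _ _).map_smul a f
  smul_whiskerRight a _ _ f Z := (whiskerRight _ _ Z).map_smul a f

instance [BraidedCategory C] [BraidedCategory D] : BraidedCategory (PreProd k C D) where
  braiding X Y := mkIso (β_ X.fst Y.fst) (β_ X.snd Y.snd)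
  braiding_naturality_right X Y Z f := by
    induction f using hom_induction with
    | zero =>
      simp
    | pure f f' =>
      change pure k _ _ ≫ pure k _ _ = pure k _ _ ≫ pure k _ _
      rw [pure_comp, pure_comp]
      exact congrArg₂ (pure k) (BraidedCategory.braiding_naturality_right _ _)
        (BraidedCategory.braiding_naturality_right _ _)
    | add f f' h h' =>
      simp [h, h']
  braiding_naturality_left f Z := by
    induction f using hom_induction with
    | zero =>
      simp
    | pure f f' =>
      change pure k _ _ ≫ pure k _ _ = pure k _ _ ≫ pure k _ _
      rw [pure_comp, pure_comp]
      exact congrArg₂ (pure k) (BraidedCategory.braiding_naturality_left _ _)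
        (BraidedCategory.braiding_naturality_left _ _)
    | add f f' h h' =>
      simp [h, h']
  hexagon_forward X Y Z := by
    change pure k _ _ ≫ pure k _ _ ≫ pure k _ _ = pure k _ _ ≫ pure k _ _ ≫ pure k _ _
    simp only [pure_comp]
    exact congrArg₂ (pure k) (BraidedCategory.hexagon_forward _ _ _)
      (BraidedCategory.hexagon_forward _ _ _)
  hexagon_reverse X Y Z := by
    change pure k _ _ ≫ pure k _ _ ≫ pure k _ _ = pure k _ _ ≫ pure k _ _ ≫ pure k _ _
    simp only [pure_comp]
    exact congrArg₂ (pure k) (BraidedCategory.hexagon_reverse _ _ _)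
      (BraidedCategory.hexagon_reverse _ _ _)

instance [SymmetricCategory C] [SymmetricCategory D] : SymmetricCategory (PreProd k C D) where
  symmetry X Y := by
    change pure k _ _ ≫ pure k _ _ = _
    rw [pure_comp, SymmetricCategory.symmetry, SymmetricCategory.symmetry]
    rfl

end PreProd

end ExternalProduct

section KaroubiMonoidal

open CategoryTheory.Idempotents

variable {C : Type u} [Category.{v} C]

instance {k : Type w} [Semiring k] [Preadditive C] [Linear k C] : Linear k (Karoubi C) where
  homModule X Y :=
    { smul a f := ⟨a • f.f, by simp⟩
      one_smul f := Karoubi.hom_ext _ _ (one_smul k f.f)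
      mul_smul a b f := Karoubi.hom_ext _ _ (mul_smul a b f.f)
      smul_zero a := Karoubi.hom_ext _ _ (smul_zero (A := (X.X ⟶ Y.X)) a)
      smul_add a f g := Karoubi.hom_ext _ _ (smul_add a f.f g.f)
      add_smul a b f := Karoubi.hom_ext _ _ (add_smul a b f.f)
      zero_smul f := Karoubi.hom_ext _ _ (zero_smul k f.f) }
  smul_comp X Y Z a f g := Karoubi.hom_ext _ _ (Linear.smul_comp _ _ _ a f.f g.f)
  comp_smul X Y Z f a g := Karoubi.hom_ext _ _ (Linear.comp_smul _ _ _ f.f a g.f)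

variable [MonoidalCategory C]

namespace KaroubiMonoidal

/-- The tensor product `(X, p) ⊗ (Y, q) = (X ⊗ Y, p ⊗ q)`. -/
def tensorObj (P Q : Karoubi C) : Karoubi C where
  X := P.X ⊗ Q.X
  p := P.p ⊗ₘ Q.p
  idem := by rw [MonoidalCategory.tensorHom_comp_tensorHom, P.idem, Q.idem]

/-- The tensor product of morphisms. -/
def tensorHom {P Q P' Q' : Karoubi C} (f : P ⟶ P') (g : Q ⟶ Q') :
    tensorObj P Q ⟶ tensorObj P' Q' where
  f := f.f ⊗ₘ g.f
  comm := by
    simp only [tensorObj, MonoidalCategory.tensorHom_comp_tensorHom, f.comm, g.comm]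

/-- An isomorphism of the underlying objects that commutes with the idempotents. -/
def mkIso {P Q : Karoubi C} (e : P.X ≅ Q.X) (h : P.p ≫ e.hom = e.hom ≫ Q.p) : P ≅ Q where
  hom := ⟨P.p ≫ e.hom, by rw [Category.assoc, ← h, P.idem_assoc, P.idem_assoc]⟩
  inv := ⟨e.inv ≫ P.p, by
    have h' : Q.p ≫ e.inv = e.inv ≫ P.p := by rw [Iso.comp_inv_eq, Category.assoc, h]; simp
    rw [← Category.assoc, ← Category.assoc, h']; simp⟩
  hom_inv_id := by ext; simp
  inv_hom_id := by
    ext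
    rw [Karoubi.comp_f, Category.assoc, P.idem_assoc, h]; simp

section aux

variable {A₁ A₂ A₃ A₄ B₁ B₂ B₃ : C}

lemma aux_associator {p₁ : A₁ ⟶ A₁} {p₂ : A₂ ⟶ A₂} {p₃ : A₃ ⟶ A₃} {q₁ : B₁ ⟶ B₁} {q₂ : B₂ ⟶ B₂}
    {q₃ : B₃ ⟶ B₃} {f₁ : A₁ ⟶ B₁} {f₂ : A₂ ⟶ B₂} {f₃ : A₃ ⟶ B₃}
    (h₁ : p₁ ≫ f₁ = f₁) (h₂ : p₂ ≫ f₂ = f₂) (h₃ : p₃ ≫ f₃ = f₃)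
    (h₁' : f₁ ≫ q₁ = f₁) (h₂' : f₂ ≫ q₂ = f₂) (h₃' : f₃ ≫ q₃ = f₃) :
    ((f₁ ⊗ₘ f₂) ⊗ₘ f₃) ≫ ((q₁ ⊗ₘ q₂) ⊗ₘ q₃) ≫ (α_ B₁ B₂ B₃).hom =
      (((p₁ ⊗ₘ p₂) ⊗ₘ p₃) ≫ (α_ A₁ A₂ A₃).hom) ≫ (f₁ ⊗ₘ (f₂ ⊗ₘ f₃)) := by
  rw [Category.assoc, ← MonoidalCategory.associator_naturality, ← Category.assoc,
    ← Category.assoc]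
  simp only [MonoidalCategory.tensorHom_comp_tensorHom, h₁, h₂, h₃, h₁', h₂', h₃']

lemma aux_pentagon {p : A₁ ⟶ A₁} {q : A₂ ⟶ A₂} {r : A₃ ⟶ A₃} {s : A₄ ⟶ A₄}
    (hp : p ≫ p = p) (hq : q ≫ q = q) (hr : r ≫ r = r) (hs : s ≫ s = s) :
    ((((p ⊗ₘ q) ⊗ₘ r) ≫ (α_ A₁ A₂ A₃).hom) ⊗ₘ s) ≫
      (((p ⊗ₘ (q ⊗ₘ r)) ⊗ₘ s) ≫ (α_ A₁ (A₂ ⊗ A₃) A₄).hom) ≫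
        (p ⊗ₘ (((q ⊗ₘ r) ⊗ₘ s) ≫ (α_ A₂ A₃ A₄).hom)) =
    ((((p ⊗ₘ q) ⊗ₘ r) ⊗ₘ s) ≫ (α_ (A₁ ⊗ A₂) A₃ A₄).hom) ≫
      (((p ⊗ₘ q) ⊗ₘ (r ⊗ₘ s)) ≫ (α_ A₁ A₂ (A₃ ⊗ A₄)).hom) := by
  have e₁ : (p ⊗ₘ (((q ⊗ₘ r) ⊗ₘ s) ≫ (α_ A₂ A₃ A₄).hom)) =
      (p ⊗ₘ ((q ⊗ₘ r) ⊗ₘ s)) ≫ (A₁ ◁ (α_ A₂ A₃ A₄).hom) := by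
    rw [← MonoidalCategory.id_tensorHom, MonoidalCategory.tensorHom_comp_tensorHom,
      Category.comp_id]
  have e₂ : ((((p ⊗ₘ q) ⊗ₘ r) ≫ (α_ A₁ A₂ A₃).hom) ⊗ₘ s) =
      ((α_ A₁ A₂ A₃).hom ▷ A₄) ≫ ((p ⊗ₘ (q ⊗ₘ r)) ⊗ₘ s) := by
    rw [← MonoidalCategory.tensorHom_id, MonoidalCategory.tensorHom_comp_tensorHom,
      Category.id_comp, MonoidalCategory.associator_naturality]
  have e₃ : (α_ A₁ A₂ A₃).hom ▷ A₄ ≫ ((p ⊗ₘ (q ⊗ₘ r)) ⊗ₘ s) =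
      (((p ⊗ₘ q) ⊗ₘ r) ⊗ₘ s) ≫ (α_ A₁ A₂ A₃).hom ▷ A₄ := by
    rw [← e₂, ← MonoidalCategory.tensorHom_id, MonoidalCategory.tensorHom_comp_tensorHom,
      Category.comp_id]
  have i₁ : ((p ⊗ₘ (q ⊗ₘ r)) ⊗ₘ s) ≫ ((p ⊗ₘ (q ⊗ₘ r)) ⊗ₘ s) = ((p ⊗ₘ (q ⊗ₘ r)) ⊗ₘ s) := by
    simp only [MonoidalCategory.tensorHom_comp_tensorHom, hp, hq, hr, hs]
  have i₂ : (((p ⊗ₘ q) ⊗ₘ r) ⊗ₘ s) ≫ (((p ⊗ₘ q) ⊗ₘ r) ⊗ₘ s) = (((p ⊗ₘ q) ⊗ₘ r) ⊗ₘ s) := by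
    simp only [MonoidalCategory.tensorHom_comp_tensorHom, hp, hq, hr, hs]
  calc _ = (((p ⊗ₘ q) ⊗ₘ r) ⊗ₘ s) ≫ (α_ A₁ A₂ A₃).hom ▷ A₄ ≫ (α_ A₁ (A₂ ⊗ A₃) A₄).hom ≫
          A₁ ◁ (α_ A₂ A₃ A₄).hom := by
        rw [e₁, e₂]
        simp only [Category.assoc]
        rw [← MonoidalCategory.associator_naturality_assoc, reassoc_of% i₁, reassoc_of% i₁,
          reassoc_of% e₃]
    _ = _ := by
        rw [MonoidalCategory.pentagon]
        simp only [Category.assoc]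
        rw [← MonoidalCategory.associator_naturality_assoc, reassoc_of% i₂]

lemma aux_triangle {p : A₁ ⟶ A₁} {q : A₂ ⟶ A₂} (hp : p ≫ p = p) (hq : q ≫ q = q) :
    (((p ⊗ₘ 𝟙 (𝟙_ C)) ⊗ₘ q) ≫ (α_ A₁ (𝟙_ C) A₂).hom) ≫
        (p ⊗ₘ ((𝟙 (𝟙_ C) ⊗ₘ q) ≫ (λ_ A₂).hom)) =
      ((p ⊗ₘ 𝟙 (𝟙_ C)) ≫ (ρ_ A₁).hom) ⊗ₘ q := by
  have e : (p ⊗ₘ ((𝟙 (𝟙_ C) ⊗ₘ q) ≫ (λ_ A₂).hom)) =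
      (p ⊗ₘ (𝟙 (𝟙_ C) ⊗ₘ q)) ≫ A₁ ◁ (λ_ A₂).hom := by
    rw [← MonoidalCategory.id_tensorHom A₁, MonoidalCategory.tensorHom_comp_tensorHom,
      Category.comp_id]
  rw [e, Category.assoc, ← MonoidalCategory.associator_naturality_assoc,
    MonoidalCategory.triangle, ← MonoidalCategory.tensorHom_id (ρ_ A₁).hom]
  simp only [MonoidalCategory.tensorHom_comp_tensorHom, ← Category.assoc, hp, hq,
    Category.comp_id]

lemma aux_leftUnitor {p : A₁ ⟶ A₁} {q : B₁ ⟶ B₁} {f : A₁ ⟶ B₁} (h : p ≫ f = f)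
    (h' : f ≫ q = f) :
    (𝟙 (𝟙_ C) ⊗ₘ f) ≫ (𝟙 (𝟙_ C) ⊗ₘ q) ≫ (λ_ B₁).hom =
      ((𝟙 (𝟙_ C) ⊗ₘ p) ≫ (λ_ A₁).hom) ≫ f := by
  simp [h, h']

lemma aux_rightUnitor {p : A₁ ⟶ A₁} {q : B₁ ⟶ B₁} {f : A₁ ⟶ B₁} (h : p ≫ f = f)
    (h' : f ≫ q = f) :
    (f ⊗ₘ 𝟙 (𝟙_ C)) ≫ (q ⊗ₘ 𝟙 (𝟙_ C)) ≫ (ρ_ B₁).hom =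
      ((p ⊗ₘ 𝟙 (𝟙_ C)) ≫ (ρ_ A₁).hom) ≫ f := by
  simp [h, h']

end aux

end KaroubiMonoidal

open KaroubiMonoidal

instance : MonoidalCategoryStruct (Karoubi C) where
  tensorObj := KaroubiMonoidal.tensorObj
  tensorHom := KaroubiMonoidal.tensorHom
  whiskerLeft P _ _ f := KaroubiMonoidal.tensorHom (𝟙 P) f
  whiskerRight f Q := KaroubiMonoidal.tensorHom f (𝟙 Q)
  tensorUnit := ⟨𝟙_ C, 𝟙 _, Category.id_comp _⟩
  associator P Q R := mkIso (α_ P.X Q.X R.X) (MonoidalCategory.associator_naturality _ _ _)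
  leftUnitor P := mkIso (λ_ P.X) (by
    simp [KaroubiMonoidal.tensorObj])
  rightUnitor P := mkIso (ρ_ P.X) (by
    simp [KaroubiMonoidal.tensorObj])

namespace KaroubiMonoidal

@[simp] lemma tensorObj_X (P Q : Karoubi C) : (P ⊗ Q).X = P.X ⊗ Q.X := rfl
@[simp] lemma tensorObj_p (P Q : Karoubi C) : (P ⊗ Q).p = P.p ⊗ₘ Q.p := rfl
@[simp] lemma tensorUnit_X : (𝟙_ (Karoubi C)).X = 𝟙_ C := rfl
@[simp] lemma tensorUnit_p : (𝟙_ (Karoubi C)).p = 𝟙 (𝟙_ C) := rfl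
@[simp] lemma tensorHom_f {P Q P' Q' : Karoubi C} (f : P ⟶ P') (g : Q ⟶ Q') :
    (f ⊗ₘ g).f = f.f ⊗ₘ g.f := rfl
@[simp] lemma whiskerLeft_f (P : Karoubi C) {Q Q' : Karoubi C} (g : Q ⟶ Q') :
    (P ◁ g).f = P.p ⊗ₘ g.f := rfl
@[simp] lemma whiskerRight_f {P P' : Karoubi C} (f : P ⟶ P') (Q : Karoubi C) :
    (f ▷ Q).f = f.f ⊗ₘ Q.p := rfl
@[simp] lemma associator_hom_f (P Q R : Karoubi C) :
    (α_ P Q R).hom.f = ((P.p ⊗ₘ Q.p) ⊗ₘ R.p) ≫ (α_ P.X Q.X R.X).hom := rfl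
@[simp] lemma associator_inv_f (P Q R : Karoubi C) :
    (α_ P Q R).inv.f = (α_ P.X Q.X R.X).inv ≫ ((P.p ⊗ₘ Q.p) ⊗ₘ R.p) := rfl
@[simp] lemma leftUnitor_hom_f (P : Karoubi C) :
    (λ_ P).hom.f = (𝟙 (𝟙_ C) ⊗ₘ P.p) ≫ (λ_ P.X).hom := rfl
@[simp] lemma rightUnitor_hom_f (P : Karoubi C) :
    (ρ_ P).hom.f = (P.p ⊗ₘ 𝟙 (𝟙_ C)) ≫ (ρ_ P.X).hom := rfl

end KaroubiMonoidal

instance : MonoidalCategory (Karoubi C) := MonoidalCategory.ofTensorHom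
  (id_tensorHom_id := fun _ _ => rfl)
  (id_tensorHom := fun _ _ _ _ => rfl)
  (tensorHom_id := fun _ _ => rfl)
  (tensorHom_comp_tensorHom := fun f₁ f₂ g₁ g₂ => Karoubi.hom_ext _ _
    (MonoidalCategory.tensorHom_comp_tensorHom f₁.f f₂.f g₁.f g₂.f))
  (associator_naturality := fun f₁ f₂ f₃ => Karoubi.hom_ext _ _
    (aux_associator (Karoubi.p_comp f₁) (Karoubi.p_comp f₂) (Karoubi.p_comp f₃)
      (Karoubi.comp_p f₁) (Karoubi.comp_p f₂) (Karoubi.comp_p f₃)))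
  (leftUnitor_naturality := fun f => Karoubi.hom_ext _ _
    (aux_leftUnitor (Karoubi.p_comp f) (Karoubi.comp_p f)))
  (rightUnitor_naturality := fun f => Karoubi.hom_ext _ _
    (aux_rightUnitor (Karoubi.p_comp f) (Karoubi.comp_p f)))
  (pentagon := fun W X Y Z => Karoubi.hom_ext _ _ (aux_pentagon W.idem X.idem Y.idem Z.idem))
  (triangle := fun X Y => Karoubi.hom_ext _ _ (aux_triangle X.idem Y.idem))

instance [Preadditive C] [MonoidalPreadditive C] : MonoidalPreadditive (Karoubi C) where
  whiskerLeft_zero {X Y Z} := Karoubi.hom_ext _ _ (by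
    change X.p ⊗ₘ (0 : Y.X ⟶ Z.X) = 0
    simp [MonoidalCategory.tensorHom_def])
  zero_whiskerRight {X Y Z} := Karoubi.hom_ext _ _ (by
    change (0 : Y.X ⟶ Z.X) ⊗ₘ X.p = 0
    simp [MonoidalCategory.tensorHom_def])
  whiskerLeft_add {X Y Z} f g := Karoubi.hom_ext _ _ (by
    change X.p ⊗ₘ (f.f + g.f) = (X.p ⊗ₘ f.f) + (X.p ⊗ₘ g.f)
    simp [MonoidalCategory.tensorHom_def])
  add_whiskerRight {X Y Z} f g := Karoubi.hom_ext _ _ (by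
    change (f.f + g.f) ⊗ₘ X.p = (f.f ⊗ₘ X.p) + (g.f ⊗ₘ X.p)
    simp [MonoidalCategory.tensorHom_def])

instance {k : Type w} [Semiring k] [Preadditive C] [Linear k C] [MonoidalPreadditive C]
    [MonoidalLinear k C] : MonoidalLinear k (Karoubi C) where
  whiskerLeft_smul X _ _ a f := Karoubi.hom_ext _ _ (by
    change X.p ⊗ₘ (a • f.f) = a • (X.p ⊗ₘ f.f)
    simp [MonoidalCategory.tensorHom_def])
  smul_whiskerRight a _ _ f Z := Karoubi.hom_ext _ _ (by
    change (a • f.f) ⊗ₘ Z.p = a • (f.f ⊗ₘ Z.p)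
    simp [MonoidalCategory.tensorHom_def])

namespace KaroubiMonoidal

section aux

variable [BraidedCategory C] {A₁ A₂ A₃ B₁ B₂ : C}

lemma aux_braiding {p₁ : A₁ ⟶ A₁} {p₂ : A₂ ⟶ A₂} {q₁ : B₁ ⟶ B₁} {q₂ : B₂ ⟶ B₂}
    {f₁ : A₁ ⟶ B₁} {f₂ : A₂ ⟶ B₂} (h₁ : p₁ ≫ f₁ = f₁) (h₂ : p₂ ≫ f₂ = f₂)
    (h₁' : f₁ ≫ q₁ = f₁) (h₂' : f₂ ≫ q₂ = f₂) :
    (f₁ ⊗ₘ f₂) ≫ (q₁ ⊗ₘ q₂) ≫ (β_ B₁ B₂).hom =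
      ((p₁ ⊗ₘ p₂) ≫ (β_ A₁ A₂).hom) ≫ (f₂ ⊗ₘ f₁) := by
  rw [Category.assoc, ← BraidedCategory.braiding_naturality, ← Category.assoc, ← Category.assoc]
  simp only [MonoidalCategory.tensorHom_comp_tensorHom, h₁, h₂, h₁', h₂']

lemma aux_hexagon_forward {p : A₁ ⟶ A₁} {q : A₂ ⟶ A₂} {r : A₃ ⟶ A₃}
    (hp : p ≫ p = p) (hq : q ≫ q = q) (hr : r ≫ r = r) :
    (((p ⊗ₘ q) ⊗ₘ r) ≫ (α_ A₁ A₂ A₃).hom) ≫ ((p ⊗ₘ (q ⊗ₘ r)) ≫ (β_ A₁ (A₂ ⊗ A₃)).hom) ≫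
        (((q ⊗ₘ r) ⊗ₘ p) ≫ (α_ A₂ A₃ A₁).hom) =
      (((p ⊗ₘ q) ≫ (β_ A₁ A₂).hom) ⊗ₘ r) ≫ (((q ⊗ₘ p) ⊗ₘ r) ≫ (α_ A₂ A₁ A₃).hom) ≫
        (q ⊗ₘ ((p ⊗ₘ r) ≫ (β_ A₁ A₃).hom)) := by
  have e₁ : (((p ⊗ₘ q) ≫ (β_ A₁ A₂).hom) ⊗ₘ r) =
      ((β_ A₁ A₂).hom ▷ A₃) ≫ ((q ⊗ₘ p) ⊗ₘ r) := by
    rw [← MonoidalCategory.tensorHom_id, MonoidalCategory.tensorHom_comp_tensorHom,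
      Category.id_comp, BraidedCategory.braiding_naturality]
  have e₂ : (q ⊗ₘ ((p ⊗ₘ r) ≫ (β_ A₁ A₃).hom)) =
      (A₂ ◁ (β_ A₁ A₃).hom) ≫ (q ⊗ₘ (r ⊗ₘ p)) := by
    rw [← MonoidalCategory.id_tensorHom, MonoidalCategory.tensorHom_comp_tensorHom,
      Category.id_comp, BraidedCategory.braiding_naturality]
  have e₃ : (q ⊗ₘ (p ⊗ₘ r)) ≫ (A₂ ◁ (β_ A₁ A₃).hom) =
      (A₂ ◁ (β_ A₁ A₃).hom) ≫ (q ⊗ₘ (r ⊗ₘ p)) := by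
    rw [← e₂, ← MonoidalCategory.id_tensorHom, MonoidalCategory.tensorHom_comp_tensorHom,
      Category.comp_id]
  rw [e₁, e₂]
  simp only [Category.assoc, MonoidalCategory.associator_naturality,
    MonoidalCategory.associator_naturality_assoc, BraidedCategory.braiding_naturality_assoc,
    MonoidalCategory.tensorHom_comp_tensorHom, reassoc_of% e₃, hp, hq, hr]
  simp only [← Category.assoc]
  congr 1
  simp only [Category.assoc]
  exact BraidedCategory.hexagon_forward _ _ _

lemma aux_hexagon_reverse {p : A₁ ⟶ A₁} {q : A₂ ⟶ A₂} {r : A₃ ⟶ A₃}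
    (hp : p ≫ p = p) (hq : q ≫ q = q) (hr : r ≫ r = r) :
    ((α_ A₁ A₂ A₃).inv ≫ ((p ⊗ₘ q) ⊗ₘ r)) ≫ (((p ⊗ₘ q) ⊗ₘ r) ≫ (β_ (A₁ ⊗ A₂) A₃).hom) ≫
        ((α_ A₃ A₁ A₂).inv ≫ ((r ⊗ₘ p) ⊗ₘ q)) =
      (p ⊗ₘ ((q ⊗ₘ r) ≫ (β_ A₂ A₃).hom)) ≫ ((α_ A₁ A₃ A₂).inv ≫ ((p ⊗ₘ r) ⊗ₘ q)) ≫
        (((p ⊗ₘ r) ≫ (β_ A₁ A₃).hom) ⊗ₘ q) := by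
  have e₁ : (((p ⊗ₘ r) ≫ (β_ A₁ A₃).hom) ⊗ₘ q) =
      ((β_ A₁ A₃).hom ▷ A₂) ≫ ((r ⊗ₘ p) ⊗ₘ q) := by
    rw [← MonoidalCategory.tensorHom_id, MonoidalCategory.tensorHom_comp_tensorHom,
      Category.id_comp, BraidedCategory.braiding_naturality]
  have e₂ : (p ⊗ₘ ((q ⊗ₘ r) ≫ (β_ A₂ A₃).hom)) =
      (A₁ ◁ (β_ A₂ A₃).hom) ≫ (p ⊗ₘ (r ⊗ₘ q)) := by
    rw [← MonoidalCategory.id_tensorHom, MonoidalCategory.tensorHom_comp_tensorHom,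
      Category.id_comp, BraidedCategory.braiding_naturality]
  have e₃ : ((p ⊗ₘ r) ⊗ₘ q) ≫ ((β_ A₁ A₃).hom ▷ A₂) =
      ((β_ A₁ A₃).hom ▷ A₂) ≫ ((r ⊗ₘ p) ⊗ₘ q) := by
    rw [← e₁, ← MonoidalCategory.tensorHom_id, MonoidalCategory.tensorHom_comp_tensorHom,
      Category.comp_id]
  rw [e₁, e₂]
  simp only [Category.assoc, MonoidalCategory.associator_inv_naturality_assoc, BraidedCategory.braiding_naturality_assoc,
    MonoidalCategory.tensorHom_comp_tensorHom, reassoc_of% e₃, hp, hq, hr]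
  simp only [← Category.assoc]
  congr 1
  simp only [Category.assoc]
  exact BraidedCategory.hexagon_reverse _ _ _

end aux

end KaroubiMonoidal

instance [BraidedCategory C] : BraidedCategory (Karoubi C) where
  braiding P Q := mkIso (β_ P.X Q.X) (BraidedCategory.braiding_naturality _ _)
  braiding_naturality_right X _ _ f := Karoubi.hom_ext _ _
    (aux_braiding X.idem (Karoubi.p_comp f) X.idem (Karoubi.comp_p f))
  braiding_naturality_left f Z := Karoubi.hom_ext _ _
    (aux_braiding (Karoubi.p_comp f) Z.idem (Karoubi.comp_p f) Z.idem)
  hexagon_forward X Y Z := Karoubi.hom_ext _ _ (aux_hexagon_forward X.idem Y.idem Z.idem)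
  hexagon_reverse X Y Z := Karoubi.hom_ext _ _ (aux_hexagon_reverse X.idem Y.idem Z.idem)

instance [SymmetricCategory C] : SymmetricCategory (Karoubi C) where
  symmetry X Y := Karoubi.hom_ext _ _ (by
    change ((X.p ⊗ₘ Y.p) ≫ (β_ X.X Y.X).hom) ≫ ((Y.p ⊗ₘ X.p) ≫ (β_ Y.X X.X).hom) = X.p ⊗ₘ Y.p
    rw [BraidedCategory.braiding_naturality Y.p X.p, Category.assoc,
      SymmetricCategory.symmetry_assoc,
      MonoidalCategory.tensorHom_comp_tensorHom, X.idem, Y.idem])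

end KaroubiMonoidal

section Symmetric

open CategoryTheory.Idempotents

/-- The external tensor product `C ⊠ D` of `k`-linear tensor categories: the Karoubian envelope
of `C ×ₖ D`. -/
abbrev ExtProd (k : Type w) [CommRing k] (C : Type u₁) [Category.{v₁} C] [Preadditive C]
    [Linear k C] (D : Type u₂) [Category.{v₂} D] [Preadditive D] [Linear k D] :=
  Karoubi (PreProd k C D)

/-- Equivalence of `k`-linear symmetric monoidal categories: there is a `k`-linear (strong)
symmetric monoidal functor which is an equivalence of categories. -/
def SymmetricEquivalent (k : Type w) [CommRing k]
    (C : Type u₁) [Category.{v₁} C] [Preadditive C] [Linear k C]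
    [MonoidalCategory C] [SymmetricCategory C]
    (D : Type u₂) [Category.{v₂} D] [Preadditive D] [Linear k D]
    [MonoidalCategory D] [SymmetricCategory D] : Prop :=
  ∃ (F : C ⥤ D) (_ : F.Braided), F.Additive ∧ F.Linear k ∧ F.IsEquivalence

variable {C : Type u} [Category.{v} C] [Preadditive C]

open Limits in
/-- A fusion subcategory of a fusion category, as a property of objects: a full subcategory which
contains the unit object and is closed under tensor products, direct sums and direct summands
(hence also under isomorphisms). -/
structure IsFusionSubcategory [MonoidalCategory C] (P : ObjectProperty C) : Prop
    extends P.IsMonoidal, P.IsStableUnderRetracts where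
  prop_biprod {X Y : C} (b : BinaryBicone X Y) (hb : b.IsBilimit) : P X → P Y → P b.pt

open Limits in
/-- The full subcategory of finite direct sums of objects satisfying `P`. -/
def directSums (P : ObjectProperty C) : ObjectProperty C := fun X =>
  ∃ (n : ℕ) (Y : Fin n → C) (b : Bicone Y),
    (∀ i, P (Y i)) ∧ Nonempty b.IsBilimit ∧ Nonempty (X ≅ b.pt)

end Symmetric

section Ver

variable (k : Type u) [Field k] (p : ℕ)

/-- The cyclic group of order `p`, written multiplicatively. -/
abbrev Cyc := Multiplicative (ZMod p)

/-- The generator `σ` of the cyclic group, as an element of the group algebra. -/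
def sigma : MonoidAlgebra k (Cyc p) := MonoidAlgebra.of k (Cyc p) (Multiplicative.ofAdd 1)

/-- The underlying space `k[σ] / (1 - σ) ^ s` of the module `L_s`, where `k[σ]` is the group
algebra of the cyclic group. -/
abbrev LSpace (s : ℕ) : Type u :=
  MonoidAlgebra k (Cyc p) ⧸ Ideal.span {(1 - sigma k p) ^ s}

/-- The representation `L_s` of the cyclic group, by multiplication on `k[σ] / (1 - σ) ^ s`. -/
def LRep (s : ℕ) : Representation k (Cyc p) (LSpace k p s) :=
  (Algebra.lmul k (LSpace k p s) : _ →* Module.End k (LSpace k p s)).comp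
    ((Ideal.Quotient.mk (Ideal.span {(1 - sigma k p) ^ s}) : _ →* LSpace k p s).comp
      (MonoidAlgebra.of k (Cyc p)))

/-- The universal Verlinde category: the quotient of the category of finite-dimensional
representations of the cyclic group of order `p` by the negligible morphisms. -/
abbrev Ver := NegQuotient k (FDRep k (Cyc p))

variable [NeZero p]

/-- The image of the indecomposable representation `L_s` in the Verlinde category. -/
def L (s : ℕ) : Ver k p := (NegQuotient.proj k).obj (FDRep.of (LRep k p s))

/-- The subcategory `Vec` of the Verlinde category: direct sums of the unit object `L_1`. -/
def VerVec : ObjectProperty (Ver k p) := directSums fun X => X = L k p 1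

/-- The subcategory `sVec` of the Verlinde category: direct sums of `L_1` and `L_{p-1}`. -/
def VerSVec : ObjectProperty (Ver k p) := directSums fun X => X = L k p 1 ∨ X = L k p (p - 1)

/-- The subcategory `Ver_p^+` of the Verlinde category: direct sums of the `L_s` with `s` odd. -/
def VerPlus : ObjectProperty (Ver k p) :=
  directSums fun X => ∃ s, Odd s ∧ s < p ∧ X = L k p s

end Ver

end Verlinde

end

/-! The group algebra `k[C_p]` is `k[X]/X^p` with `X = 1 - σ`, so the structure theorem over `k[X]`
splits every representation into copies of `L_s = k[X]/X^s` with `s ≤ p`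
(`exists_isDirectSum_LObj`). An endomorphism of `L_s` is a scalar `c` plus a nilpotent and has trace
`s * c`; hence nilpotent endomorphisms are negligible, and the identity of `L_s` is negligible for
`s = p` but not for `0 < s < p`. Maps between `L_s` and `L_t` with `s ≠ t` are negligible too. In
`Ver_p` the `L_s` with `0 < s < p` therefore behave as pairwise non-isomorphic simple objects with
endomorphism ring `k`, and every object is a direct sum of them, governed by the multiplicities `dim
Hom(L_t, X)` (`mult`, `mult_L`).

The fusion rules come from one explicit splitting, `L_2 ⊗ L_s ≅ L_{s+1} ⊕ L_{s-1}` for `1 < s < p`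
(`isBiprod_tensor_two`), where `L_p` dies in `Ver_p`. Induction on `r` gives the truncated
Clebsch-Gordan rule for `L_r ⊗ L_s` (`mult_L_tensor_L`). Fusion subcategories then correspond to
sets of labels that contain 1 and are closed under this rule (`IsFusionClosed`). A label strictly
between 1 and `p - 1` has 3 in its square; 3 produces all odd labels; one further even label
produces `p - 1`, and then everything (`IsFusionClosed.eq_or`). This gives (i) and (ii).

For (iii), the functor `(X, Y) ↦ X ⊗ Y` from `Ver_p^+ × sVec` to `Ver_p` is braided because the
braiding is symmetric. Since `L_s ⊗ L_{p-1} ≅ L_{p-s}` and `p` is odd, it sends pairs of simple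
objects bijectively to simple objects, so it is fully faithful and every object is a retract of its
image. As `Ver_p` is idempotent complete (idempotents lift along quotients of finite-dimensional
algebras), it is the Karoubian envelope of the source (`symmetricEquivalent_karoubi`). -/

noncomputable section

open CategoryTheory MonoidalCategory
open scoped TensorProduct

namespace Verlinde

/-! ### The categorical trace of representations is the linear trace. -/

section RepLin

variable {k : Type u} [Field k] {G : Type v} [Group G]

/-- The linear map underlying a morphism of representations. -/
def repLin {V W : FDRep k G} (f : V ⟶ W) : V →ₗ[k] W := f.hom.hom.hom

/-- An equivariant linear map as a morphism of representations. -/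
def repHom {V W : FDRep k G} (f : V →ₗ[k] W) (h : ∀ g v, f (V.ρ g v) = W.ρ g (f v)) : V ⟶ W where
  hom := ObjectProperty.homMk (ModuleCat.ofHom f)
  comm g := FGModuleCat.hom_ext (LinearMap.ext fun v => h g v)

lemma repLin_injective {V W : FDRep k G} {f g : V ⟶ W} (h : repLin f = repLin g) : f = g :=
  Action.Hom.ext (FGModuleCat.hom_ext h)

@[simp] lemma repLin_id (V : FDRep k G) : repLin (𝟙 V) = LinearMap.id := rfl

@[simp] lemma repLin_sub {V W : FDRep k G} (f g : V ⟶ W) :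
    repLin (f - g) = repLin f - repLin g := rfl

@[simp] lemma repLin_smul {V W : FDRep k G} (c : k) (f : V ⟶ W) :
    repLin (c • f) = c • repLin f := rfl

lemma repLin_sum {V W : FDRep k G} {ι : Type*} (s : Finset ι) (f : ι → (V ⟶ W)) :
    repLin (∑ i ∈ s, f i) = ∑ i ∈ s, repLin (f i) :=
  map_sum (AddMonoidHom.mk' (fun f : V ⟶ W => repLin f) (fun _ _ => rfl)) f s

lemma repLin_equivariant {V W : FDRep k G} (f : V ⟶ W) (g : G) (v : V) :
    repLin f (V.ρ g v) = W.ρ g (repLin f v) :=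
  congrArg (fun φ : V.V ⟶ W.V => φ.hom.hom v) (f.comm g)

/-- A bijective equivariant linear map is an isomorphism of representations. -/
def repIso {V W : FDRep k G} (e : V ≃ₗ[k] W) (h : ∀ g v, e (V.ρ g v) = W.ρ g (e v)) : V ≅ W where
  hom := repHom e.toLinearMap h
  inv := repHom e.symm.toLinearMap (fun g w => by
    obtain ⟨v, rfl⟩ := e.surjective w
    change e.symm (W.ρ g (e v)) = V.ρ g (e.symm (e v))
    rw [← h, e.symm_apply_apply, e.symm_apply_apply])
  hom_inv_id := repLin_injective (LinearMap.ext fun v => e.symm_apply_apply v)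
  inv_hom_id := repLin_injective (LinearMap.ext fun v => e.apply_symm_apply v)

/-- A tensor `v ⊗ w` acts on `V` as the rank one map `x ↦ ev (w ⊗ x) • v`. Contracting `f` against
any tensor gives the trace of `f` composed with this action, by linearity from pure tensors, and the
zigzag identity says that `co` acts as the identity. No explicit form of the dual is needed. -/
lemma trace_eq_of_zigzag {V W : Type*} [AddCommGroup V] [Module k V] [Module.Finite k V]
    [AddCommGroup W] [Module k W] (ev : W ⊗[k] V →ₗ[k] k) (co : V ⊗[k] W)
    (h : ∀ x, TensorProduct.rid k V (ev.lTensor V (TensorProduct.assoc k V W V (co ⊗ₜ x))) = x)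
    (f : V →ₗ[k] V) :
    ev (TensorProduct.comm k V W (TensorProduct.map f LinearMap.id co)) =
      LinearMap.trace k V f := by
  let T : V ⊗[k] W →ₗ[k] (V →ₗ[k] V) :=
    ((LinearMap.llcomp k V (V ⊗[k] (W ⊗[k] V)) V
      ((TensorProduct.rid k V).toLinearMap ∘ₗ ev.lTensor V)) ∘ₗ
      (LinearMap.llcomp k V ((V ⊗[k] W) ⊗[k] V) (V ⊗[k] (W ⊗[k] V))
        (TensorProduct.assoc k V W V).toLinearMap)) ∘ₗ TensorProduct.mk k (V ⊗[k] W) V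
  have hT : T co = LinearMap.id := LinearMap.ext h
  have h2 (c : V ⊗[k] W) : ev (TensorProduct.comm k V W (TensorProduct.map f LinearMap.id c)) =
      LinearMap.trace k V (f ∘ₗ T c) := by
    induction c using TensorProduct.induction_on with
    | zero => simp
    | add a b ha hb => simp only [map_add, ha, hb, LinearMap.comp_add]
    | tmul v w =>
      have : f ∘ₗ T (v ⊗ₜ w) =
          LinearMap.smulRight (ev ∘ₗ TensorProduct.mk k _ _ w) (f v) := by
        ext x
        simp [T]
      rw [this, LinearMap.trace_smulRight]
      simp
  rw [h2, hT, LinearMap.comp_id]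

lemma repLin_associator (V W Z : FDRep k G) :
    repLin (α_ V W Z).hom = (TensorProduct.assoc k V W Z).toLinearMap :=
  TensorProduct.ext_threefold fun _ _ _ => rfl

lemma symTrace_apply_one {V : FDRep k G} (f : V ⟶ V) :
    repLin (symTrace f) (1 : k) = LinearMap.trace k V (repLin f) := by
  refine trace_eq_of_zigzag (k := k) (V := V) (W := (Vᘁ : FDRep k G)) (repLin (ε_ V Vᘁ))
    (repLin (η_ V Vᘁ) (1 : k)) (fun x => ?_) (repLin f)
  -- The duality axiom evaluated at `1 ⊗ x` is the zigzag hypothesis, up to unitors.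
  have h := congrArg (fun φ => TensorProduct.rid k V (repLin φ ((1 : k) ⊗ₜ[k] x)))
    (ExactPairing.evaluation_coevaluation V Vᘁ)
  refine Eq.trans ?_ (h.trans ?_)
  · refine congrArg (fun t => TensorProduct.rid k V (repLin (V ◁ ε_ V Vᘁ) t)) ?_
    exact (LinearMap.congr_fun (repLin_associator V Vᘁ V) (repLin (η_ V Vᘁ) (1 : k) ⊗ₜ[k] x)).symm
  · change TensorProduct.rid k V (repLin (ρ_ V).inv (repLin (λ_ V).hom ((1 : k) ⊗ₜ[k] x))) = _
    have : repLin (λ_ V).hom ((1 : k) ⊗ₜ[k] x) = x := one_smul k x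
    rw [this]
    exact one_smul k x

lemma symTrace_eq_zero_iff {V : FDRep k G} (f : V ⟶ V) :
    symTrace f = 0 ↔ LinearMap.trace k V (repLin f) = 0 := by
  rw [← symTrace_apply_one]
  constructor
  · intro h; rw [h]; rfl
  · intro h
    apply repLin_injective
    exact LinearMap.ext_ring h

lemma isNegligible_iff_trace {V W : FDRep k G} (f : V ⟶ W) :
    IsNegligible f ↔ ∀ u : W ⟶ V, LinearMap.trace k V (repLin u ∘ₗ repLin f) = 0 :=
  forall_congr' fun u => symTrace_eq_zero_iff (f ≫ u)

end RepLin

/-! ### The representations `L_s` as truncated polynomial algebras in `1 - σ`. -/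

section Nil

variable {k : Type u} [Field k] {p : ℕ} [Fact p.Prime]

/-- The operator `1 - σ` on a representation of the cyclic group. -/
def nil (V : FDRep k (Cyc p)) : V →ₗ[k] V := LinearMap.id - V.ρ (Multiplicative.ofAdd 1)

lemma nil_apply (V : FDRep k (Cyc p)) (v : V) :
    nil V v = v - V.ρ (Multiplicative.ofAdd 1) v := rfl

lemma asAlgebraHom_one_sub_sigma (V : FDRep k (Cyc p)) :
    Representation.asAlgebraHom V.ρ (1 - sigma k p) = nil V := by
  rw [map_sub, map_one, sigma, MonoidAlgebra.of_apply, Representation.asAlgebraHom_single_one]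
  rfl

/-- Frobenius is additive in characteristic `p`, and `σ ^ p = 1`. -/
lemma one_sub_sigma_pow [CharP k p] : (1 - sigma k p) ^ p = 0 := by
  have : CharP (MonoidAlgebra k (Cyc p)) p :=
    charP_of_injective_algebraMap (algebraMap k (MonoidAlgebra k (Cyc p))).injective p
  rw [sub_pow_char, one_pow, sigma, ← map_pow, ← ofAdd_nsmul]
  simp [MonoidAlgebra.one_def]

lemma nil_pow [CharP k p] (V : FDRep k (Cyc p)) : nil V ^ p = 0 := by
  rw [← asAlgebraHom_one_sub_sigma, ← map_pow, one_sub_sigma_pow, map_zero]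

lemma cyc_eq_pow (g : Cyc p) : ∃ n : ℕ, g = Multiplicative.ofAdd (1 : ZMod p) ^ n := by
  refine ⟨(Multiplicative.toAdd g).val, ?_⟩
  rw [← ofAdd_nsmul]
  simp

/-- A linear map commuting with `1 - σ` is a morphism of representations. -/
def nilHom {V W : FDRep k (Cyc p)} (f : V →ₗ[k] W) (h : ∀ v, f (nil V v) = nil W (f v)) : V ⟶ W :=
  repHom f (fun g v => by
    obtain ⟨n, rfl⟩ := cyc_eq_pow g
    have h' (v) : f (V.ρ (Multiplicative.ofAdd 1) v) = W.ρ (Multiplicative.ofAdd 1) (f v) := by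
      have := h v
      rw [nil_apply, nil_apply, map_sub] at this
      exact sub_right_injective this
    induction n with
    | zero => simp
    | succ n ih =>
      rw [pow_succ', map_mul, map_mul, Module.End.mul_apply, Module.End.mul_apply, h', ih])

lemma repLin_asAlgebraHom {V W : FDRep k (Cyc p)} (f : V ⟶ W) (a : MonoidAlgebra k (Cyc p))
    (v : V) : repLin f (Representation.asAlgebraHom V.ρ a v) =
      Representation.asAlgebraHom W.ρ a (repLin f v) := by
  induction a using MonoidAlgebra.induction_on with
  | of g => simpa using repLin_equivariant f g v
  | add a b ha hb => simp only [map_add, LinearMap.add_apply, ha, hb]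
  | smul c a ha => simp only [map_smul, LinearMap.smul_apply, ha]

lemma repLin_nil {V W : FDRep k (Cyc p)} (f : V ⟶ W) (v : V) :
    repLin f (nil V v) = nil W (repLin f v) := by
  rw [← asAlgebraHom_one_sub_sigma, ← asAlgebraHom_one_sub_sigma, repLin_asAlgebraHom]

variable (k p) in
/-- The representation `L_s`. -/
abbrev LObj (s : ℕ) : FDRep k (Cyc p) := FDRep.of (LRep k p s)

variable (k p) in
/-- The class of `1 - σ` in `L_s`. -/
def ell (s : ℕ) : LSpace k p s := Ideal.Quotient.mk _ (1 - sigma k p)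

lemma asAlgebraHom_LObj (s : ℕ) (a : MonoidAlgebra k (Cyc p)) (b : LSpace k p s) :
    Representation.asAlgebraHom (LObj k p s).ρ a b = Ideal.Quotient.mk _ a * b := by
  induction a using MonoidAlgebra.induction_on with
  | of g => simp; rfl
  | add a a' ha hb => simp only [map_add, LinearMap.add_apply, ha, hb, add_mul]
  | smul c a ha =>
    simp only [map_smul, LinearMap.smul_apply, ha]
    rw [← smul_mul_assoc]
    rfl

lemma nil_LObj (s : ℕ) (b : LSpace k p s) : nil (LObj k p s) b = ell k p s * b := by
  rw [← asAlgebraHom_one_sub_sigma, asAlgebraHom_LObj]; rfl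

lemma ell_pow_self (s : ℕ) : ell k p s ^ s = 0 := by
  rw [ell, ← map_pow, Ideal.Quotient.eq_zero_iff_mem]
  exact Ideal.mem_span_singleton_self _

/-- The linear map underlying `LObj.lift`. -/
def liftLin {s : ℕ} {V : FDRep k (Cyc p)} (m : V) (h : (nil V ^ s) m = 0) : LSpace k p s →ₗ[k] V :=
  (Submodule.liftQ ((Ideal.span {(1 - sigma k p) ^ s}).restrictScalars k)
    ((LinearMap.applyₗ m) ∘ₗ (Representation.asAlgebraHom V.ρ).toLinearMap) (by
      intro a ha
      obtain ⟨b, rfl⟩ := Ideal.mem_span_singleton'.1 ha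
      change Representation.asAlgebraHom V.ρ (b * _) m = 0
      rw [map_mul, map_pow, asAlgebraHom_one_sub_sigma, Module.End.mul_apply, h, map_zero])) ∘ₗ
    (Submodule.Quotient.restrictScalarsEquiv k (Ideal.span {(1 - sigma k p) ^ s})).symm.toLinearMap

lemma liftLin_mk {s : ℕ} {V : FDRep k (Cyc p)} (m : V) (h : (nil V ^ s) m = 0)
    (a : MonoidAlgebra k (Cyc p)) :
    liftLin m h (Ideal.Quotient.mk _ a) = Representation.asAlgebraHom V.ρ a m := rfl

/-- The morphism `L_s ⟶ V` determined by an element of `V` killed by `(1 - σ) ^ s`. -/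
def liftHom {s : ℕ} {V : FDRep k (Cyc p)} (m : V) (h : (nil V ^ s) m = 0) : LObj k p s ⟶ V :=
  nilHom (liftLin m h) (fun b => by
    rw [nil_LObj]
    obtain ⟨a, rfl⟩ := Ideal.Quotient.mk_surjective b
    rw [ell, ← map_mul, liftLin_mk, liftLin_mk, map_mul, asAlgebraHom_one_sub_sigma]
    rfl)

lemma repLin_liftHom_ell_pow {s : ℕ} {V : FDRep k (Cyc p)} (m : V) (h : (nil V ^ s) m = 0)
    (n : ℕ) : repLin (liftHom m h) (ell k p s ^ n) = (nil V ^ n) m := by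
  rw [ell, ← map_pow]
  change Representation.asAlgebraHom V.ρ ((1 - sigma k p) ^ n) m = _
  rw [map_pow, asAlgebraHom_one_sub_sigma]

lemma repLin_liftHom_one {s : ℕ} {V : FDRep k (Cyc p)} (m : V) (h : (nil V ^ s) m = 0) :
    repLin (liftHom m h) (1 : LSpace k p s) = m := by
  have := repLin_liftHom_ell_pow m h 0
  rwa [pow_zero, pow_zero] at this

lemma repLin_LObj_eq {s : ℕ} {V : FDRep k (Cyc p)} (f : LObj k p s ⟶ V) (a) :
    repLin f (Ideal.Quotient.mk _ a) = Representation.asAlgebraHom V.ρ a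
      (repLin f (1 : LSpace k p s)) := by
  rw [← repLin_asAlgebraHom, asAlgebraHom_LObj, mul_one]

/-- `L_s` is cyclic on the generator 1, so its endomorphisms are multiplications by elements of the
commutative algebra `L_s`. -/
lemma repLin_LObj_apply {s : ℕ} (f : LObj k p s ⟶ LObj k p s) (b : LSpace k p s) :
    repLin f b = b * repLin f (1 : LSpace k p s) := by
  obtain ⟨a, rfl⟩ := Ideal.Quotient.mk_surjective b
  rw [repLin_LObj_eq, asAlgebraHom_LObj]

section Polynomial

open Polynomial

variable (k p) in
/-- The algebra map from polynomials to the group algebra, sending `X` to `1 - σ`. -/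
def polyHom : k[X] →ₐ[k] MonoidAlgebra k (Cyc p) := aeval (1 - sigma k p)

@[simp] lemma polyHom_X : polyHom k p X = 1 - sigma k p := aeval_X _

lemma polyHom_surjective : Function.Surjective (polyHom k p) := by
  intro a
  induction a using MonoidAlgebra.induction_on with
  | of g =>
    obtain ⟨n, rfl⟩ := cyc_eq_pow g
    exact ⟨(1 - X) ^ n, by rw [map_pow, map_sub, map_one, polyHom_X, sub_sub_cancel,
      sigma, map_pow]⟩
  | add a b ha hb =>
    obtain ⟨a, rfl⟩ := ha
    obtain ⟨b, rfl⟩ := hb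
    exact ⟨a + b, map_add _ _ _⟩
  | smul c a ha =>
    obtain ⟨a, rfl⟩ := ha
    exact ⟨c • a, map_smul _ _ _⟩

lemma finrank_quotient_X_pow (s : ℕ) :
    Module.finrank k (k[X] ⧸ Ideal.span {(X : k[X]) ^ s}) = s := by
  rw [finrank_quotient_span_eq_natDegree, natDegree_X_pow]

/-- The polynomial map to `L_s`. -/
def polyL (s : ℕ) : k[X] →ₐ[k] LSpace k p s := (Ideal.Quotient.mkₐ k _).comp (polyHom k p)

lemma polyL_surjective (s : ℕ) : Function.Surjective (polyL (k := k) (p := p) s) :=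
  Ideal.Quotient.mk_surjective.comp polyHom_surjective

@[simp] lemma polyL_X (s : ℕ) : polyL (k := k) (p := p) s X = ell k p s := by
  change Ideal.Quotient.mk _ (polyHom k p X) = _
  rw [polyHom_X]; rfl

/-- Lift to a polynomial and split off the constant coefficient. -/
lemma exists_eq_smul_add (s : ℕ) (a : LSpace k p s) :
    ∃ (c : k) (b : LSpace k p s), a = c • 1 + ell k p s * b := by
  obtain ⟨f, rfl⟩ := polyL_surjective s a
  refine ⟨f.coeff 0, polyL s f.divX, ?_⟩
  conv_lhs => rw [← X_mul_divX_add f]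
  rw [map_add, map_mul, polyL_X, add_comm, ← Algebra.algebraMap_eq_smul_one]
  exact congrArg (· + _) ((polyL s).commutes _)

variable [CharP k p]

/-- The induced surjection from `k[X]/X^p` to the group algebra is between spaces of dimension `p`,
hence injective. -/
lemma ker_polyHom : RingHom.ker (polyHom k p) = Ideal.span {(X : k[X]) ^ p} := by
  have hle : Ideal.span {(X : k[X]) ^ p} ≤ RingHom.ker (polyHom k p) := by
    rw [Ideal.span_singleton_le_iff_mem, RingHom.mem_ker, map_pow, polyHom_X, one_sub_sigma_pow]
  let φ : (k[X] ⧸ Ideal.span {(X : k[X]) ^ p}) →ₐ[k] MonoidAlgebra k (Cyc p) :=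
    Ideal.Quotient.liftₐ _ (polyHom k p) hle
  have hs : Function.Surjective φ.toLinearMap := fun a => by
    obtain ⟨f, rfl⟩ := polyHom_surjective a
    exact ⟨Ideal.Quotient.mk _ f, rfl⟩
  have : Module.Finite k (k[X] ⧸ Ideal.span {(X : k[X]) ^ p}) :=
    Polynomial.Monic.finite_quotient (monic_X_pow p)
  have hd : Module.finrank k (k[X] ⧸ Ideal.span {(X : k[X]) ^ p}) =
      Module.finrank k (MonoidAlgebra k (Cyc p)) := by
    rw [finrank_quotient_X_pow]
    rw [(MonoidAlgebra.coeffLinearEquiv k).finrank_eq]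
    simp [ZMod.card]
  have hi := (LinearMap.injective_iff_surjective_of_finrank_eq_finrank hd).2 hs
  refine le_antisymm (fun f hf => ?_) hle
  rw [← Ideal.Quotient.eq_zero_iff_mem]
  exact hi (hf.trans (map_zero φ.toLinearMap).symm)

lemma ker_polyL {s : ℕ} (hs : s ≤ p) :
    RingHom.ker (polyL (k := k) (p := p) s) = Ideal.span {(X : k[X]) ^ s} := by
  apply le_antisymm
  · intro f hf
    have hf' : polyHom k p f ∈ Ideal.span {(1 - sigma k p) ^ s} :=
      Ideal.Quotient.eq_zero_iff_mem.1 hf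
    obtain ⟨b, hb⟩ := Ideal.mem_span_singleton'.1 hf'
    obtain ⟨g, rfl⟩ := polyHom_surjective b
    -- The difference lies in `(X ^ p)`, which is contained in `(X ^ s)` because `s ≤ p`.
    have h : f - g * X ^ s ∈ RingHom.ker (polyHom k p) := by
      rw [RingHom.mem_ker, map_sub, map_mul, map_pow, polyHom_X, hb, sub_self]
    rw [ker_polyHom, Ideal.mem_span_singleton] at h
    rw [Ideal.mem_span_singleton]
    simpa using ((pow_dvd_pow X hs).trans h).add (Dvd.intro_left g rfl)
  · rw [Ideal.span_singleton_le_iff_mem, RingHom.mem_ker, map_pow, polyL_X, ell_pow_self]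

/-- The isomorphism of `k[X] / X ^ s` with `L_s`. -/
def polyEquiv {s : ℕ} (hs : s ≤ p) : (k[X] ⧸ Ideal.span {(X : k[X]) ^ s}) ≃ₐ[k] LSpace k p s :=
  (Ideal.quotientEquivAlgOfEq k (ker_polyL hs).symm).trans
    (Ideal.quotientKerAlgEquivOfSurjective (polyL_surjective s))

lemma finrank_LSpace {s : ℕ} (hs : s ≤ p) : Module.finrank k (LSpace k p s) = s := by
  rw [← (polyEquiv hs).toLinearEquiv.finrank_eq, finrank_quotient_X_pow]

lemma ell_pow_ne_zero {s n : ℕ} (hs : s ≤ p) (hn : n < s) : ell k p s ^ n ≠ 0 := by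
  intro h
  have : (X : k[X]) ^ n ∈ RingHom.ker (polyL (k := k) (p := p) s) := by
    rw [RingHom.mem_ker, map_pow, polyL_X, h]
  rw [ker_polyL hs, Ideal.mem_span_singleton, X_pow_dvd_iff] at this
  simpa using this n hn

/-- The socle of `L_{s+1}` is the line spanned by the top power of `1 - σ`. Injectivity of maps out
of these modules will be tested there. -/
lemma exists_eq_smul_of_ell_mul_eq_zero {s : ℕ} (hs : s + 1 ≤ p) (a : LSpace k p (s + 1))
    (h : ell k p (s + 1) * a = 0) : ∃ c : k, a = c • ell k p (s + 1) ^ s := by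
  obtain ⟨f, rfl⟩ := polyL_surjective _ a
  have : X * f ∈ RingHom.ker (polyL (k := k) (p := p) (s + 1)) := by
    rw [RingHom.mem_ker, map_mul, polyL_X, h]
  rw [ker_polyL hs, Ideal.mem_span_singleton, pow_succ', mul_dvd_mul_iff_left X_ne_zero] at this
  obtain ⟨g, rfl⟩ := this
  obtain ⟨c, b, hb⟩ := exists_eq_smul_add _ (polyL (k := k) (p := p) (s + 1) g)
  refine ⟨c, ?_⟩
  rw [map_mul, map_pow, polyL_X, hb, mul_add, ← mul_assoc, ← pow_succ, ell_pow_self]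
  simp

end Polynomial

end Nil

/-! ### Negligible morphisms between the `L_s`. -/

section NegligibleL

variable {k : Type u} [Field k] {p : ℕ} [Fact p.Prime]

lemma isNilpotent_mul_of_ell_dvd {s : ℕ} {a : LSpace k p s} (ha : ell k p s ∣ a) :
    IsNilpotent a := by
  obtain ⟨b, rfl⟩ := ha
  exact ⟨s, by rw [mul_pow, ell_pow_self, zero_mul]⟩

/-- The endomorphism is multiplication by the nilpotent element `f 1`, and nilpotent operators have
trace zero. -/
lemma trace_eq_zero_of_ell_dvd {s : ℕ} (f : LObj k p s ⟶ LObj k p s)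
    (h : ell k p s ∣ repLin f (1 : LSpace k p s)) :
    LinearMap.trace k (LSpace k p s) (repLin f) = 0 := by
  have e : (repLin f : LSpace k p s →ₗ[k] LSpace k p s) =
      Algebra.lmul k (LSpace k p s) (repLin f (1 : LSpace k p s)) :=
    LinearMap.ext fun b => (repLin_LObj_apply f b).trans (mul_comm _ _)
  rw [e]
  exact (LinearMap.isNilpotent_trace_of_isNilpotent
    ((isNilpotent_mul_of_ell_dvd h).map (Algebra.lmul k (LSpace k p s)))).eq_zero

lemma isNegligible_of_ell_dvd {s : ℕ} (f : LObj k p s ⟶ LObj k p s)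
    (h : ell k p s ∣ repLin f (1 : LSpace k p s)) : IsNegligible f := by
  rw [isNegligible_iff_trace]
  intro u
  refine trace_eq_zero_of_ell_dvd (f ≫ u) ?_
  change ell k p s ∣ repLin u (repLin f (1 : LSpace k p s))
  rw [repLin_LObj_apply]
  exact h.mul_right _

lemma exists_isNegligible_sub_smul {s : ℕ} (f : LObj k p s ⟶ LObj k p s) :
    ∃ c : k, IsNegligible (f - c • 𝟙 _) := by
  obtain ⟨c, b, h⟩ := exists_eq_smul_add s (repLin f (1 : LSpace k p s))
  refine ⟨c, isNegligible_of_ell_dvd _ ⟨b, ?_⟩⟩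
  change repLin f (1 : LSpace k p s) - c • (1 : LSpace k p s) = _
  rw [h, add_sub_cancel_left]

/-- A nonzero constant term makes the element a unit plus a nilpotent. -/
lemma isUnit_or_ell_dvd {s : ℕ} (a : LSpace k p s) : IsUnit a ∨ ell k p s ∣ a := by
  obtain ⟨c, b, rfl⟩ := exists_eq_smul_add s a
  by_cases hc : c = 0
  · exact Or.inr ⟨b, by simp [hc]⟩
  · refine Or.inl (IsNilpotent.isUnit_add_left_of_commute
      (isNilpotent_mul_of_ell_dvd (dvd_mul_right _ _)) ?_ (Commute.all _ _))
    rw [← Algebra.algebraMap_eq_smul_one]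
    exact (IsUnit.mk0 c hc).map _

lemma bijective_or_ell_dvd {s : ℕ} (f : LObj k p s ⟶ LObj k p s) :
    Function.Bijective (repLin f) ∨ ell k p s ∣ repLin f (1 : LSpace k p s) := by
  refine (isUnit_or_ell_dvd _).imp_left fun h => ?_
  have e : (repLin f : LSpace k p s → LSpace k p s) = fun b => b * repLin f (1 : LSpace k p s) :=
    funext (repLin_LObj_apply f)
  rw [e]
  exact (IsUnit.isUnit_iff_mulRight_bijective).1 h

lemma subsingleton_LSpace_zero : Subsingleton (LSpace k p 0) := by
  refine ⟨fun a b => ?_⟩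
  obtain ⟨a, rfl⟩ := Ideal.Quotient.mk_surjective a
  obtain ⟨b, rfl⟩ := Ideal.Quotient.mk_surjective b
  rw [Ideal.Quotient.eq]
  simp

variable [CharP k p]

/-- If `f ≫ u` and `u ≫ f` were both bijective, the dimensions `s` and `t` would agree. So one of
them is multiplication by a nilpotent and has trace zero, and both have the same trace. -/
lemma isNegligible_of_ne {s t : ℕ} (hs : s ≤ p) (ht : t ≤ p) (hst : s ≠ t)
    (f : LObj k p s ⟶ LObj k p t) : IsNegligible f := by
  rw [isNegligible_iff_trace]
  intro u
  rcases bijective_or_ell_dvd (f ≫ u) with h | h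
  · rcases bijective_or_ell_dvd (u ≫ f) with h' | h'
    · exfalso
      have h1 : Function.Injective (repLin u ∘ repLin f) := h.1
      have h2 : Function.Surjective (repLin f ∘ repLin u) := h'.2
      have hb : Function.Bijective (repLin f) := ⟨h1.of_comp, h2.of_comp⟩
      have := (LinearEquiv.ofBijective _ hb).finrank_eq
      change Module.finrank k (LSpace k p s) = Module.finrank k (LSpace k p t) at this
      rw [finrank_LSpace hs, finrank_LSpace ht] at this
      exact hst this
    · rw [LinearMap.trace_comp_comm']
      exact trace_eq_zero_of_ell_dvd (u ≫ f) h'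
  · exact trace_eq_zero_of_ell_dvd (f ≫ u) h

/-- Every endomorphism of `L_p` is a scalar `c` plus a nilpotent, so its trace is `c * p = 0`. -/
lemma isNegligible_id_LObj_self : IsNegligible (𝟙 (LObj k p p)) := by
  rw [isNegligible_iff_trace]
  intro u
  obtain ⟨c, b, h⟩ := exists_eq_smul_add p (repLin u (1 : LSpace k p p))
  have h0 := trace_eq_zero_of_ell_dvd (u - c • 𝟙 _) ⟨b, by
    change repLin u (1 : LSpace k p p) - c • (1 : LSpace k p p) = _
    rw [h, add_sub_cancel_left]⟩
  rw [repLin_sub, map_sub, repLin_smul, map_smul, repLin_id, sub_eq_zero] at h0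
  rw [repLin_id, LinearMap.comp_id]
  refine h0.trans ?_
  have : LinearMap.trace k (LSpace k p p) LinearMap.id = 0 := by
    rw [LinearMap.trace_id, finrank_LSpace le_rfl, CharP.cast_eq_zero]
  exact (congrArg (c • ·) this).trans (smul_zero c)

lemma not_isNegligible_id_LObj {s : ℕ} (h0 : 0 < s) (hs : s < p) :
    ¬ IsNegligible (𝟙 (LObj k p s)) := by
  rw [isNegligible_iff_trace]
  intro h
  have h1 : LinearMap.trace k (LSpace k p s) LinearMap.id = 0 := h (𝟙 _)
  rw [LinearMap.trace_id, finrank_LSpace hs.le, CharP.cast_eq_zero_iff k p] at h1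
  exact absurd (Nat.le_of_dvd h0 h1) (not_le.2 hs)

/-- `L_1` is the trivial representation. -/
def LObjOneIso : LObj k p 1 ≅ 𝟙_ (FDRep k (Cyc p)) :=
  let f : LObj k p 1 ⟶ 𝟙_ (FDRep k (Cyc p)) := liftHom (V := 𝟙_ (FDRep k (Cyc p))) (1 : k) (by
    rw [pow_one, nil_apply, sub_eq_zero]; rfl)
  have hf : repLin f (1 : LSpace k p 1) = (1 : k) :=
    repLin_liftHom_one (V := 𝟙_ (FDRep k (Cyc p))) (1 : k) _
  have hs : Function.Surjective (repLin f) := fun c =>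
    ⟨c • (1 : LSpace k p 1), by
      refine (map_smul (repLin f) c (1 : LSpace k p 1)).trans ?_
      rw [hf]; exact mul_one c⟩
  have hd : Module.finrank k (LSpace k p 1) = Module.finrank k k := by
    rw [finrank_LSpace (Fact.out : p.Prime).one_lt.le, Module.finrank_self]
  repIso (LinearEquiv.ofBijective (repLin f)
    ⟨(LinearMap.injective_iff_surjective_of_finrank_eq_finrank hd).2 hs, hs⟩)
    (fun g v => repLin_equivariant f g v)

end NegligibleL

/-! ### Direct sums given by equations, hence preserved by additive functors. -/

section DirectSum

variable {C : Type u₁} [Category.{v₁} C] [Preadditive C]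

/-- `M` is a direct sum of `A` and `B`. -/
def IsBiprod (M A B : C) : Prop :=
  ∃ (i₁ : A ⟶ M) (i₂ : B ⟶ M) (q₁ : M ⟶ A) (q₂ : M ⟶ B), i₁ ≫ q₁ = 𝟙 A ∧ i₂ ≫ q₂ = 𝟙 B ∧
    i₁ ≫ q₂ = 0 ∧ i₂ ≫ q₁ = 0 ∧ q₁ ≫ i₁ + q₂ ≫ i₂ = 𝟙 M

/-- `M` is a direct sum of the objects `S a`. -/
def IsDirectSum {ι : Type*} [Fintype ι] (M : C) (S : ι → C) : Prop :=
  ∃ (i : ∀ a, S a ⟶ M) (q : ∀ a, M ⟶ S a), (∀ a, i a ≫ q a = 𝟙 (S a)) ∧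
    (∀ a b, a ≠ b → i a ≫ q b = 0) ∧ ∑ a, q a ≫ i a = 𝟙 M

variable {D : Type u₂} [Category.{v₂} D] [Preadditive D]

lemma IsBiprod.map {M A B : C} (h : IsBiprod M A B) (F : C ⥤ D) [F.Additive] :
    IsBiprod (F.obj M) (F.obj A) (F.obj B) := by
  obtain ⟨i₁, i₂, q₁, q₂, h₁, h₂, h₃, h₄, h₅⟩ := h
  refine ⟨F.map i₁, F.map i₂, F.map q₁, F.map q₂, ?_, ?_, ?_, ?_, ?_⟩
  · rw [← F.map_comp, h₁, F.map_id]
  · rw [← F.map_comp, h₂, F.map_id]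
  · rw [← F.map_comp, h₃, F.map_zero]
  · rw [← F.map_comp, h₄, F.map_zero]
  · rw [← F.map_comp, ← F.map_comp, ← F.map_add, h₅, F.map_id]

lemma IsDirectSum.map {ι : Type*} [Fintype ι] {M : C} {S : ι → C} (h : IsDirectSum M S)
    (F : C ⥤ D) [F.Additive] : IsDirectSum (F.obj M) (fun a => F.obj (S a)) := by
  obtain ⟨i, q, h₁, h₂, h₃⟩ := h
  refine ⟨fun a => F.map (i a), fun a => F.map (q a), fun a => ?_, fun a b hab => ?_, ?_⟩
  · rw [← F.map_comp, h₁, F.map_id]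
  · rw [← F.map_comp, h₂ a b hab, F.map_zero]
  · simp only [← F.map_comp]
    rw [← F.map_sum, h₃, F.map_id]

end DirectSum

/-! ### The decomposition of `L_2 ⊗ L_s`. -/

section TensorTwo

variable {R : Type*} [CommRing R] {X Y : R}

/-- `X + Y - X * Y = 1 - (1 - X) * (1 - Y)` is how `1 - σ` acts on a tensor product. For the factor
`L_2` one has `X ^ 2 = 0`, so only the terms of degree at most 1 in `X` survive. -/
lemma pow_succ_of_sq_eq_zero (hX : X ^ 2 = 0) (n : ℕ) :
    (X + Y - X * Y) ^ (n + 1) = Y ^ (n + 1) + (n + 1) * X * (1 - Y) * Y ^ n := by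
  induction n with
  | zero => simp; ring
  | succ n ih =>
    rw [pow_succ, ih]
    push_cast
    linear_combination ((n + 1) * (1 - Y) * Y ^ n * (1 - Y)) * hX

lemma pow_mul_sub_of_sq_eq_zero (hX : X ^ 2 = 0) (n : ℕ) :
    (X + Y - X * Y) ^ n * (Y - (n + 1) * X) = Y ^ (n + 1) - X * Y ^ n - n * X * Y ^ (n + 1) := by
  cases n with
  | zero => simp
  | succ n =>
    rw [pow_succ_of_sq_eq_zero hX]
    push_cast
    linear_combination (- (n + 1) * (n + 2) * (1 - Y) * Y ^ n) * hX

end TensorTwo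

section Tensor

/-- The kernel of `f` is stable under the nilpotent `N`, so if it were nonzero it would contain a
nonzero vector killed by `N`. -/
lemma injective_of_commute_of_ker {k U W : Type*} [Field k] [AddCommGroup U] [Module k U]
    [AddCommGroup W] [Module k W] (f : U →ₗ[k] W) (N : U →ₗ[k] U) (N' : W →ₗ[k] W) (n : ℕ)
    (hN : N ^ n = 0) (h : ∀ u, f (N u) = N' (f u)) (h0 : ∀ u, N u = 0 → f u = 0 → u = 0) :
    Function.Injective f := by
  have key : ∀ m u, (N ^ m) u = 0 → f u = 0 → u = 0 := by
    intro m
    induction m with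
    | zero => intro u hu _; simpa using hu
    | succ m ih =>
      intro u hu hf
      rw [pow_succ, Module.End.mul_apply] at hu
      exact h0 u (ih _ hu (by rw [h, hf, map_zero])) hf
  rw [injective_iff_map_eq_zero]
  exact fun u hu => key n u (by rw [hN]; rfl) hu

section Algebra

variable {k A B : Type*} [Field k] [CommRing A] [Algebra k A] [CommRing B] [Algebra k B]

variable (k) in
/-- The operator `1 - (1 - x) ⊗ (1 - y)` on a tensor product of algebras. -/
def tensorNil (x : A) (y : B) : A ⊗[k] B →ₗ[k] A ⊗[k] B :=
  LinearMap.id - TensorProduct.map (LinearMap.id - LinearMap.mulLeft k x)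
    (LinearMap.id - LinearMap.mulLeft k y)

lemma tensorNil_pow_apply (x : A) (y : B) (n : ℕ) (b : A ⊗[k] B) :
    (tensorNil k x y ^ n) b = (x ⊗ₜ 1 + 1 ⊗ₜ y - (x ⊗ₜ 1) * (1 ⊗ₜ y)) ^ n * b := by
  have h : tensorNil k x y = LinearMap.mulLeft k (x ⊗ₜ 1 + 1 ⊗ₜ y - (x ⊗ₜ 1) * (1 ⊗ₜ y)) := by
    ext a b
    simp only [tensorNil, TensorProduct.AlgebraTensorModule.curry_apply,
      TensorProduct.curry_apply, LinearMap.coe_restrictScalars, LinearMap.sub_apply,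
      LinearMap.id_apply, TensorProduct.map_tmul, LinearMap.mulLeft_apply, sub_mul, add_mul,
      Algebra.TensorProduct.tmul_mul_tmul, one_mul, mul_one, TensorProduct.sub_tmul,
      TensorProduct.tmul_sub]
    abel
  rw [h, LinearMap.pow_mulLeft, LinearMap.mulLeft_apply]

lemma tmul_ne_zero {x : A} {y : B} (hx : x ≠ 0) (hy : y ≠ 0) : x ⊗ₜ[k] y ≠ 0 := by
  intro h
  have hi := Module.Flat.rTensor_preserves_injective_linearMap (M := B)
    (LinearMap.toSpanSingleton k A x) (LinearMap.ker_eq_bot.1 (LinearMap.ker_toSpanSingleton k hx))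
  have h1 : (1 : k) ⊗ₜ[k] y = 0 := by
    apply hi
    rw [LinearMap.rTensor_tmul, LinearMap.toSpanSingleton_apply_one, h, map_zero]
  have h2 := congrArg (TensorProduct.lid k B) h1
  rw [TensorProduct.lid_tmul, one_smul, map_zero] at h2
  exact hy h2

variable {x : A} {y : B} {n : ℕ}

variable (k) in
/-- A generator of the second summand of `L_2 ⊗ L_s`. -/
def secondGen (x : A) (y : B) (n : ℕ) : A ⊗[k] B :=
  (1 : A) ⊗ₜ[k] y - (n + 1 : A ⊗[k] B) * (x ⊗ₜ[k] 1)

lemma tmul_one_sq (hx : x ^ 2 = 0) : (x ⊗ₜ[k] (1 : B)) ^ 2 = 0 := by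
  rw [Algebra.TensorProduct.tmul_pow, hx, TensorProduct.zero_tmul]

lemma one_tmul_pow (hy : y ^ n = 0) : ((1 : A) ⊗ₜ[k] y) ^ n = 0 := by
  rw [Algebra.TensorProduct.tmul_pow, hy, TensorProduct.tmul_zero]

lemma tensorNil_pow_one (hx : x ^ 2 = 0) (hy : y ^ (n + 2) = 0) :
    (tensorNil k x y ^ (n + 3)) 1 = 0 := by
  have hX := tmul_one_sq (k := k) (B := B) hx
  have hY := one_tmul_pow (k := k) (A := A) hy
  rw [tensorNil_pow_apply, pow_succ_of_sq_eq_zero hX]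
  push_cast
  linear_combination (1 ⊗ₜ y + (n + 3) * (x ⊗ₜ 1) * (1 - 1 ⊗ₜ y)) * hY

/-- The coefficient `n + 1` in `secondGen` is chosen so that the two terms in `x ⊗ y ^ (n + 1)`
cancel; the others contain `x ^ 2` or `y ^ (n + 2)`. -/
lemma tensorNil_pow_sub (hx : x ^ 2 = 0) (hy : y ^ (n + 2) = 0) :
    (tensorNil k x y ^ (n + 1)) (secondGen k x y n) = 0 := by
  have hX := tmul_one_sq (k := k) (B := B) hx
  have hY := one_tmul_pow (k := k) (A := A) hy
  rw [tensorNil_pow_apply, secondGen, pow_succ_of_sq_eq_zero hX]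
  linear_combination (1 - (n + 1) * (x ⊗ₜ 1)) * hY -
    ((n + 1) ^ 2 * (1 - 1 ⊗ₜ y) * (1 ⊗ₜ y) ^ n) * hX

/-- This is independence of the two socle vectors generated by 1 and `secondGen`. The first is `n +
2` times `x ⊗ y ^ (n + 1)`, nonzero because `n + 2` is invertible in `k`; the second has further
terms of lower degree in `y`. -/
lemma eq_zero_of_tensorNil (hx : x ^ 2 = 0) (hx0 : x ≠ 0) (hy : y ^ (n + 2) = 0)
    (hy0 : y ^ (n + 1) ≠ 0) (hn : ((n + 2 : ℕ) : k) ≠ 0) {c d : k}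
    (h : c • (tensorNil k x y ^ (n + 2)) 1 +
      d • (tensorNil k x y ^ n) (secondGen k x y n) = 0) : c = 0 ∧ d = 0 := by
  have hX := tmul_one_sq (k := k) (B := B) hx
  have hY := one_tmul_pow (k := k) (A := A) hy
  have hXY : (x ⊗ₜ[k] (1 : B)) * ((1 : A) ⊗ₜ y) ^ (n + 1) ≠ 0 := by
    rw [Algebra.TensorProduct.tmul_pow, one_pow, Algebra.TensorProduct.tmul_mul_tmul, mul_one,
      one_mul]
    exact tmul_ne_zero hx0 hy0
  rw [tensorNil_pow_apply, tensorNil_pow_apply, secondGen, pow_mul_sub_of_sq_eq_zero hX,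
    pow_succ_of_sq_eq_zero hX] at h
  -- Multiplying by `1 ⊗ y` kills the `c` term and leaves `-d` times `x ⊗ y ^ (n + 1)`.
  have h3 : d • ((x ⊗ₜ[k] (1 : B)) * ((1 : A) ⊗ₜ y) ^ (n + 1)) = 0 := by
    have h4 := congrArg (· * ((1 : A) ⊗ₜ[k] y)) h
    simp only [zero_mul, Algebra.smul_def] at h4 ⊢
    push_cast at h4
    linear_combination -h4 + (algebraMap k _ c * (1 ⊗ₜ y + (n + 2) * (x ⊗ₜ 1) * (1 - 1 ⊗ₜ y)) +
      algebraMap k _ d * (1 - n * (x ⊗ₜ 1))) * hY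
  have hd : d = 0 := (smul_eq_zero.1 h3).resolve_right hXY
  subst hd
  have h5 : (c * (n + 2 : ℕ)) • ((x ⊗ₜ[k] (1 : B)) * ((1 : A) ⊗ₜ y) ^ (n + 1)) = 0 := by
    simp only [Algebra.smul_def, map_mul, map_natCast, map_zero, zero_mul] at h ⊢
    push_cast at h ⊢
    linear_combination h - algebraMap k _ c * (1 - (n + 2) * (x ⊗ₜ 1)) * hY
  exact ⟨(mul_eq_zero.1 ((smul_eq_zero.1 h5).resolve_right hXY)).resolve_right hn, rfl⟩

end Algebra

variable {k : Type u} [Field k] {p : ℕ} [Fact p.Prime]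

lemma nil_tensor_LObj (r s : ℕ) :
    nil (LObj k p r ⊗ LObj k p s) = tensorNil k (ell k p r) (ell k p s) := by
  have h (t : ℕ) : (LObj k p t).ρ (Multiplicative.ofAdd 1) =
      (LinearMap.id - LinearMap.mulLeft k (ell k p t) : LSpace k p t →ₗ[k] LSpace k p t) := by
    refine LinearMap.ext fun a => ?_
    refine Eq.trans ?_ (congrArg (a - ·) (nil_LObj t a))
    rw [nil_apply]
    exact (sub_sub_cancel _ _).symm
  have e : nil (LObj k p r ⊗ LObj k p s) = LinearMap.id -
      TensorProduct.map ((LObj k p r).ρ (Multiplicative.ofAdd 1))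
        ((LObj k p s).ρ (Multiplicative.ofAdd 1)) := rfl
  rw [e, h, h]
  rfl

variable [CharP k p]

/-- By nilpotence of `1 - σ`, the map from the direct sum is injective as soon as it is injective on
invariants, and equality of dimensions makes it bijective. The inverse commutes with `1 - σ`, so its
components are morphisms. -/
lemma isBiprod_of_injective {V A B : FDRep k (Cyc p)} (f : A ⟶ V) (g : B ⟶ V)
    (hi : ∀ a b, nil A a = 0 → nil B b = 0 → repLin f a + repLin g b = 0 → a = 0 ∧ b = 0)
    (hd : Module.finrank k V = Module.finrank k A + Module.finrank k B) :
    IsBiprod V A B := by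
  let φ : (A × B) →ₗ[k] V := LinearMap.coprod (repLin f) (repLin g)
  have hφ : Function.Injective φ := by
    refine injective_of_commute_of_ker φ (LinearMap.prodMap (nil A) (nil B)) (nil V) p ?_ ?_ ?_
    · have h (m : ℕ) : LinearMap.prodMap (nil A) (nil B) ^ m =
          LinearMap.prodMap (nil A ^ m) (nil B ^ m) := by
        induction m with
        | zero => rfl
        | succ m ih => rw [pow_succ, ih]; rfl
      rw [h, nil_pow, nil_pow]; rfl
    · rintro ⟨a, b⟩
      simp [φ, repLin_nil]
    · rintro ⟨a, b⟩ hN h0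
      have h1 := hi a b (congrArg Prod.fst hN) (congrArg Prod.snd hN) h0
      exact Prod.ext h1.1 h1.2
  have hb : Function.Bijective φ :=
    ⟨hφ, (LinearMap.injective_iff_surjective_of_finrank_eq_finrank
      (by rw [Module.finrank_prod, hd])).1 hφ⟩
  let e := LinearEquiv.ofBijective φ hb
  have he (a b) : e.symm (repLin f a + repLin g b) = (a, b) := e.symm_apply_apply (a, b)
  have hea (a) : e.symm (repLin f a) = (a, 0) := by simpa using he a 0
  have heb (b) : e.symm (repLin g b) = (0, b) := by simpa using he 0 b
  have hn (v) : e.symm (nil V v) = (nil A (e.symm v).1, nil B (e.symm v).2) := by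
    obtain ⟨⟨a, b⟩, rfl⟩ := e.surjective v
    rw [e.symm_apply_apply]
    change e.symm (nil V (repLin f a + repLin g b)) = _
    rw [map_add, ← repLin_nil, ← repLin_nil, he]
  refine ⟨f, g, nilHom (LinearMap.fst k A B ∘ₗ e.symm.toLinearMap) ?_,
    nilHom (LinearMap.snd k A B ∘ₗ e.symm.toLinearMap) ?_, ?_, ?_, ?_, ?_, ?_⟩
  · exact fun v => congrArg Prod.fst (hn v)
  · exact fun v => congrArg Prod.snd (hn v)
  · exact repLin_injective (LinearMap.ext fun a => congrArg Prod.fst (hea a))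
  · exact repLin_injective (LinearMap.ext fun b => congrArg Prod.snd (heb b))
  · exact repLin_injective (LinearMap.ext fun a => congrArg Prod.snd (hea a))
  · exact repLin_injective (LinearMap.ext fun b => congrArg Prod.fst (heb b))
  · exact repLin_injective (LinearMap.ext fun v => e.apply_symm_apply v)

lemma isBiprod_tensor_two (n : ℕ) (hn : n + 3 ≤ p) :
    IsBiprod (LObj k p 2 ⊗ LObj k p (n + 2)) (LObj k p (n + 3)) (LObj k p (n + 1)) := by
  have hx : ell k p 2 ^ 2 = 0 := ell_pow_self 2
  have hx0 : ell k p 2 ≠ 0 := by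
    simpa using ell_pow_ne_zero (k := k) (p := p) (s := 2) (n := 1) (by omega) (by omega)
  have hy : ell k p (n + 2) ^ (n + 2) = 0 := ell_pow_self _
  have hy0 : ell k p (n + 2) ^ (n + 1) ≠ 0 := ell_pow_ne_zero (by omega) (by omega)
  -- Here `n + 3 ≤ p` enters: it gives `0 < n + 2 < p`.
  have hn0 : ((n + 2 : ℕ) : k) ≠ 0 := by
    rw [Ne, CharP.cast_eq_zero_iff k p]
    exact fun h => absurd (Nat.le_of_dvd (by omega) h) (by omega)
  let V : FDRep k (Cyc p) := LObj k p 2 ⊗ LObj k p (n + 2)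
  let v : V := (1 : LSpace k p 2 ⊗[k] LSpace k p (n + 2))
  let w : V := secondGen k (ell k p 2) (ell k p (n + 2)) n
  have hf : (nil V ^ (n + 3)) v = 0 := by
    rw [nil_tensor_LObj]; exact tensorNil_pow_one hx hy
  have hg : (nil V ^ (n + 1)) w = 0 := by
    rw [nil_tensor_LObj]; exact tensorNil_pow_sub hx hy
  have h0 {c d : k} (h : c • (nil V ^ (n + 2)) v + d • (nil V ^ n) w = 0) : c = 0 ∧ d = 0 := by
    rw [nil_tensor_LObj] at h
    exact eq_zero_of_tensorNil hx hx0 hy hy0 hn0 h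
  refine isBiprod_of_injective (liftHom v hf) (liftHom w hg) ?_ ?_
  · intro a b ha hb hab
    rw [nil_LObj] at ha hb
    obtain ⟨c, rfl⟩ := exists_eq_smul_of_ell_mul_eq_zero (by omega) a ha
    obtain ⟨d, rfl⟩ := exists_eq_smul_of_ell_mul_eq_zero (by omega) b hb
    have h2 := (congrArg₂ (· + ·) (map_smul (repLin (liftHom v hf)) c (ell k p (n + 3) ^ (n + 2)))
      (map_smul (repLin (liftHom w hg)) d (ell k p (n + 1) ^ n))).symm.trans hab
    rw [repLin_liftHom_ell_pow, repLin_liftHom_ell_pow] at h2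
    obtain ⟨rfl, rfl⟩ := h0 h2
    exact ⟨zero_smul _ _, zero_smul _ _⟩
  · change Module.finrank k (LSpace k p 2 ⊗[k] LSpace k p (n + 2)) =
      Module.finrank k (LSpace k p (n + 3)) + Module.finrank k (LSpace k p (n + 1))
    rw [Module.finrank_tensorProduct, finrank_LSpace (by omega), finrank_LSpace (by omega),
      finrank_LSpace hn, finrank_LSpace (by omega)]
    omega

end Tensor

/-! ### Every representation is a direct sum of `L_s` with `s ≤ p`. -/

section Classification

open Polynomial

variable {k : Type u} [Field k] {p : ℕ} [Fact p.Prime] [CharP k p]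

/-- View `V` as a `k[X]`-module with `X` acting by `1 - σ`. It is torsion for powers of the prime
`X`, so it is a sum of modules `k[X]/X^e`; the rest transports the inclusions and projections to
morphisms of representations. -/
lemma exists_isDirectSum_LObj (V : FDRep k (Cyc p)) :
    ∃ (d : ℕ) (e : Fin d → ℕ), (∀ a, e a ≤ p) ∧ IsDirectSum V (fun a => LObj k p (e a)) := by
  let N := Module.AEval' (nil V)
  have hX (m : N) : (X : k[X]) • m =
      Module.AEval'.of (nil V) (nil V ((Module.AEval'.of (nil V)).symm m)) := by
    obtain ⟨v, rfl⟩ := (Module.AEval'.of (nil V)).surjective m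
    rw [LinearEquiv.symm_apply_apply]
    exact Module.AEval'.X_smul_of (nil V) v
  have hXp (m : N) : (X : k[X]) ^ p • m = 0 := by
    obtain ⟨v, rfl⟩ := (Module.AEval'.of (nil V)).surjective m
    rw [Module.AEval'.X_pow_smul_of, nil_pow]
    exact map_zero _
  have htor : Module.IsTorsion' N (Submonoid.powers (X : k[X])) :=
    fun {m} => ⟨⟨X ^ p, p, rfl⟩, hXp m⟩
  obtain ⟨d, e, ⟨φ⟩⟩ := Module.torsion_by_prime_power_decomposition irreducible_X htor
  -- `X ^ p` kills the generator of the summand, so `X ^ e a` divides `X ^ p`.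
  have he (a) : e a ≤ p := by
    have h := hXp (φ.symm (DirectSum.lof k[X] (Fin d)
      (fun i => k[X] ⧸ Submodule.span k[X] {(X : k[X]) ^ e i}) a (Submodule.Quotient.mk 1)))
    rw [← map_smul, ← map_smul, LinearEquiv.map_eq_zero_iff] at h
    have h1 := congrArg (DirectSum.component k[X] (Fin d) _ a) h
    rw [DirectSum.component.lof_self, map_zero, ← Submodule.Quotient.mk_smul,
      Submodule.Quotient.mk_eq_zero, smul_eq_mul, mul_one] at h1
    have h2 : (X : k[X]) ^ e a ∣ X ^ p := Ideal.mem_span_singleton.1 h1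
    exact (pow_dvd_pow_iff X_ne_zero not_isUnit_X).1 h2
  refine ⟨d, e, he, ?_⟩
  let i (a) : k[X] ⧸ Submodule.span k[X] {(X : k[X]) ^ e a} →ₗ[k[X]] N :=
    φ.symm.toLinearMap ∘ₗ DirectSum.lof k[X] (Fin d)
      (fun i => k[X] ⧸ Submodule.span k[X] {(X : k[X]) ^ e i}) a
  let q (a) : N →ₗ[k[X]] k[X] ⧸ Submodule.span k[X] {(X : k[X]) ^ e a} :=
    DirectSum.component k[X] (Fin d) _ a ∘ₗ φ.toLinearMap
  have hqi (a b) (x) : q b (i a x) = DirectSum.component k[X] (Fin d) _ b (DirectSum.lof k[X] (Fin d)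
      (fun i => k[X] ⧸ Submodule.span k[X] {(X : k[X]) ^ e i}) a x) :=
    congrArg (DirectSum.component k[X] (Fin d) _ b) (φ.apply_symm_apply (DirectSum.lof k[X] (Fin d)
      (fun i => k[X] ⧸ Submodule.span k[X] {(X : k[X]) ^ e i}) a x))
  have hsum (y : N) : ∑ a, i a (q a y) = y := by
    change ∑ a, φ.symm (DirectSum.lof k[X] (Fin d)
      (fun i => k[X] ⧸ Submodule.span k[X] {(X : k[X]) ^ e i}) a (φ y a)) = y
    rw [← map_sum, LinearEquiv.symm_apply_eq]
    exact DirectSum.sum_univ_of (φ y)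
  let ψ (a) : (k[X] ⧸ Submodule.span k[X] {(X : k[X]) ^ e a}) ≃ₗ[k] LSpace k p (e a) :=
    (polyEquiv (he a)).toLinearEquiv
  have hψ (a x) : ψ a ((X : k[X]) • x) = ell k p (e a) * ψ a x := by
    obtain ⟨f, rfl⟩ := Ideal.Quotient.mk_surjective x
    have h1 : ψ a ((X : k[X]) • Ideal.Quotient.mk _ f) = polyL (e a) (X * f) := rfl
    rw [h1, map_mul, polyL_X]
    rfl
  let o := Module.AEval'.of (nil V)
  let I (a) : LSpace k p (e a) →ₗ[k] V :=
    o.symm.toLinearMap ∘ₗ (i a).restrictScalars k ∘ₗ (ψ a).symm.toLinearMap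
  let Q (a) : V →ₗ[k] LSpace k p (e a) :=
    (ψ a).toLinearMap ∘ₗ (q a).restrictScalars k ∘ₗ o.toLinearMap
  have hI (a) (x : LSpace k p (e a)) : I a (nil (LObj k p (e a)) x) = nil V (I a x) := by
    rw [nil_LObj]
    obtain ⟨y, rfl⟩ := (ψ a).surjective x
    rw [← hψ]
    change o.symm (i a ((ψ a).symm _)) = nil V (o.symm (i a ((ψ a).symm _)))
    rw [LinearEquiv.symm_apply_apply, LinearEquiv.symm_apply_apply, map_smul, hX]
    exact o.symm_apply_apply _
  have hQ (a) (v : V) : Q a (nil V v) = nil (LObj k p (e a)) (Q a v) := by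
    rw [nil_LObj]
    change ψ a (q a (o (nil V v))) = ell k p (e a) * ψ a (q a (o v))
    rw [← hψ, ← map_smul, hX, o.symm_apply_apply]
  refine ⟨fun a => nilHom (V := LObj k p (e a)) (I a) (hI a),
    fun a => nilHom (W := LObj k p (e a)) (Q a) (hQ a), fun a => ?_, fun a b hab => ?_, ?_⟩
  · refine repLin_injective (LinearMap.ext fun x => ?_)
    change ψ a (q a (o (o.symm (i a ((ψ a).symm x))))) = x
    rw [o.apply_symm_apply, hqi, DirectSum.component.lof_self, LinearEquiv.apply_symm_apply]
  · refine repLin_injective (LinearMap.ext fun x => ?_)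
    change ψ b (q b (o (o.symm (i a ((ψ a).symm x))))) = 0
    rw [o.apply_symm_apply, hqi, DirectSum.component.of, dif_neg hab, map_zero]
  · refine repLin_injective (LinearMap.ext fun v => ?_)
    rw [repLin_sum, LinearMap.sum_apply]
    refine Eq.trans (Finset.sum_congr rfl fun a _ => ?_) ((map_sum o.symm _ _).symm.trans
      ((congrArg o.symm (hsum (o v))).trans (o.symm_apply_apply v)))
    change o.symm (i a ((ψ a).symm (ψ a (q a (o v))))) = o.symm (i a (q a (o v)))
    rw [LinearEquiv.symm_apply_apply]

end Classification

/-! ### Direct sums and dimensions of Hom spaces in linear categories. -/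

section Generic

open Limits

variable {C : Type u₁} [Category.{v₁} C] [Preadditive C]

lemma IsDirectSum.of_iso {ι : Type*} [Fintype ι] {M M' : C} {S : ι → C} (h : IsDirectSum M S)
    (e : M ≅ M') : IsDirectSum M' S := by
  obtain ⟨i, q, h₁, h₂, h₃⟩ := h
  refine ⟨fun a => i a ≫ e.hom, fun a => e.inv ≫ q a, fun a => by simp [h₁],
    fun a b hab => by simp [h₂ a b hab], ?_⟩
  have : e.inv ≫ (∑ a, q a ≫ i a) ≫ e.hom = 𝟙 M' := by rw [h₃]; simp
  simpa [Preadditive.sum_comp, Preadditive.comp_sum] using this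

lemma isBiprod_of_isBilimit {A B : C} {b : BinaryBicone A B} (hb : b.IsBilimit) :
    IsBiprod b.pt A B :=
  ⟨b.inl, b.inr, b.fst, b.snd, b.inl_fst, b.inr_snd, b.inl_snd, b.inr_fst,
    Limits.IsBilimit.binary_total hb⟩

lemma IsBiprod.exists_bicone {M A B : C} (h : IsBiprod M A B) :
    ∃ b : BinaryBicone A B, b.pt = M ∧ Nonempty b.IsBilimit := by
  obtain ⟨i₁, i₂, q₁, q₂, h₁, h₂, h₃, h₄, h₅⟩ := h
  exact ⟨⟨M, q₁, q₂, i₁, i₂, h₁, h₃, h₄, h₂⟩, rfl, ⟨isBinaryBilimitOfTotal _ h₅⟩⟩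

lemma directSums_iff (P : ObjectProperty C) (X : C) :
    directSums P X ↔ ∃ (n : ℕ) (Y : Fin n → C), (∀ a, P (Y a)) ∧ IsDirectSum X Y := by
  constructor
  · rintro ⟨n, Y, b, hY, ⟨hb⟩, ⟨e⟩⟩
    refine ⟨n, Y, hY, IsDirectSum.of_iso ⟨b.ι, b.π, fun a => bicone_ι_π_self b a,
      fun a a' h => bicone_ι_π_ne b h, Limits.IsBilimit.total hb⟩ e.symm⟩
  · rintro ⟨n, Y, hY, i, q, h₁, h₂, h₃⟩
    refine ⟨n, Y, ⟨X, q, i, fun a a' => ?_⟩, hY, ⟨isBilimitOfTotal _ h₃⟩, ⟨Iso.refl _⟩⟩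
    split_ifs with h
    · subst h; simpa using h₁ a
    · exact h₂ a a' h

lemma IsDirectSum.exists_fin {ι : Type*} [Fintype ι] {X : C} {S : ι → C} (h : IsDirectSum X S) :
    ∃ (n : ℕ) (e : Fin n ≃ ι), IsDirectSum X (S ∘ e) := by
  obtain ⟨i, q, h₁, h₂, h₃⟩ := h
  refine ⟨Fintype.card ι, (Fintype.equivFin ι).symm, fun a => i _, fun a => q _,
    fun a => h₁ _, fun a b hab => h₂ _ _ (fun h => hab (Equiv.injective _ h)), ?_⟩
  rw [← h₃]
  exact Equiv.sum_comp (Fintype.equivFin ι).symm (fun a => q a ≫ i a)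

/-- Summands whose identity is zero can be dropped; this removes the copies of `L_0` and `L_p` in
`Ver_p`. -/
lemma IsDirectSum.subtype {ι : Type*} [Fintype ι] {X : C} {S : ι → C} (h : IsDirectSum X S)
    (J : ι → Prop) [DecidablePred J] (hJ : ∀ a, ¬ J a → 𝟙 (S a) = 0) :
    IsDirectSum X (fun a : {a // J a} => S a) := by
  obtain ⟨i, q, h₁, h₂, h₃⟩ := h
  refine ⟨fun a => i a, fun a => q a, fun a => h₁ _,
    fun a b hab => h₂ _ _ (fun h => hab (Subtype.ext h)), ?_⟩
  rw [← h₃, ← Finset.sum_filter_add_sum_filter_not Finset.univ J,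
    Finset.sum_eq_zero (s := Finset.univ.filter fun a => ¬ J a), add_zero]
  · rw [Finset.sum_subtype (p := J) (Finset.univ.filter J) (by simp)]
  · intro a ha
    rw [← Category.id_comp (i a), hJ a (by simpa using ha)]
    simp

variable {k : Type w} [Field k] [Linear k C]

/-- Morphisms into a direct sum. -/
lemma IsBiprod.finrank_hom {M A B : C} (h : IsBiprod M A B) (T : C)
    [FiniteDimensional k (T ⟶ A)] [FiniteDimensional k (T ⟶ B)] :
    Module.finrank k (T ⟶ M) = Module.finrank k (T ⟶ A) + Module.finrank k (T ⟶ B) := by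
  obtain ⟨i₁, i₂, q₁, q₂, h₁, h₂, h₃, h₄, h₅⟩ := h
  rw [← Module.finrank_prod]
  refine LinearEquiv.finrank_eq
    { toFun := fun f => (f ≫ q₁, f ≫ q₂)
      map_add' := fun f g => by simp
      map_smul' := fun c f => by simp
      invFun := fun x => x.1 ≫ i₁ + x.2 ≫ i₂
      left_inv := fun f => by
        simp only [Category.assoc]
        rw [← Preadditive.comp_add, h₅, Category.comp_id]
      right_inv := fun x => by simp [h₁, h₂, h₃, h₄] }

lemma IsDirectSum.finrank_hom {ι : Type*} [Fintype ι] {M : C} {S : ι → C} (h : IsDirectSum M S)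
    (T : C) [∀ a, FiniteDimensional k (T ⟶ S a)] :
    Module.finrank k (T ⟶ M) = ∑ a, Module.finrank k (T ⟶ S a) := by
  classical
  obtain ⟨i, q, h₁, h₂, h₃⟩ := h
  rw [← Module.finrank_pi_fintype]
  refine LinearEquiv.finrank_eq
    { toFun := fun f a => f ≫ q a
      map_add' := fun f g => by ext; simp
      map_smul' := fun c f => by ext; simp
      invFun := fun x => ∑ a, x a ≫ i a
      left_inv := fun f => by
        simp only [Category.assoc]
        rw [← Preadditive.comp_sum, h₃, Category.comp_id]
      right_inv := fun x => by
        ext b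
        change (∑ a, x a ≫ i a) ≫ q b = x b
        rw [Preadditive.sum_comp, Finset.sum_eq_single b]
        · simp [h₁]
        · intro a _ hab
          simp [h₂ a b hab]
        · simp }

lemma finrank_hom_congr {X Y : C} (e : X ≅ Y) (T : C) :
    Module.finrank k (T ⟶ X) = Module.finrank k (T ⟶ Y) :=
  LinearEquiv.finrank_eq
    { toFun := fun f => f ≫ e.hom
      map_add' := fun f g => by simp
      map_smul' := fun c f => by simp
      invFun := fun f => f ≫ e.inv
      left_inv := fun f => by simp
      right_inv := fun f => by simp }

lemma finrank_hom_le_of_retract {X Y : C} (r : Retract X Y) (T : C)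
    [FiniteDimensional k (T ⟶ Y)] :
    Module.finrank k (T ⟶ X) ≤ Module.finrank k (T ⟶ Y) := by
  refine LinearMap.finrank_le_finrank_of_injective (f := Linear.rightComp k T r.i) ?_
  intro f g h
  have : (f ≫ r.i) ≫ r.r = (g ≫ r.i) ≫ r.r := congrArg (· ≫ r.r) h
  simpa using this

end Generic

/-! ### Simple objects of `Ver_p` and multiplicities. -/

section VerObjects

variable {k : Type u} [Field k] {p : ℕ} [Fact p.Prime]

instance (X Y : Ver k p) : FiniteDimensional k (X ⟶ Y) :=
  inferInstanceAs (FiniteDimensional k ((X.as ⟶ Y.as) ⧸ negligible k X.as Y.as))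

variable (k p) in
lemma exists_isBiprod (A B : Ver k p) : ∃ M : Ver k p, IsBiprod M A B := by
  have : Limits.HasBinaryBiproducts (FDRep k (Cyc p)) :=
    Limits.HasBinaryBiproducts.of_hasBinaryProducts
  exact ⟨_, (isBiprod_of_isBilimit
    (Limits.BinaryBiproduct.isBilimit A.as B.as)).map (NegQuotient.proj k)⟩

variable (k p) in
lemma L_hom_eq_smul (s : ℕ) (f : L k p s ⟶ L k p s) : ∃ c : k, f = c • 𝟙 _ := by
  obtain ⟨g, rfl⟩ := NegQuotient.proj_map_surjective f
  obtain ⟨c, hc⟩ := exists_isNegligible_sub_smul g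
  exact ⟨c, (NegQuotient.proj_map_eq_iff _ _).2 hc⟩

variable (k) in
/-- The multiplicity of `L_t` in `X`. -/
def mult (t : ℕ) (X : Ver k p) : ℕ := Module.finrank k (L k p t ⟶ X)

variable [CharP k p]

lemma L_hom_eq_zero {s t : ℕ} (hs : s ≤ p) (ht : t ≤ p) (hst : s ≠ t) (f : L k p s ⟶ L k p t) :
    f = 0 := by
  obtain ⟨g, rfl⟩ := NegQuotient.proj_map_surjective f
  refine (NegQuotient.proj_map_eq_iff g 0).2 ?_
  rw [sub_zero]
  exact isNegligible_of_ne hs ht hst g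

lemma id_L_ne_zero {s : ℕ} (h0 : 0 < s) (hs : s < p) : 𝟙 (L k p s) ≠ 0 := by
  intro h
  have h1 := (NegQuotient.proj_map_eq_iff (k := k) (𝟙 (LObj k p s)) 0).1 h
  rw [sub_zero] at h1
  exact not_isNegligible_id_LObj h0 hs h1

lemma id_L_eq_zero {s : ℕ} (hs : s ≤ p) (h : ¬ (0 < s ∧ s < p)) : 𝟙 (L k p s) = 0 := by
  refine (NegQuotient.proj_map_eq_iff (k := k) (𝟙 (LObj k p s)) 0).2 ?_
  rw [sub_zero]
  rcases Nat.eq_zero_or_pos s with rfl | h0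
  · have : 𝟙 (LObj k p 0) = 0 := repLin_injective (LinearMap.ext fun a =>
      (subsingleton_LSpace_zero (k := k) (p := p)).elim _ _)
    rw [this]
    exact zero_mem (negligible k (LObj k p 0) (LObj k p 0))
  · obtain rfl : s = p := by omega
    exact isNegligible_id_LObj_self

/-- Schur's lemma for the labels `0 < t < p`. The labels 0 and `p` are allowed and give zero, so the
recursion for `L_2 ⊗ -` needs no boundary cases. -/
lemma mult_L {s t : ℕ} (hs : s ≤ p) (ht : t ≤ p) :
    mult k t (L k p s) = if s = t ∧ 0 < t ∧ t < p then 1 else 0 := by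
  split_ifs with h
  · obtain ⟨rfl, h0, h1⟩ := h
    exact finrank_eq_one (𝟙 _) (id_L_ne_zero h0 h1) fun f => by
      obtain ⟨c, rfl⟩ := L_hom_eq_smul k p s f
      exact ⟨c, rfl⟩
  · have : Subsingleton (L k p t ⟶ L k p s) := by
      refine ⟨fun f g => ?_⟩
      by_cases hst : s = t
      · subst hst
        have h0 := id_L_eq_zero (k := k) hs (fun h' => h ⟨rfl, h'⟩)
        rw [← Category.id_comp f, ← Category.id_comp g, h0]
        simp
      · rw [L_hom_eq_zero ht hs (Ne.symm hst) f, L_hom_eq_zero ht hs (Ne.symm hst) g]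
    exact Module.finrank_zero_of_subsingleton

lemma mult_eq_zero {t : ℕ} (ht : t ≤ p) (h : ¬ (0 < t ∧ t < p)) (X : Ver k p) :
    mult k t X = 0 := by
  have : Subsingleton (L k p t ⟶ X) := by
    refine ⟨fun f g => ?_⟩
    rw [← Category.id_comp f, ← Category.id_comp g, id_L_eq_zero ht h]
    simp
  exact Module.finrank_zero_of_subsingleton

-- Project the decomposition from `FDRep` and discard the summands that became zero.
variable (k p) in
lemma exists_isDirectSum_L (X : Ver k p) :
    ∃ (d : ℕ) (e : Fin d → ℕ), (∀ a, 0 < e a ∧ e a < p) ∧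
      IsDirectSum X (fun a => L k p (e a)) := by
  classical
  obtain ⟨d, e, he, h⟩ := exists_isDirectSum_LObj X.as
  have h1 := (h.map (NegQuotient.proj k)).subtype (fun a => 0 < e a ∧ e a < p)
    (fun a ha => id_L_eq_zero (he a) ha)
  obtain ⟨n, φ, h2⟩ := h1.exists_fin
  exact ⟨n, fun a => e (φ a), fun a => (φ a).2, h2⟩

variable (k p) in
/-- `L_1` is the unit object. -/
def LOneIso : L k p 1 ≅ 𝟙_ (Ver k p) := (NegQuotient.proj k).mapIso LObjOneIso

lemma L_isBiprod_tensor_two (n : ℕ) (hn : n + 3 ≤ p) :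
    IsBiprod (L k p 2 ⊗ L k p (n + 2)) (L k p (n + 3)) (L k p (n + 1)) :=
  (isBiprod_tensor_two n hn).map (NegQuotient.proj k)

end VerObjects

/-! ### The fusion rules and the subcategories they define. -/

section Fusion

variable {k : Type u} [Field k] {p : ℕ} [Fact p.Prime]

lemma mult_congr {X Y : Ver k p} (e : X ≅ Y) (t : ℕ) : mult k t X = mult k t Y :=
  finrank_hom_congr e _

lemma IsBiprod.mult_eq {M A B : Ver k p} (h : IsBiprod M A B) (t : ℕ) :
    mult k t M = mult k t A + mult k t B :=
  h.finrank_hom _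

lemma IsDirectSum.mult_eq {ι : Type*} [Fintype ι] {M : Ver k p} {S : ι → Ver k p}
    (h : IsDirectSum M S) (t : ℕ) : mult k t M = ∑ a, mult k t (S a) :=
  h.finrank_hom _

lemma IsBiprod.tensorRight {M A B : Ver k p} (h : IsBiprod M A B) (X : Ver k p) :
    IsBiprod (M ⊗ X) (A ⊗ X) (B ⊗ X) :=
  h.map (MonoidalCategory.tensorRight X)

lemma IsDirectSum.tensorLeft {ι : Type*} [Fintype ι] {M : Ver k p} {S : ι → Ver k p}
    (h : IsDirectSum M S) (X : Ver k p) : IsDirectSum (X ⊗ M) (fun a => X ⊗ S a) :=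
  h.map (MonoidalCategory.tensorLeft X)

lemma IsDirectSum.tensorRight {ι : Type*} [Fintype ι] {M : Ver k p} {S : ι → Ver k p}
    (h : IsDirectSum M S) (X : Ver k p) : IsDirectSum (M ⊗ X) (fun a => S a ⊗ X) :=
  h.map (MonoidalCategory.tensorRight X)

/-- `L_t` occurs in `L_r ⊗ L_s`. -/
def Fus (p r s t : ℕ) : Prop :=
  (r + s + t) % 2 = 1 ∧ t < r + s ∧ r < s + t ∧ s < r + t ∧ r + s + t < 2 * p

/-- The multiplicity of `L_t` in `L_r ⊗ L_s`. -/
def fusNum (p r s t : ℕ) : ℕ :=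
  if (r + s + t) % 2 = 1 ∧ t < r + s ∧ r < s + t ∧ s < r + t ∧ r + s + t < 2 * p then 1 else 0

lemma fusNum_ne_zero_iff {p r s t : ℕ} : fusNum p r s t ≠ 0 ↔ Fus p r s t := by
  simp [fusNum, Fus]

variable (k) in
/-- Direct sums of the `L_s` with `s ∈ T`. -/
def VerOf (T : Set ℕ) : ObjectProperty (Ver k p) := directSums fun X => ∃ s ∈ T, X = L k p s

lemma exists_fin_of_verOf {T : Set ℕ} {X : Ver k p} (hX : VerOf k T X) :
    ∃ (d : ℕ) (e : Fin d → ℕ), (∀ a, e a ∈ T) ∧ IsDirectSum X (fun a => L k p (e a)) := by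
  obtain ⟨n, Y, hY, h⟩ := (directSums_iff _ _).1 hX
  choose e he hYe using hY
  obtain rfl : Y = fun a => L k p (e a) := funext hYe
  exact ⟨n, e, he, h⟩

variable [CharP k p]

variable (k p) in
/-- `L_1 ⊗ X` is isomorphic to `X`. -/
def LOneTensorIso (X : Ver k p) : L k p 1 ⊗ X ≅ X :=
  whiskerRightIso (LOneIso k p) X ≪≫ λ_ X

variable (k p) in
/-- `X ⊗ L_1` is isomorphic to `X`. -/
def tensorLOneIso (X : Ver k p) : X ⊗ L k p 1 ≅ X :=
  whiskerLeftIso X (LOneIso k p) ≪≫ ρ_ X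

lemma mult_L_two_tensor_L {s t : ℕ} (hs0 : 0 < s) (hs : s < p) (ht0 : 0 < t) (ht : t < p) :
    mult k t (L k p 2 ⊗ L k p s) = mult k (t - 1) (L k p s) + mult k (t + 1) (L k p s) := by
  have hp := (Fact.out : p.Prime).two_le
  rw [mult_L (by omega) (by omega), mult_L (by omega) (by omega)]
  obtain rfl | ⟨n, rfl⟩ : s = 1 ∨ ∃ n, s = n + 2 := by
    rcases s with _ | _ | n
    · omega
    · exact Or.inl rfl
    · exact Or.inr ⟨n, rfl⟩
  · rw [mult_congr (tensorLOneIso k p _), mult_L (by omega) (by omega)]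
    split_ifs <;> omega
  -- For `n + 3 = p` the summand `L_p` contributes zero.
  · rw [(L_isBiprod_tensor_two n (by omega)).mult_eq, mult_L (by omega) (by omega),
      mult_L (by omega) (by omega)]
    split_ifs <;> omega

lemma mult_L_two_tensor {t : ℕ} (ht0 : 0 < t) (ht : t < p) (X : Ver k p) :
    mult k t (L k p 2 ⊗ X) = mult k (t - 1) X + mult k (t + 1) X := by
  obtain ⟨d, e, he, h⟩ := exists_isDirectSum_L k p X
  rw [(h.tensorLeft _).mult_eq, h.mult_eq, h.mult_eq, ← Finset.sum_add_distrib]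
  exact Finset.sum_congr rfl fun a _ => mult_L_two_tensor_L (he a).1 (he a).2 ht0 ht

/-- The recursion `L_2 ⊗ L_{n+2} = L_{n+3} ⊕ L_{n+1}`, tensored with `L_s`, determines the
multiplicities for `n + 3` from those for `n + 2` and `n + 1`. The truncated Clebsch-Gordan numbers
satisfy the same recursion, the bound `r + s + t < 2 * p` coming from the vanishing at label `p`. -/
lemma mult_L_tensor_L {r s t : ℕ} (hr0 : 0 < r) (hr : r < p) (hs0 : 0 < s) (hs : s < p)
    (ht : t ≤ p) : mult k t (L k p r ⊗ L k p s) = fusNum p r s t := by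
  induction r using Nat.strong_induction_on generalizing t with
  | _ r ih =>
    by_cases ht' : 0 < t ∧ t < p
    · obtain rfl | rfl | ⟨n, rfl⟩ : r = 1 ∨ r = 2 ∨ ∃ n, r = n + 3 := by
        rcases r with _ | _ | _ | n
        · omega
        · exact Or.inl rfl
        · exact Or.inr (Or.inl rfl)
        · exact Or.inr (Or.inr ⟨n, rfl⟩)
      · rw [mult_congr (LOneTensorIso k p _), mult_L hs.le ht]
        simp only [fusNum]
        split_ifs <;> omega
      · rw [mult_L_two_tensor ht'.1 ht'.2, mult_L hs.le (by omega), mult_L hs.le (by omega)]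
        simp only [fusNum]
        split_ifs <;> omega
      · have h1 := mult_L_two_tensor (k := k) ht'.1 ht'.2 (L k p (n + 2) ⊗ L k p s)
        rw [ih (n + 2) (by omega) (by omega) (by omega) (by omega),
          ih (n + 2) (by omega) (by omega) (by omega) (by omega),
          ← mult_congr (α_ (L k p 2) (L k p (n + 2)) (L k p s)),
          ((L_isBiprod_tensor_two n (by omega)).tensorRight _).mult_eq,
          ih (n + 1) (by omega) (by omega) (by omega) (by omega)] at h1
        generalize mult k t (L k p (n + 3) ⊗ L k p s) = m at h1 ⊢
        simp only [fusNum] at h1 ⊢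
        split_ifs at h1 ⊢ <;> omega
    · rw [mult_eq_zero ht ht', fusNum, if_neg]
      omega

/-- With `mem_of_mult_ne_zero`, this turns membership in `VerOf` into a condition on multiplicities,
which are additive and monotone under retracts. -/
lemma verOf_of_forall {T : Set ℕ} {X : Ver k p}
    (h : ∀ t, 0 < t → t < p → mult k t X ≠ 0 → t ∈ T) : VerOf k T X := by
  obtain ⟨d, e, he, hX⟩ := exists_isDirectSum_L k p X
  refine (directSums_iff _ _).2 ⟨d, fun a => L k p (e a), fun a => ⟨e a, ?_, rfl⟩, hX⟩
  refine h _ (he a).1 (he a).2 ?_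
  rw [hX.mult_eq]
  intro h0
  have h1 := Finset.sum_eq_zero_iff.1 h0 a (Finset.mem_univ _)
  rw [mult_L (he a).2.le (he a).2.le, if_pos ⟨rfl, he a⟩] at h1
  exact one_ne_zero h1

lemma mem_of_mult_ne_zero {T : Set ℕ} (hT : ∀ s ∈ T, 0 < s ∧ s < p) {X : Ver k p}
    (hX : VerOf k T X) {t : ℕ} (ht : t ≤ p) (h : mult k t X ≠ 0) : t ∈ T := by
  obtain ⟨d, e, he, hS⟩ := exists_fin_of_verOf hX
  rw [hS.mult_eq] at h
  obtain ⟨a, -, ha⟩ := Finset.exists_ne_zero_of_sum_ne_zero h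
  rw [mult_L (hT _ (he a)).2.le ht] at ha
  split_ifs at ha with h1
  · exact h1.1 ▸ he a
  · exact absurd rfl ha

lemma verOf_L_iff {T : Set ℕ} (hT : ∀ s ∈ T, 0 < s ∧ s < p) {t : ℕ} (ht0 : 0 < t) (ht : t < p) :
    VerOf k T (L k p t) ↔ t ∈ T := by
  constructor
  · intro h
    refine mem_of_mult_ne_zero hT h ht.le ?_
    rw [mult_L ht.le ht.le, if_pos ⟨rfl, ht0, ht⟩]
    exact one_ne_zero
  · intro h
    refine verOf_of_forall fun s hs0 hs hm => ?_
    rw [mult_L ht.le hs.le] at hm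
    split_ifs at hm with h1
    · exact h1.1 ▸ h
    · exact absurd rfl hm

/-- A set of indices closed under the fusion rules. -/
structure IsFusionClosed (p : ℕ) (T : Set ℕ) : Prop where
  bounds : ∀ s ∈ T, 0 < s ∧ s < p
  one_mem : 1 ∈ T
  mem_of_fus : ∀ r ∈ T, ∀ s ∈ T, ∀ t, Fus p r s t → t ∈ T

lemma IsFusionClosed.isFusionSubcategory {T : Set ℕ} (hT : IsFusionClosed p T) :
    IsFusionSubcategory (VerOf k T : ObjectProperty (Ver k p)) where
  prop_unit := verOf_of_forall fun t ht0 ht h => by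
    have hp := (Fact.out : p.Prime).two_le
    rw [← mult_congr (LOneIso k p), mult_L (by omega) ht.le] at h
    split_ifs at h with h1
    · exact h1.1 ▸ hT.one_mem
    · exact absurd rfl h
  prop_tensor X Y hX hY := verOf_of_forall fun t ht0 ht h => by
    obtain ⟨d, e, he, hX⟩ := exists_fin_of_verOf hX
    obtain ⟨d', e', he', hY⟩ := exists_fin_of_verOf hY
    rw [(hX.tensorRight Y).mult_eq] at h
    obtain ⟨a, -, ha⟩ := Finset.exists_ne_zero_of_sum_ne_zero h
    rw [(hY.tensorLeft _).mult_eq] at ha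
    obtain ⟨b, -, hb⟩ := Finset.exists_ne_zero_of_sum_ne_zero ha
    rw [mult_L_tensor_L (hT.bounds _ (he a)).1 (hT.bounds _ (he a)).2 (hT.bounds _ (he' b)).1
      (hT.bounds _ (he' b)).2 ht.le, fusNum_ne_zero_iff] at hb
    exact hT.mem_of_fus _ (he a) _ (he' b) _ hb
  of_retract r hY := verOf_of_forall fun t _ ht h =>
    mem_of_mult_ne_zero hT.bounds hY ht.le
      (fun h0 => h (Nat.le_zero.1 (h0 ▸ finrank_hom_le_of_retract r (L k p t))))
  prop_biprod {X Y} b hb hX hY := verOf_of_forall fun t _ ht h => by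
    rw [(isBiprod_of_isBilimit hb).mult_eq] at h
    by_cases h0 : mult k t X = 0
    · exact mem_of_mult_ne_zero hT.bounds hY ht.le (by omega)
    · exact mem_of_mult_ne_zero hT.bounds hX ht.le h0

end Fusion

/-! ### Fusion subcategories are determined by their simple objects. -/

section FusionSubcategory

open Limits

variable {C : Type u₁} [Category.{v₁} C] [Preadditive C] [MonoidalCategory C]
  {P : ObjectProperty C}

/-- Closure is assumed for binary sums only, so `X` is exhibited as a retract of an iterated binary
sum. -/
lemma IsFusionSubcategory.of_isDirectSum (hP : IsFusionSubcategory P)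
    (hC : ∀ A B : C, ∃ M, IsBiprod M A B) {ι : Type*} [Fintype ι] {X : C} {S : ι → C}
    (h : IsDirectSum X S) (hS : ∀ a, P (S a)) : P X := by
  classical
  obtain ⟨i, q, -, -, h₃⟩ := h
  have key (s : Finset ι) : ∃ (A : C) (f : X ⟶ A) (g : A ⟶ X),
      P A ∧ f ≫ g = ∑ a ∈ s, q a ≫ i a := by
    induction s using Finset.induction_on with
    -- The unit with zero maps serves as the start of the iteration, which avoids asking for a zero
    -- object in the subcategory.
    | empty => exact ⟨𝟙_ C, 0, 0, hP.prop_unit, by simp⟩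
    | insert a s ha ih =>
      obtain ⟨A, f, g, hA, hfg⟩ := ih
      obtain ⟨M, hM⟩ := hC (S a) A
      obtain ⟨b, rfl, ⟨hb⟩⟩ := hM.exists_bicone
      refine ⟨b.pt, q a ≫ b.inl + f ≫ b.inr, b.fst ≫ i a + b.snd ≫ g,
        hP.prop_biprod b hb (hS a) hA, ?_⟩
      rw [Finset.sum_insert ha, ← hfg]
      simp
  obtain ⟨A, f, g, hA, hfg⟩ := key Finset.univ
  exact hP.of_retract ⟨f, g, hfg.trans h₃⟩ hA

end FusionSubcategory

section Classify

variable {k : Type u} [Field k] {p : ℕ} [Fact p.Prime] [CharP k p]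
  {P : ObjectProperty (Ver k p)}

/-- A simple object with nonzero multiplicity is a summand, and summands stay in the subcategory. -/
lemma IsFusionSubcategory.L_of_mult_ne_zero (hP : IsFusionSubcategory P) {X : Ver k p} (hX : P X)
    {t : ℕ} (ht : t ≤ p) (h : mult k t X ≠ 0) : P (L k p t) := by
  obtain ⟨d, e, he, hS⟩ := exists_isDirectSum_L k p X
  rw [hS.mult_eq] at h
  obtain ⟨a, -, ha⟩ := Finset.exists_ne_zero_of_sum_ne_zero h
  rw [mult_L (he a).2.le ht] at ha
  split_ifs at ha with h1
  · obtain ⟨i, q, h₁, -, -⟩ := hS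
    rw [← h1.1]
    exact hP.of_retract ⟨i a, q a, h₁ a⟩ hX
  · exact absurd rfl ha

/-- The indices of the simple objects in a subcategory. -/
def indices (P : ObjectProperty (Ver k p)) : Set ℕ := {t | (0 < t ∧ t < p) ∧ P (L k p t)}

lemma IsFusionSubcategory.eq_verOf (hP : IsFusionSubcategory P) : P = VerOf k (indices P) := by
  funext X
  refine propext ⟨fun hX => ?_, fun hX => ?_⟩
  · exact verOf_of_forall fun t ht0 ht h => ⟨⟨ht0, ht⟩, hP.L_of_mult_ne_zero hX ht.le h⟩
  · obtain ⟨d, e, he, hS⟩ := exists_fin_of_verOf hX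
    exact hP.of_isDirectSum (exists_isBiprod k p) hS fun a => (he a).2

lemma IsFusionSubcategory.isFusionClosed (hP : IsFusionSubcategory P) :
    IsFusionClosed p (indices P) where
  bounds _ hs := hs.1
  one_mem := ⟨⟨one_pos, (Fact.out : p.Prime).one_lt⟩,
    hP.of_retract (LOneIso k p).retract hP.prop_unit⟩
  mem_of_fus r hr s hs t h := by
    have ht : 0 < t ∧ t < p := by
      simp only [Fus] at h; omega
    refine ⟨ht, hP.L_of_mult_ne_zero (hP.prop_tensor _ _ hr.2 hs.2) ht.2.le ?_⟩
    rw [mult_L_tensor_L hr.1.1 hr.1.2 hs.1.1 hs.1.2 ht.2.le, fusNum_ne_zero_iff]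
    exact h

end Classify

/-! ### Label sets closed under the fusion rule. -/

section Combinatorics

variable {p : ℕ} {T : Set ℕ}

lemma isFusionClosed_one (hp : 1 < p) : IsFusionClosed p {1} where
  bounds s hs := by simp only [Set.mem_singleton_iff] at hs; omega
  one_mem := rfl
  mem_of_fus r hr s hs t h := by
    simp only [Set.mem_singleton_iff, Fus] at *; omega

lemma isFusionClosed_pair (hp : 1 < p) : IsFusionClosed p {1, p - 1} where
  bounds s hs := by simp only [Set.mem_insert_iff, Set.mem_singleton_iff] at hs; omega
  one_mem := Or.inl rfl
  mem_of_fus r hr s hs t h := by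
    simp only [Set.mem_insert_iff, Set.mem_singleton_iff, Fus] at *; omega

lemma isFusionClosed_odd (hp : 1 < p) : IsFusionClosed p {s | Odd s ∧ s < p} where
  bounds s hs := ⟨hs.1.pos, hs.2⟩
  one_mem := ⟨odd_one, hp⟩
  mem_of_fus r hr s hs t h := by
    simp only [Set.mem_ofPred_eq, Fus, Nat.odd_iff] at *; omega

lemma isFusionClosed_all (hp : 1 < p) : IsFusionClosed p {s | 0 < s ∧ s < p} where
  bounds s hs := hs
  one_mem := ⟨one_pos, hp⟩
  mem_of_fus r hr s hs t h := by
    simp only [Set.mem_ofPred_eq, Fus] at *; omega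

/-- The label `r + 2` occurs in the product of 3 and `r` as long as `r + 2 < p`. -/
lemma IsFusionClosed.add_two_mul_mem (hT : IsFusionClosed p T) (h3 : 3 ∈ T) {r : ℕ} (hr : r ∈ T)
    (j : ℕ) (hj : r + 2 * j < p) : r + 2 * j ∈ T := by
  induction j with
  | zero => exact hr
  | succ j ih =>
    have h := hT.bounds r hr
    refine hT.mem_of_fus 3 h3 (r + 2 * j) (ih (by omega)) _ ?_
    simp only [Fus]; omega

lemma IsFusionClosed.odd_subset (hT : IsFusionClosed p T) (h3 : 3 ∈ T) :
    {s | Odd s ∧ s < p} ⊆ T := by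
  rintro s ⟨⟨j, rfl⟩, hs⟩
  rw [add_comm]
  exact hT.add_two_mul_mem h3 hT.one_mem j (by omega)

lemma IsFusionClosed.eq_or (hT : IsFusionClosed p T) (hp : Odd p) :
    T = {1} ∨ T = {1, p - 1} ∨ T = {s | Odd s ∧ s < p} ∨ T = {s | 0 < s ∧ s < p} := by
  by_cases h : ∃ s ∈ T, 1 < s ∧ s < p - 1
  · obtain ⟨s, hs, h1, h2⟩ := h
    -- Label 3 occurs in the square of `s` exactly when `3 < 2 * s` and `2 * s + 3 < 2 * p`, which
    -- is the range `1 < s < p - 1`.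
    have h3 : 3 ∈ T := hT.mem_of_fus s hs s hs 3 (by simp only [Fus]; omega)
    have hodd := hT.odd_subset h3
    by_cases he : ∃ r ∈ T, Even r
    · obtain ⟨r, hr, he⟩ := he
      have hrp := hT.bounds r hr
      obtain ⟨m, hm⟩ := hp
      obtain ⟨l, hl⟩ := he
      -- From the even label `r`, steps of 2 reach `p - 1`, which is even because `p` is odd.
      have h4 : p - 1 ∈ T := by
        have := hT.add_two_mul_mem h3 hr (m - l) (by omega)
        rwa [show r + 2 * (m - l) = p - 1 by omega] at this
      refine Or.inr (Or.inr (Or.inr (Set.Subset.antisymm hT.bounds fun t ht => ?_)))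
      rcases Nat.even_or_odd t with ht' | ht'
      · obtain ⟨j, hj⟩ := ht'
        have ht0 : 0 < t ∧ t < p := ht
        -- For even `t` the label `p - t` is odd, hence already in `T`, and its product with `p - 1`
        -- contains `t`.
        refine hT.mem_of_fus (p - 1) h4 (p - t) (hodd ⟨⟨m - j, by omega⟩, by omega⟩) t ?_
        simp only [Fus]; omega
      · exact hodd ⟨ht', ht.2⟩
    · push Not at he
      exact Or.inr (Or.inr (Or.inl (Set.Subset.antisymm
        (fun t ht => ⟨Nat.not_even_iff_odd.1 (he t ht), (hT.bounds t ht).2⟩) hodd)))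
  · push Not at h
    have hsub : ∀ s ∈ T, s = 1 ∨ s = p - 1 := fun s hs => by
      have := hT.bounds s hs
      have := h s hs
      omega
    by_cases h4 : p - 1 ∈ T
    · refine Or.inr (Or.inl (Set.Subset.antisymm hsub ?_))
      rintro s (rfl | rfl)
      exacts [hT.one_mem, h4]
    · refine Or.inl (Set.Subset.antisymm (fun s hs => ?_) (by simpa using hT.one_mem))
      exact (hsub s hs).resolve_right fun h => h4 (h ▸ hs)

end Combinatorics

/-! ### Statements (i) and (ii). -/

section Main

variable (k : Type u) [Field k] (p : ℕ) [Fact p.Prime] [CharP k p]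

omit [CharP k p] in
lemma verVec_eq : VerVec k p = VerOf k {1} := by
  simp [VerVec, VerOf]

omit [CharP k p] in
lemma verSVec_eq : VerSVec k p = VerOf k {1, p - 1} := by
  simp [VerSVec, VerOf]

omit [CharP k p] in
lemma verPlus_eq : VerPlus k p = VerOf k {s | Odd s ∧ s < p} := by
  simp [VerPlus, VerOf, and_assoc]

lemma top_eq : (⊤ : ObjectProperty (Ver k p)) = VerOf k {s | 0 < s ∧ s < p} := by
  funext X
  exact propext ⟨fun _ => verOf_of_forall fun t h0 h _ => ⟨h0, h⟩, fun _ => trivial⟩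

lemma isFusionSubcategory_iff (hp : 3 < p) (P : ObjectProperty (Ver k p)) :
    IsFusionSubcategory P ↔ P = VerVec k p ∨ P = VerSVec k p ∨ P = VerPlus k p ∨ P = ⊤ := by
  rw [verVec_eq, verSVec_eq, verPlus_eq, top_eq]
  constructor
  · intro hP
    have hodd : Odd p := (Fact.out : p.Prime).odd_of_ne_two (by omega)
    rcases hP.isFusionClosed.eq_or hodd with h | h | h | h
    · exact Or.inl (h ▸ hP.eq_verOf)
    · exact Or.inr (Or.inl (h ▸ hP.eq_verOf))
    · exact Or.inr (Or.inr (Or.inl (h ▸ hP.eq_verOf)))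
    · exact Or.inr (Or.inr (Or.inr (h ▸ hP.eq_verOf)))
  · rintro (rfl | rfl | rfl | rfl)
    · exact (isFusionClosed_one (by omega)).isFusionSubcategory
    · exact (isFusionClosed_pair (by omega)).isFusionSubcategory
    · exact (isFusionClosed_odd (by omega)).isFusionSubcategory
    · exact (isFusionClosed_all (by omega)).isFusionSubcategory

lemma isLeast_verPlus (hp : 3 < p) :
    IsLeast {P : ObjectProperty (Ver k p) | IsFusionSubcategory P ∧ P (L k p 3)}
      (VerPlus k p) := by
  rw [verPlus_eq]
  have hT := isFusionClosed_odd (p := p) (by omega)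
  refine ⟨⟨hT.isFusionSubcategory, (verOf_L_iff hT.bounds (by omega) hp).2 ⟨by decide, hp⟩⟩, ?_⟩
  rintro P ⟨hP, h3⟩ X hX
  obtain ⟨d, e, he, hS⟩ := exists_fin_of_verOf hX
  have := hP.isFusionClosed.odd_subset ⟨⟨by omega, hp⟩, h3⟩
  exact hP.of_isDirectSum (exists_isBiprod k p) hS fun a => (this (he a)).2

/-- The set is recovered from the subcategory by testing the simple objects. Distinctness of the
four subcategories thus reduces to the labels 3 and `p - 1`. -/
lemma verOf_injective {S T : Set ℕ} (hS : IsFusionClosed p S) (hT : IsFusionClosed p T)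
    (h : (VerOf k S : ObjectProperty (Ver k p)) = VerOf k T) : S = T := by
  ext t
  constructor
  · intro ht
    have hb := hS.bounds t ht
    rw [← verOf_L_iff (k := k) hT.bounds hb.1 hb.2, ← h, verOf_L_iff hS.bounds hb.1 hb.2]
    exact ht
  · intro ht
    have hb := hT.bounds t ht
    rw [← verOf_L_iff (k := k) hS.bounds hb.1 hb.2, h, verOf_L_iff hT.bounds hb.1 hb.2]
    exact ht

lemma pairwise_ne (hp : 3 < p) :
    [VerVec k p, VerSVec k p, VerPlus k p, ⊤].Pairwise (· ≠ ·) := by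
  have hodd : Odd p := (Fact.out : p.Prime).odd_of_ne_two (by omega)
  have h1 := isFusionClosed_one (p := p) (by omega)
  have h2 := isFusionClosed_pair (p := p) (by omega)
  have h3 := isFusionClosed_odd (p := p) (by omega)
  have h4 := isFusionClosed_all (p := p) (by omega)
  have m3 : 3 ∈ {s | Odd s ∧ s < p} := ⟨by decide, hp⟩
  have m3' : 3 ∈ {s | 0 < s ∧ s < p} := ⟨by decide, hp⟩
  have m2' : p - 1 ∈ {s | 0 < s ∧ s < p} := ⟨by omega, by omega⟩
  have m2 : p - 1 ∈ ({1, p - 1} : Set ℕ) := Or.inr rfl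
  have n2 : p - 1 ∉ {s | Odd s ∧ s < p} := fun h => by
    have := Nat.odd_iff.1 h.1
    have := Nat.odd_iff.1 hodd
    omega
  -- By parity: `p - 1` is even.
  have n3 : 3 ∉ ({1, p - 1} : Set ℕ) := by
    obtain ⟨m, rfl⟩ := hodd
    simp only [Set.mem_insert_iff, Set.mem_singleton_iff]
    omega
  have n31 : 3 ∉ ({1} : Set ℕ) := by simp
  have n21 : p - 1 ∉ ({1} : Set ℕ) := by
    rw [Set.mem_singleton_iff]; omega
  rw [verVec_eq, verSVec_eq, verPlus_eq, top_eq]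
  have e12 : (VerOf k {1} : ObjectProperty (Ver k p)) ≠ VerOf k {1, p - 1} := fun h =>
    n21 (verOf_injective k p h1 h2 h ▸ m2)
  have e13 : (VerOf k {1} : ObjectProperty (Ver k p)) ≠ VerOf k {s | Odd s ∧ s < p} := fun h =>
    n31 (verOf_injective k p h1 h3 h ▸ m3)
  have e14 : (VerOf k {1} : ObjectProperty (Ver k p)) ≠ VerOf k {s | 0 < s ∧ s < p} := fun h =>
    n31 (verOf_injective k p h1 h4 h ▸ m3')
  have e23 : (VerOf k {1, p - 1} : ObjectProperty (Ver k p)) ≠ VerOf k {s | Odd s ∧ s < p} :=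
    fun h => n3 (verOf_injective k p h2 h3 h ▸ m3)
  have e24 : (VerOf k {1, p - 1} : ObjectProperty (Ver k p)) ≠ VerOf k {s | 0 < s ∧ s < p} :=
    fun h => n3 (verOf_injective k p h2 h4 h ▸ m3')
  have e34 : (VerOf k {s | Odd s ∧ s < p} : ObjectProperty (Ver k p)) ≠
      VerOf k {s | 0 < s ∧ s < p} := fun h => n2 (verOf_injective k p h3 h4 h ▸ m2')
  simp [e12, e13, e14, e23, e24, e34]

end Main

/-! ### Inverses of braided equivalences. -/

section Braided

open Functor.LaxMonoidal Functor.OplaxMonoidal Functor.Monoidal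

variable {C : Type u₁} [Category.{v₁} C] [MonoidalCategory C] [BraidedCategory C]
  {D : Type u₂} [Category.{v₂} D] [MonoidalCategory D] [BraidedCategory D]

/-- The inverse of a braided equivalence is braided. -/
abbrev inverseBraided (e : C ≌ D) [e.functor.Braided] : e.inverse.Braided :=
  letI : e.inverse.Monoidal := e.inverseMonoidal
  haveI : e.toAdjunction.IsMonoidal := by
    constructor
    · rfl
    · exact fun _ _ => rfl
  { (inferInstance : e.inverse.Monoidal) with
    braided := fun X Y => by
      -- The identity is checked after applying the functor and the counit, where the monoidal
      -- structure of the inverse is expressed by that of the functor.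
      apply e.functor.map_injective
      rw [← cancel_mono (e.toAdjunction.counit.app (Y ⊗ X)), Functor.map_comp, Functor.map_comp,
        Category.assoc, Category.assoc]
      have h1 := e.toAdjunction.map_μ_comp_counit_app_tensor X Y
      have h2 := e.toAdjunction.map_μ_comp_counit_app_tensor Y X
      have h3 := e.toAdjunction.counit.naturality (β_ X Y).hom
      dsimp at h1 h2 h3 ⊢
      rw [h3, reassoc_of% h1, h2, BraidedCategory.braiding_naturality, Functor.map_braiding]
      simp }

end Braided

/-! ### Functoriality of the Karoubian envelope as a symmetric tensor category. -/

section KaroubiFunctor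

open CategoryTheory.Idempotents Functor.LaxMonoidal Functor.OplaxMonoidal Functor.Monoidal

variable {C : Type u₁} [Category.{v₁} C] {D : Type u₂} [Category.{v₂} D]

/-- The functor induced on Karoubian envelopes. -/
def karoubiMap (G : C ⥤ D) : Karoubi C ⥤ Karoubi D where
  obj P := ⟨G.obj P.X, G.map P.p, by rw [← G.map_comp, P.idem]⟩
  map {P Q} f := ⟨G.map f.f, by
    change G.map P.p ≫ G.map f.f ≫ G.map Q.p = G.map f.f
    rw [← G.map_comp, ← G.map_comp, f.comm]⟩

instance (G : C ⥤ D) [G.Faithful] : (karoubiMap G).Faithful where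
  map_injective h := Karoubi.hom_ext _ _ (G.map_injective (congrArg Karoubi.Hom.f h))

instance (G : C ⥤ D) [G.Full] [G.Faithful] : (karoubiMap G).Full where
  map_surjective {P Q} f := by
    obtain ⟨g, hg⟩ := G.map_surjective (X := P.X) (Y := Q.X) f.f
    refine ⟨⟨g, G.map_injective ?_⟩, Karoubi.hom_ext _ _ hg⟩
    rw [G.map_comp, G.map_comp, hg]
    exact f.comm

/-- Given `(Y, e)` with `Y` a retract of `G X`, transport `e` to an idempotent of `G X`. Since `G`
is fully faithful it comes from an idempotent of `X`, whose image is isomorphic to `(Y, e)`. -/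
lemma karoubiMap_essSurj (G : C ⥤ D) [G.Full] [G.Faithful]
    (h : ∀ Y : D, ∃ X, Nonempty (Retract Y (G.obj X))) : (karoubiMap G).EssSurj where
  mem_essImage Q := by
    obtain ⟨X, ⟨r⟩⟩ := h Q.X
    have hr := r.retract
    refine ⟨⟨X, G.preimage (r.r ≫ Q.p ≫ r.i), G.map_injective ?_⟩, ⟨?_⟩⟩
    · simp [reassoc_of% hr]
    · refine ⟨⟨r.r ≫ Q.p, ?_⟩, ⟨Q.p ≫ r.i, ?_⟩, ?_, ?_⟩
      · change G.map (G.preimage (r.r ≫ Q.p ≫ r.i)) ≫ (r.r ≫ Q.p) ≫ Q.p = r.r ≫ Q.p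
        simp [reassoc_of% hr]
      · change Q.p ≫ (Q.p ≫ r.i) ≫ G.map (G.preimage (r.r ≫ Q.p ≫ r.i)) = Q.p ≫ r.i
        simp [reassoc_of% hr]
      · refine Karoubi.hom_ext _ _ ?_
        change (r.r ≫ Q.p) ≫ (Q.p ≫ r.i) = G.map (G.preimage (r.r ≫ Q.p ≫ r.i))
        simp
      · refine Karoubi.hom_ext _ _ ?_
        change (Q.p ≫ r.i) ≫ (r.r ≫ Q.p) = Q.p
        simp [reassoc_of% hr]

instance [Preadditive C] [Preadditive D] (G : C ⥤ D) [G.Additive] : (karoubiMap G).Additive where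
  map_add {_ _ f g} := Karoubi.hom_ext _ _ (G.map_add (f := f.f) (g := g.f))

instance {k : Type w} [CommRing k] [Preadditive C] [Preadditive D] [Linear k C] [Linear k D]
    (G : C ⥤ D) [G.Additive] [G.Linear k] : (karoubiMap G).Linear k where
  map_smul f c := Karoubi.hom_ext _ _ (Functor.Linear.map_smul (F := G) f.f c)

instance {k : Type w} [CommRing k] [Preadditive C] [Linear k C] :
    (toKaroubi C).Linear k where
  map_smul _ _ := rfl

variable [MonoidalCategory C] [MonoidalCategory D]

namespace KaroubiMonoidal

section aux

variable (G : C ⥤ D) [G.Monoidal] {A₁ A₂ A₃ B₁ B₂ : C}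

lemma map_μ_natural {p₁ : A₁ ⟶ A₁} {p₂ : A₂ ⟶ A₂} {q₁ : B₁ ⟶ B₁} {q₂ : B₂ ⟶ B₂}
    {f₁ : A₁ ⟶ B₁} {f₂ : A₂ ⟶ B₂} (h₁ : p₁ ≫ f₁ = f₁) (h₂ : p₂ ≫ f₂ = f₂)
    (h₁' : f₁ ≫ q₁ = f₁) (h₂' : f₂ ≫ q₂ = f₂) :
    (G.map f₁ ⊗ₘ G.map f₂) ≫ (G.map q₁ ⊗ₘ G.map q₂) ≫ μ G B₁ B₂ =
      ((G.map p₁ ⊗ₘ G.map p₂) ≫ μ G A₁ A₂) ≫ G.map (f₁ ⊗ₘ f₂) := by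
  rw [Category.assoc, ← μ_natural]
  simp only [MonoidalCategory.tensorHom_comp_tensorHom_assoc, ← G.map_comp, h₁, h₂, h₁', h₂']

/-- All idempotents are moved to the front by naturality and merged there, which leaves the
associativity axiom of `G`. The unit axioms follow the same pattern. -/
lemma map_associativity {p : A₁ ⟶ A₁} {q : A₂ ⟶ A₂} {r : A₃ ⟶ A₃}
    (hp : p ≫ p = p) (hq : q ≫ q = q) (hr : r ≫ r = r) :
    (((G.map p ⊗ₘ G.map q) ≫ μ G A₁ A₂) ⊗ₘ G.map r) ≫
        ((G.map (p ⊗ₘ q) ⊗ₘ G.map r) ≫ μ G (A₁ ⊗ A₂) A₃) ≫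
          G.map (((p ⊗ₘ q) ⊗ₘ r) ≫ (α_ A₁ A₂ A₃).hom) =
      (((G.map p ⊗ₘ G.map q) ⊗ₘ G.map r) ≫ (α_ (G.obj A₁) (G.obj A₂) (G.obj A₃)).hom) ≫
        (G.map p ⊗ₘ ((G.map q ⊗ₘ G.map r) ≫ μ G A₂ A₃)) ≫
          ((G.map p ⊗ₘ G.map (q ⊗ₘ r)) ≫ μ G A₁ (A₂ ⊗ A₃)) := by
  have hp' : G.map p ≫ G.map p = G.map p := by rw [← G.map_comp, hp]
  have hq' : G.map q ≫ G.map q = G.map q := by rw [← G.map_comp, hq]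
  have hr' : G.map r ≫ G.map r = G.map r := by rw [← G.map_comp, hr]
  have e₁ : (((G.map p ⊗ₘ G.map q) ≫ μ G A₁ A₂) ⊗ₘ G.map r) =
      ((G.map p ⊗ₘ G.map q) ⊗ₘ G.map r) ≫ μ G A₁ A₂ ▷ G.obj A₃ := by
    rw [← MonoidalCategory.tensorHom_id, MonoidalCategory.tensorHom_comp_tensorHom,
      Category.comp_id]
  have e₂ : ((G.map p ⊗ₘ G.map q) ⊗ₘ G.map r) ≫ μ G A₁ A₂ ▷ G.obj A₃ =
      μ G A₁ A₂ ▷ G.obj A₃ ≫ (G.map (p ⊗ₘ q) ⊗ₘ G.map r) := by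
    rw [← e₁, ← MonoidalCategory.tensorHom_id, MonoidalCategory.tensorHom_comp_tensorHom,
      Category.id_comp, μ_natural]
  have e₃ : (G.map p ⊗ₘ ((G.map q ⊗ₘ G.map r) ≫ μ G A₂ A₃)) =
      (G.map p ⊗ₘ (G.map q ⊗ₘ G.map r)) ≫ G.obj A₁ ◁ μ G A₂ A₃ := by
    rw [← MonoidalCategory.id_tensorHom, MonoidalCategory.tensorHom_comp_tensorHom,
      Category.comp_id]
  have e₄ : (G.map p ⊗ₘ (G.map q ⊗ₘ G.map r)) ≫ G.obj A₁ ◁ μ G A₂ A₃ =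
      G.obj A₁ ◁ μ G A₂ A₃ ≫ (G.map p ⊗ₘ G.map (q ⊗ₘ r)) := by
    rw [← e₃, ← MonoidalCategory.id_tensorHom, MonoidalCategory.tensorHom_comp_tensorHom,
      Category.id_comp, μ_natural]
  have i : ((G.map p ⊗ₘ G.map q) ⊗ₘ G.map r) ≫ ((G.map p ⊗ₘ G.map q) ⊗ₘ G.map r) =
      ((G.map p ⊗ₘ G.map q) ⊗ₘ G.map r) := by
    simp only [MonoidalCategory.tensorHom_comp_tensorHom, hp', hq', hr']
  rw [e₁, e₃, G.map_comp]
  simp only [Category.assoc]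
  rw [← μ_natural_assoc, ← reassoc_of% e₂, ← reassoc_of% e₂, ← reassoc_of% e₄,
    ← MonoidalCategory.associator_naturality_assoc, ← MonoidalCategory.associator_naturality_assoc]
  simp only [reassoc_of% i]
  rw [Functor.LaxMonoidal.associativity]

lemma map_left_unitality {p : A₁ ⟶ A₁} (hp : p ≫ p = p) :
    (𝟙 (𝟙_ D) ⊗ₘ G.map p) ≫ (λ_ (G.obj A₁)).hom =
      ((𝟙 (𝟙_ D) ≫ ε G) ⊗ₘ G.map p) ≫ ((G.map (𝟙 (𝟙_ C)) ⊗ₘ G.map p) ≫ μ G (𝟙_ C) A₁) ≫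
        G.map ((𝟙 (𝟙_ C) ⊗ₘ p) ≫ (λ_ A₁).hom) := by
  have hp' : G.map p ≫ G.map p = G.map p := by rw [← G.map_comp, hp]
  rw [G.map_comp]
  simp only [Category.assoc]
  rw [← μ_natural_assoc]
  simp only [MonoidalCategory.tensorHom_comp_tensorHom_assoc, G.map_id, Category.id_comp,
    Category.comp_id, hp', Functor.LaxMonoidal.left_unitality]
  simp only [← Category.assoc]
  congr 2
  simp [MonoidalCategory.tensorHom_def']

lemma map_right_unitality {p : A₁ ⟶ A₁} (hp : p ≫ p = p) :
    (G.map p ⊗ₘ 𝟙 (𝟙_ D)) ≫ (ρ_ (G.obj A₁)).hom =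
      (G.map p ⊗ₘ (𝟙 (𝟙_ D) ≫ ε G)) ≫ ((G.map p ⊗ₘ G.map (𝟙 (𝟙_ C))) ≫ μ G A₁ (𝟙_ C)) ≫
        G.map ((p ⊗ₘ 𝟙 (𝟙_ C)) ≫ (ρ_ A₁).hom) := by
  have hp' : G.map p ≫ G.map p = G.map p := by rw [← G.map_comp, hp]
  rw [G.map_comp]
  simp only [Category.assoc]
  rw [← μ_natural_assoc]
  simp only [MonoidalCategory.tensorHom_comp_tensorHom_assoc, G.map_id, Category.id_comp,
    Category.comp_id, hp', Functor.LaxMonoidal.right_unitality]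
  simp only [← Category.assoc]
  congr 2
  simp [MonoidalCategory.tensorHom_def]

end aux

end KaroubiMonoidal

open KaroubiMonoidal

instance (G : C ⥤ D) [G.Monoidal] : (karoubiMap G).Monoidal :=
  Functor.CoreMonoidal.toMonoidal
    { εIso := mkIso (P := 𝟙_ (Karoubi D)) (Q := (karoubiMap G).obj (𝟙_ (Karoubi C))) (εIso G) (by
        change 𝟙 _ ≫ _ = _ ≫ G.map (𝟙 _)
        simp)
      μIso := fun P Q => mkIso (P := (karoubiMap G).obj P ⊗ (karoubiMap G).obj Q)
        (Q := (karoubiMap G).obj (P ⊗ Q)) (μIso G P.X Q.X) (μ_natural G P.p Q.p)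
      μIso_hom_natural_left := fun f Q => Karoubi.hom_ext _ _
        (map_μ_natural G (Karoubi.p_comp f) Q.idem (Karoubi.comp_p f) Q.idem)
      μIso_hom_natural_right := fun {_ _} P f => Karoubi.hom_ext _ _
        (map_μ_natural G P.idem (Karoubi.p_comp f) P.idem (Karoubi.comp_p f))
      associativity := fun P Q R => Karoubi.hom_ext _ _
        (map_associativity G P.idem Q.idem R.idem)
      left_unitality := fun P => Karoubi.hom_ext _ _ (map_left_unitality G P.idem)
      right_unitality := fun P => Karoubi.hom_ext _ _ (map_right_unitality G P.idem) }

instance [BraidedCategory C] [BraidedCategory D] (G : C ⥤ D) [G.Braided] :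
    (karoubiMap G).Braided where
  braided P Q := Karoubi.hom_ext _ _ (by
    change ((G.map P.p ⊗ₘ G.map Q.p) ≫ μ G P.X Q.X) ≫ G.map ((P.p ⊗ₘ Q.p) ≫ (β_ P.X Q.X).hom) =
      ((G.map P.p ⊗ₘ G.map Q.p) ≫ (β_ (G.obj P.X) (G.obj Q.X)).hom) ≫
        (G.map Q.p ⊗ₘ G.map P.p) ≫ μ G Q.X P.X
    rw [G.map_comp]
    simp only [Category.assoc]
    rw [← μ_natural_assoc, ← BraidedCategory.braiding_naturality_assoc,
      Functor.LaxBraided.braided])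

instance : (toKaroubi C).Monoidal :=
  Functor.CoreMonoidal.toMonoidal
    { εIso := mkIso (P := 𝟙_ (Karoubi C)) (Q := (toKaroubi C).obj (𝟙_ C)) (Iso.refl _) rfl
      μIso := fun X Y => mkIso (P := (toKaroubi C).obj X ⊗ (toKaroubi C).obj Y)
        (Q := (toKaroubi C).obj (X ⊗ Y)) (Iso.refl _) (by
          change (𝟙 X ⊗ₘ 𝟙 Y) ≫ 𝟙 _ = 𝟙 _ ≫ 𝟙 _
          simp)
      μIso_hom_natural_left := fun {X Y} f Z => Karoubi.hom_ext _ _ (by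
        change (f ⊗ₘ 𝟙 Z) ≫ (𝟙 Y ⊗ₘ 𝟙 Z) ≫ 𝟙 _ = ((𝟙 X ⊗ₘ 𝟙 Z) ≫ 𝟙 _) ≫ (f ▷ Z)
        simp)
      μIso_hom_natural_right := fun {Y Z} X f => Karoubi.hom_ext _ _ (by
        change (𝟙 X ⊗ₘ f) ≫ (𝟙 X ⊗ₘ 𝟙 Z) ≫ 𝟙 _ = ((𝟙 X ⊗ₘ 𝟙 Y) ≫ 𝟙 _) ≫ (X ◁ f)
        simp)
      associativity := fun X Y Z => Karoubi.hom_ext _ _ (by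
        change (((𝟙 X ⊗ₘ 𝟙 Y) ≫ 𝟙 _) ⊗ₘ 𝟙 Z) ≫ ((𝟙 (X ⊗ Y) ⊗ₘ 𝟙 Z) ≫ 𝟙 _) ≫ (α_ X Y Z).hom =
          (((𝟙 X ⊗ₘ 𝟙 Y) ⊗ₘ 𝟙 Z) ≫ (α_ X Y Z).hom) ≫ (𝟙 X ⊗ₘ ((𝟙 Y ⊗ₘ 𝟙 Z) ≫ 𝟙 _)) ≫
            ((𝟙 X ⊗ₘ 𝟙 (Y ⊗ Z)) ≫ 𝟙 _)
        simp)
      left_unitality := fun X => Karoubi.hom_ext _ _ (by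
        change (𝟙 (𝟙_ C) ⊗ₘ 𝟙 X) ≫ (λ_ X).hom =
          ((𝟙 (𝟙_ C) ≫ 𝟙 _) ⊗ₘ 𝟙 X) ≫ ((𝟙 (𝟙_ C) ⊗ₘ 𝟙 X) ≫ 𝟙 _) ≫ (λ_ X).hom
        simp)
      right_unitality := fun X => Karoubi.hom_ext _ _ (by
        change (𝟙 X ⊗ₘ 𝟙 (𝟙_ C)) ≫ (ρ_ X).hom =
          (𝟙 X ⊗ₘ (𝟙 (𝟙_ C) ≫ 𝟙 _)) ≫ ((𝟙 X ⊗ₘ 𝟙 (𝟙_ C)) ≫ 𝟙 _) ≫ (ρ_ X).hom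
        simp) }

instance [BraidedCategory C] : (toKaroubi C).Braided where
  braided X Y := Karoubi.hom_ext _ _ (by
    change ((𝟙 X ⊗ₘ 𝟙 Y) ≫ 𝟙 _) ≫ (β_ X Y).hom = ((𝟙 X ⊗ₘ 𝟙 Y) ≫ (β_ X Y).hom) ≫
        (𝟙 Y ⊗ₘ 𝟙 X) ≫ 𝟙 _
    simp)

end KaroubiFunctor

/-! ### Recognizing a Karoubian envelope. -/

section SymmetricEquivalence

open CategoryTheory.Idempotents

lemma SymmetricEquivalent.of_inverse (k : Type w) [CommRing k]
    {B : Type u} [Category.{v} B] [Preadditive B] [Linear k B] [MonoidalCategory B]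
    [SymmetricCategory B]
    {C : Type u₁} [Category.{v₁} C] [Preadditive C] [Linear k C] [MonoidalCategory C]
    [SymmetricCategory C]
    {D : Type u₂} [Category.{v₂} D] [Preadditive D] [Linear k D] [MonoidalCategory D]
    [SymmetricCategory D]
    (F : B ⥤ D) [F.Braided] [F.Additive] [F.Linear k] [F.IsEquivalence]
    (G : C ⥤ D) [hb : G.Braided] [ha : G.Additive] [hl : G.Linear k] [G.IsEquivalence] :
    SymmetricEquivalent k B C := by
  let e := G.asEquivalence
  have : e.functor.Additive := ha
  have : e.functor.Linear k := hl
  let : e.functor.Braided := hb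
  let : e.inverse.Braided := inverseBraided e
  have : e.inverse.Additive := Equivalence.inverse_additive e
  have : e.inverse.Linear k := inferInstance
  exact ⟨F ⋙ e.inverse, inferInstance, inferInstance, inferInstance, inferInstance⟩

/-- If `E` is idempotent complete and every object of `E` is a retract of an object in the image
of the fully faithful braided functor `G : D ⥤ E`, then `E` is the Karoubian envelope of `D`. -/
theorem symmetricEquivalent_karoubi (k : Type w) [CommRing k]
    {D : Type u₁} [Category.{v₁} D] [Preadditive D] [Linear k D] [MonoidalCategory D]
    [SymmetricCategory D]
    {E : Type u₂} [Category.{v₂} E] [Preadditive E] [Linear k E] [MonoidalCategory E]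
    [SymmetricCategory E] [IsIdempotentComplete E]
    (G : D ⥤ E) [G.Braided] [G.Additive] [G.Linear k] [G.Full] [G.Faithful]
    (h : ∀ Y : E, ∃ X, Nonempty (Retract Y (G.obj X))) :
    SymmetricEquivalent k E (Karoubi D) := by
  have := karoubiMap_essSurj G h
  have : (karoubiMap G).IsEquivalence := {}
  -- Both `E` and `Karoubi D` are equivalent to `Karoubi E`, the first by idempotent completeness
  -- and the second by `karoubiMap G`.
  exact SymmetricEquivalent.of_inverse k (toKaroubi E) (karoubiMap G)

end SymmetricEquivalence

/-! ### Lifting idempotents; `Ver_p` is idempotent complete. -/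

section Idempotents

open Polynomial CategoryTheory.Idempotents

lemma aeval_mul_of_idempotent {K B : Type*} [Field K] [Ring B] [Algebra K B] {e : B}
    (he : e * e = e) (q : K[X]) : aeval e q * e = q.eval 1 • e := by
  induction q using Polynomial.induction_on' with
  | add q r hq hr => rw [map_add, add_mul, hq, hr, eval_add, add_smul]
  | monomial n c =>
    have h : e ^ n * e = e := by
      induction n with
      | zero => simp
      | succ n ih => rw [pow_succ, mul_assoc, he, ih]
    simp [aeval_monomial, mul_assoc, h, Algebra.smul_def]

/-- Idempotents lift along surjections from a finite-dimensional algebra. -/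
lemma exists_idempotent_lift {K A B : Type*} [Field K] [Ring A] [Algebra K A] [Ring B]
    [Algebra K B] [FiniteDimensional K A] (φ : A →ₐ[K] B) (hφ : Function.Surjective φ) {e : B}
    (he : e * e = e) : ∃ c : A, c * c = c ∧ φ c = e := by
  obtain ⟨a, rfl⟩ := hφ e
  have h0 : minpoly K a ≠ 0 := minpoly.ne_zero (Algebra.IsIntegral.isIntegral a)
  obtain ⟨g, hg, hndvd⟩ := (minpoly K a).exists_eq_pow_rootMultiplicity_mul_and_not_dvd h0 0
  set m := rootMultiplicity 0 (minpoly K a)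
  rw [C_0, sub_zero] at hg hndvd
  -- Fitting decomposition: with minimal polynomial `X ^ m * g` and `X` not dividing `g`, Bézout
  -- gives an idempotent `u * X ^ (m + 1)` at `a`. The exponent `m + 1` rather than `m` ensures `φ a
  -- ^ (m + 1) = φ a` also when `m = 0`.
  have hcop : IsCoprime (X ^ (m + 1)) g :=
    (irreducible_X.coprime_iff_not_dvd.2 hndvd).pow_left
  obtain ⟨u, v, huv⟩ := hcop
  have hzero : aeval a (X ^ (m + 1) * g) = 0 := by
    rw [pow_succ', mul_assoc, ← hg, map_mul, minpoly.aeval, mul_zero]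
  refine ⟨aeval a (u * X ^ (m + 1)), ?_, ?_⟩
  · rw [← map_mul]
    have : u * X ^ (m + 1) * (u * X ^ (m + 1)) =
        u * X ^ (m + 1) - u * v * (X ^ (m + 1) * g) := by
      linear_combination (u * X ^ (m + 1)) * huv
    rw [this, map_sub, map_mul _ _ (X ^ (m + 1) * g), hzero, mul_zero, sub_zero]
  · have key := fun q : K[X] => aeval_mul_of_idempotent he q
    have hpow : φ a ^ (m + 1) = φ a := by
      induction m with
      | zero => simp
      | succ n ih => rw [pow_succ, ih, he]
    -- On multiples of an idempotent, a polynomial acts by its value at 1; so the vanishing of `X ^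
    -- (m + 1) * g` at `a` yields this.
    have hg1 : g.eval 1 • φ a = 0 := by
      have := congrArg φ hzero
      rw [← aeval_algHom_apply, map_zero, mul_comm, map_mul, map_pow, aeval_X, hpow, key] at this
      exact this
    have hu : u.eval 1 + v.eval 1 * g.eval 1 = 1 := by
      have := congrArg (Polynomial.eval 1) huv
      simpa using this
    rw [← aeval_algHom_apply, map_mul, map_pow, aeval_X, hpow, key]
    calc u.eval 1 • φ a = (u.eval 1 + v.eval 1 * g.eval 1) • φ a := by
          rw [add_smul, mul_smul, hg1, smul_zero, add_zero]
      _ = φ a := by rw [hu, one_smul]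

end Idempotents

section

open CategoryTheory.Idempotents
variable (k : Type u) [Field k] (p : ℕ) [NeZero p]

/-- Lift the idempotent to the finite-dimensional algebra of endomorphisms of the representation,
split it there, and project the splitting. -/
instance : IsIdempotentComplete (Ver k p) where
  idempotents_split X e he := by
    let φ : End X.as →ₐ[k] End X :=
      { toFun := fun f => (NegQuotient.proj k).map f
        map_one' := rfl
        map_mul' := fun _ _ => rfl
        map_zero' := rfl
        map_add' := fun _ _ => rfl
        commutes' := fun _ => rfl }
    have : FiniteDimensional k (End X.as) := inferInstanceAs (FiniteDimensional k (X.as ⟶ X.as))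
    obtain ⟨c, hc, hce⟩ := exists_idempotent_lift φ NegQuotient.proj_map_surjective (e := e) he
    obtain ⟨Y, i, r, h1, h2⟩ := IsIdempotentComplete.idempotents_split X.as c hc
    exact ⟨⟨Y⟩, (NegQuotient.proj k).map i, (NegQuotient.proj k).map r,
      congrArg (NegQuotient.proj k).map h1, (congrArg (NegQuotient.proj k).map h2).trans hce⟩

end

/-! ### The tensor product functor on a pair of subcategories. -/

section TensorFunctor

variable (k : Type w) [CommRing k] {E : Type u₁} [Category.{v₁} E] [Preadditive E] [Linear k E]
  [MonoidalCategory E] [MonoidalPreadditive E] [MonoidalLinear k E]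
  (P Q : ObjectProperty E)

/-- The tensor product of morphisms as a linear map. -/
def tensorHomLift (X Y : PreProd k P.FullSubcategory Q.FullSubcategory) :
    (X ⟶ Y) →ₗ[k] (X.fst.obj ⊗ X.snd.obj ⟶ Y.fst.obj ⊗ Y.snd.obj) :=
  TensorProduct.lift (LinearMap.mk₂ k (fun f g => f.hom ⊗ₘ g.hom)
    (fun f f' g => by
      change (f.hom + f'.hom) ⊗ₘ g.hom = _
      simp [MonoidalCategory.tensorHom_def])
    (fun c f g => by
      change (c • f.hom) ⊗ₘ g.hom = _
      simp [MonoidalCategory.tensorHom_def])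
    (fun f g g' => by
      change f.hom ⊗ₘ (g.hom + g'.hom) = _
      simp [MonoidalCategory.tensorHom_def])
    (fun c f g => by
      change f.hom ⊗ₘ (c • g.hom) = _
      simp [MonoidalCategory.tensorHom_def]))

lemma tensorHomLift_pure {X Y : PreProd k P.FullSubcategory Q.FullSubcategory}
    (f : X.fst ⟶ Y.fst) (g : X.snd ⟶ Y.snd) :
    tensorHomLift k P Q X Y (PreProd.pure k f g) = f.hom ⊗ₘ g.hom :=
  rfl

/-- The tensor product `(X, Y) ↦ X ⊗ Y` as a functor on pairs of objects of two subcategories. -/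
def tensorFunctor : PreProd k P.FullSubcategory Q.FullSubcategory ⥤ E where
  obj X := X.fst.obj ⊗ X.snd.obj
  map {X Y} f := tensorHomLift k P Q X Y f
  map_id X := by
    rw [← PreProd.pure_id, tensorHomLift_pure]
    exact MonoidalCategory.id_tensorHom_id _ _
  map_comp {X Y Z} f g := by
    induction f using PreProd.hom_induction with
    | zero => simp
    | pure f f' =>
      induction g using PreProd.hom_induction with
      | zero => simp
      | pure g g' =>
        rw [PreProd.pure_comp, tensorHomLift_pure, tensorHomLift_pure, tensorHomLift_pure,
          MonoidalCategory.tensorHom_comp_tensorHom]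
        rfl
      | add g g' h h' => simp [h, h']
    | add f f' h h' => simp [h, h']

instance : (tensorFunctor k P Q).Additive where
  map_add {X Y f g} := map_add (tensorHomLift k P Q X Y) f g

instance : (tensorFunctor k P Q).Linear k where
  map_smul {X Y} f c := map_smul (tensorHomLift k P Q X Y) c f

end TensorFunctor

section Braided

/-- The isomorphism `(X₁ ⊗ X₂) ⊗ (Y₁ ⊗ Y₂) ≅ (X₁ ⊗ Y₁) ⊗ (X₂ ⊗ Y₂)`. -/
def tensorμIso {E : Type u₁} [Category.{v₁} E] [MonoidalCategory E] [BraidedCategory E]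
    (X₁ X₂ Y₁ Y₂ : E) : (X₁ ⊗ X₂) ⊗ (Y₁ ⊗ Y₂) ≅ (X₁ ⊗ Y₁) ⊗ (X₂ ⊗ Y₂) where
  hom := tensorμ X₁ X₂ Y₁ Y₂
  inv := tensorδ X₁ X₂ Y₁ Y₂

/-- Both sides permute four factors. The symmetry is needed to identify the middle braiding with the
inverse of the opposite one; it makes `tensorFunctor` braided. -/
lemma tensorμ_braiding {E : Type u₁} [Category.{v₁} E] [MonoidalCategory E] [SymmetricCategory E]
    (X₁ X₂ Y₁ Y₂ : E) : tensorμ X₁ X₂ Y₁ Y₂ ≫ ((β_ X₁ Y₁).hom ⊗ₘ (β_ X₂ Y₂).hom) =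
      (β_ (X₁ ⊗ X₂) (Y₁ ⊗ Y₂)).hom ≫ tensorμ Y₁ Y₂ X₁ X₂ := by
  simp [tensorμ, SymmetricCategory.braiding_swap_eq_inv_braiding X₁ Y₂,
    MonoidalCategory.tensorHom_def]

variable (k : Type w) [CommRing k] {E : Type u₁} [Category.{v₁} E] [Preadditive E] [Linear k E]
  [MonoidalCategory E] [MonoidalPreadditive E] [MonoidalLinear k E] [SymmetricCategory E]
  (P Q : ObjectProperty E) [P.IsMonoidal] [Q.IsMonoidal]

/-- The monoidal structure isomorphism of `tensorFunctor`. -/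
def tensorFunctorμIso (X Y : PreProd k P.FullSubcategory Q.FullSubcategory) :
    (tensorFunctor k P Q).obj X ⊗ (tensorFunctor k P Q).obj Y ≅ (tensorFunctor k P Q).obj (X ⊗ Y) :=
  tensorμIso X.fst.obj X.snd.obj Y.fst.obj Y.snd.obj

lemma tensorFunctor_natural {X X' Y Y' : PreProd k P.FullSubcategory Q.FullSubcategory}
    (f : X ⟶ X') (g : Y ⟶ Y') :
    ((tensorFunctor k P Q).map f ⊗ₘ (tensorFunctor k P Q).map g) ≫
        (tensorFunctorμIso k P Q X' Y').hom =
      (tensorFunctorμIso k P Q X Y).hom ≫ (tensorFunctor k P Q).map (f ⊗ₘ g) := by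
  induction f using PreProd.hom_induction with
  | zero => simp [MonoidalCategory.tensorHom_def]
  | pure f f' =>
    induction g using PreProd.hom_induction with
    | zero => simp [MonoidalCategory.tensorHom_def]
    | pure g g' =>
      rw [PreProd.tensorHom_pure]
      exact tensorμ_natural f.hom f'.hom g.hom g'.hom
    | add g g' h h' =>
      simp only [MonoidalCategory.tensorHom_def, MonoidalPreadditive.whiskerLeft_add,
        CategoryTheory.Functor.map_add, Preadditive.comp_add, Preadditive.add_comp] at h h' ⊢
      rw [h, h']
  | add f f' h h' =>
    simp only [MonoidalCategory.tensorHom_def, MonoidalPreadditive.add_whiskerRight,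
      CategoryTheory.Functor.map_add, Preadditive.comp_add, Preadditive.add_comp] at h h' ⊢
    rw [h, h']

instance : (tensorFunctor k P Q).Monoidal :=
  Functor.CoreMonoidal.toMonoidal
    { εIso := (λ_ (𝟙_ E)).symm
      μIso := tensorFunctorμIso k P Q
      μIso_hom_natural_left := fun f Z => by
        have := tensorFunctor_natural k P Q f (𝟙 Z)
        rwa [CategoryTheory.Functor.map_id, MonoidalCategory.tensorHom_id,
          MonoidalCategory.tensorHom_id] at this
      μIso_hom_natural_right := fun X f => by
        have := tensorFunctor_natural k P Q (𝟙 X) f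
        rwa [CategoryTheory.Functor.map_id, MonoidalCategory.id_tensorHom,
          MonoidalCategory.id_tensorHom] at this
      associativity := fun X Y Z => tensor_associativity X.fst.obj X.snd.obj Y.fst.obj Y.snd.obj
        Z.fst.obj Z.snd.obj
      left_unitality := fun X => tensor_left_unitality X.fst.obj X.snd.obj
      right_unitality := fun X => tensor_right_unitality X.fst.obj X.snd.obj }

instance : (tensorFunctor k P Q).Braided where
  braided X Y := tensorμ_braiding X.fst.obj X.snd.obj Y.fst.obj Y.snd.obj

end Braided

/-! ### Full faithfulness and retracts checked on summands. -/

section Sums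

variable {C : Type u₁} [Category.{v₁} C] [Preadditive C] {D : Type u₂} [Category.{v₂} D]
  [Preadditive D] {ι κ : Type*} [Fintype ι] [Fintype κ]

/-- The identity of `X` is a sum of morphisms that factor through the objects `S a`. -/
def IsSumOf (X : C) (S : ι → C) : Prop :=
  ∃ (i : ∀ a, S a ⟶ X) (q : ∀ a, X ⟶ S a), ∑ a, q a ≫ i a = 𝟙 X

lemma IsDirectSum.isSumOf {X : C} {S : ι → C} (h : IsDirectSum X S) : IsSumOf X S := by
  obtain ⟨i, q, -, -, h⟩ := h
  exact ⟨i, q, h⟩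

/-- The decomposition of the identity lifts along fully faithful functors, so a decomposition found
in the ambient category holds in a full subcategory that contains the summands. -/
lemma IsSumOf.of_map (F : C ⥤ D) [F.Full] [F.Faithful] [F.Additive] {X : C} {S : ι → C}
    (h : IsSumOf (F.obj X) (fun a => F.obj (S a))) : IsSumOf X S := by
  obtain ⟨i, q, h⟩ := h
  refine ⟨fun a => F.preimage (i a), fun a => F.preimage (q a), F.map_injective ?_⟩
  simp [CategoryTheory.Functor.map_sum, h]

lemma IsSumOf.prod {k : Type w} [CommRing k] [Linear k C] [Linear k D]
    {X : PreProd k C D} {S : ι → C} {T : κ → D} (hS : IsSumOf X.fst S) (hT : IsSumOf X.snd T) :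
    IsSumOf X (fun a : ι × κ => (⟨S a.1, T a.2⟩ : PreProd k C D)) := by
  obtain ⟨i, q, h⟩ := hS
  obtain ⟨j, r, h'⟩ := hT
  refine ⟨fun a => PreProd.pure k (i a.1) (j a.2), fun a => PreProd.pure k (q a.1) (r a.2), ?_⟩
  simp only [PreProd.pure_comp]
  rw [← PreProd.pure_id, ← h, ← h', Fintype.sum_prod_type]
  simp only [PreProd.pure]
  rw [TensorProduct.sum_tmul]
  simp only [TensorProduct.tmul_sum]

/-- Full faithfulness of an additive functor can be checked on summands. -/
lemma bijective_map_of_isSumOf (F : C ⥤ D) [F.Additive] {X Y : C} {S : ι → C} {T : κ → C}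
    (hX : IsSumOf X S) (hY : IsSumOf Y T)
    (h : ∀ a b, Function.Bijective (F.map : (S a ⟶ T b) → (F.obj (S a) ⟶ F.obj (T b)))) :
    Function.Bijective (F.map : (X ⟶ Y) → (F.obj X ⟶ F.obj Y)) := by
  obtain ⟨i, q, hX⟩ := hX
  obtain ⟨j, r, hY⟩ := hY
  -- A morphism is the sum of its matrix entries; this uses only the decompositions of the two
  -- identities, not orthogonality.
  have expand : ∀ f : X ⟶ Y, f = ∑ a, ∑ b, q a ≫ (i a ≫ f ≫ r b) ≫ j b := fun f => by
    calc f = (∑ a, q a ≫ i a) ≫ f ≫ ∑ b, r b ≫ j b := by rw [hX, hY]; simp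
      _ = _ := by
        rw [Finset.sum_comm]
        simp [Preadditive.sum_comp, Preadditive.comp_sum]
  constructor
  · intro f g hfg
    rw [expand f, expand g]
    refine Finset.sum_congr rfl fun a _ => Finset.sum_congr rfl fun b _ => ?_
    rw [(h a b).1 (a₁ := i a ≫ f ≫ r b) (a₂ := i a ≫ g ≫ r b) (by simp [hfg])]
  · intro g
    choose m hm using fun a b => (h a b).2 (F.map (i a) ≫ g ≫ F.map (r b))
    refine ⟨∑ a, ∑ b, q a ≫ m a b ≫ j b, ?_⟩
    calc F.map (∑ a, ∑ b, q a ≫ m a b ≫ j b)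
        = F.map (∑ a, q a ≫ i a) ≫ g ≫ F.map (∑ b, r b ≫ j b) := by
          rw [Finset.sum_comm]
          simp [CategoryTheory.Functor.map_sum, hm, Preadditive.sum_comp, Preadditive.comp_sum]
      _ = g := by rw [hX, hY]; simp

/-- The maps into and out of `W` are assembled from the summands; orthogonality in `W` removes the
cross terms. -/
lemma IsDirectSum.nonempty_retract {Z W : C} {S : ι → C} (h : IsDirectSum Z S)
    (j : ∀ a, S a ⟶ W) (r : ∀ a, W ⟶ S a) (h₁ : ∀ a, j a ≫ r a = 𝟙 _)
    (h₂ : ∀ a b, a ≠ b → j a ≫ r b = 0) : Nonempty (Retract Z W) := by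
  classical
  obtain ⟨i, q, -, -, h⟩ := h
  refine ⟨⟨∑ a, q a ≫ j a, ∑ a, r a ≫ i a, ?_⟩⟩
  rw [← h, Preadditive.sum_comp]
  refine Finset.sum_congr rfl fun a _ => ?_
  rw [Preadditive.comp_sum, Finset.sum_eq_single a]
  · rw [Category.assoc, reassoc_of% h₁ a]
  · intro b _ hb
    rw [Category.assoc, reassoc_of% h₂ a b hb.symm]
    simp
  · simp

end Sums

/-! ### Products of simple objects of `Ver_p^+` and `sVec`. -/

section Ver

variable {k : Type u} [Field k] {p : ℕ} [Fact p.Prime]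

lemma exists_isDirectSum {ι : Type} [Fintype ι] (S : ι → Ver k p) :
    ∃ X : Ver k p, IsDirectSum X S := by
  have : Limits.HasFiniteBiproducts (FDRep k (Cyc p)) :=
    Limits.HasFiniteBiproducts.of_hasFiniteProducts
  have hX : IsDirectSum (Limits.biproduct fun a => (S a).as) (fun a => (S a).as) := by
    classical
    exact ⟨Limits.biproduct.ι _, Limits.biproduct.π _, Limits.biproduct.ι_π_self _,
      fun a b => Limits.biproduct.ι_π_ne _, Limits.biproduct.total⟩
  exact ⟨_, hX.map (NegQuotient.proj k)⟩

variable [CharP k p]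

/-- Every label in a decomposition of `X` must be `s`, and the count of summands must be 1. -/
lemma nonempty_iso_L {X : Ver k p} {s : ℕ} (hs : s ≤ p)
    (hX : ∀ t ≤ p, mult k t X = if t = s then 1 else 0) : Nonempty (X ≅ L k p s) := by
  obtain ⟨d, e, he, h⟩ := exists_isDirectSum_L k p X
  have hsum := fun t => h.mult_eq t
  have hes : ∀ a, e a = s := fun a => by
    by_contra hne
    have h1 := hsum (e a)
    rw [hX _ (he a).2.le, if_neg hne] at h1
    have h2 := Finset.sum_eq_zero_iff.1 h1.symm a (Finset.mem_univ _)
    rw [mult_L (he a).2.le (he a).2.le, if_pos ⟨rfl, he a⟩] at h2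
    exact one_ne_zero h2
  obtain rfl : e = fun _ => s := funext hes
  have h1 := hsum s
  rw [hX s hs, if_pos rfl, Finset.sum_const, Finset.card_univ, Fintype.card_fin] at h1
  obtain rfl : d = 1 := Nat.eq_one_of_mul_eq_one_right (m := d) (by simpa using h1.symm)
  obtain ⟨i, q, h₁, -, h₃⟩ := h
  exact ⟨⟨q 0, i 0, by simpa using h₃, h₁ 0⟩⟩

/-- `L_s ⊗ L_{p-1}` is isomorphic to `L_{p-s}`. -/
lemma nonempty_tensor_iso {s : ℕ} (h0 : 0 < s) (hs : s < p) :
    Nonempty (L k p s ⊗ L k p (p - 1) ≅ L k p (p - s)) := by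
  have := (Fact.out : p.Prime).two_le
  refine nonempty_iso_L (by omega) fun t ht => ?_
  rw [mult_L_tensor_L h0 hs (by omega) (by omega) ht, fusNum]
  split_ifs <;> omega

lemma exists_tensor_iso {s a : ℕ} (h0 : 0 < s) (hs : s < p) (ha : a ∈ ({1, p - 1} : Set ℕ)) :
    Nonempty (L k p s ⊗ L k p a ≅ L k p (if a = 1 then s else p - s)) := by
  split_ifs with h
  · subst h
    exact ⟨tensorLOneIso k p _⟩
  · obtain rfl : a = p - 1 := ha.resolve_left h
    exact nonempty_tensor_iso h0 hs

variable {P Q : ObjectProperty (Ver k p)}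

/-- The pair `(s, a)` goes to the simple object with label `s` or `p - s`, of odd or even parity
according to `a`, so distinct pairs have distinct images. For equal pairs both Hom spaces consist of
multiples of identities and the identity of the image is nonzero; for distinct pairs both vanish. -/
lemma bijective_tensorFunctor_map (hp : Odd p)
    {X Y : PreProd k P.FullSubcategory Q.FullSubcategory} {s t a b : ℕ}
    (hs : Odd s ∧ s < p) (ht : Odd t ∧ t < p) (ha : a ∈ ({1, p - 1} : Set ℕ))
    (hb : b ∈ ({1, p - 1} : Set ℕ)) (hX : X.fst.obj = L k p s) (hX' : X.snd.obj = L k p a)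
    (hY : Y.fst.obj = L k p t) (hY' : Y.snd.obj = L k p b) :
    Function.Bijective ((tensorFunctor k P Q).map : (X ⟶ Y) → _) := by
  have hp' := Nat.odd_iff.1 hp
  have hs' := Nat.odd_iff.1 hs.1
  have ht' := Nat.odd_iff.1 ht.1
  have hp1 := (Fact.out : p.Prime).two_le
  have ha' : a ≤ p := by rcases ha with rfl | rfl <;> omega
  have hb' : b ≤ p := by rcases hb with rfl | rfl <;> omega
  rcases X with ⟨⟨X₁, hX₁⟩, ⟨X₂, hX₂⟩⟩
  rcases Y with ⟨⟨Y₁, hY₁⟩, ⟨Y₂, hY₂⟩⟩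
  obtain rfl : X₁ = L k p s := hX
  obtain rfl : X₂ = L k p a := hX'
  obtain rfl : Y₁ = L k p t := hY
  obtain rfl : Y₂ = L k p b := hY'
  obtain ⟨eX⟩ := exists_tensor_iso (k := k) (s := s) (by omega) hs.2 ha
  obtain ⟨eY⟩ := exists_tensor_iso (k := k) (s := t) (by omega) ht.2 hb
  by_cases hst : s = t ∧ a = b
  · obtain ⟨rfl, rfl⟩ := hst
    have src : ∀ f : (⟨⟨L k p s, hX₁⟩, ⟨L k p a, hX₂⟩⟩ :
        PreProd k P.FullSubcategory Q.FullSubcategory) ⟶ ⟨⟨L k p s, hX₁⟩, ⟨L k p a, hX₂⟩⟩,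
        ∃ c : k, f = c • 𝟙 _ := by
      intro f
      induction f using PreProd.hom_induction with
      | zero => exact ⟨0, by simp⟩
      | pure g h =>
        obtain ⟨c, hc⟩ := L_hom_eq_smul k p s g.hom
        obtain ⟨d, hd⟩ := L_hom_eq_smul k p a h.hom
        have hg : g = c • 𝟙 _ := ObjectProperty.hom_ext _ hc
        have hh : h = d • 𝟙 _ := ObjectProperty.hom_ext _ hd
        refine ⟨c * d, ?_⟩
        rw [hg, hh, ← PreProd.pure_id]
        exact TensorProduct.smul_tmul_smul c d _ _
      | add f f' hf hf' =>
        obtain ⟨c, rfl⟩ := hf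
        obtain ⟨d, rfl⟩ := hf'
        exact ⟨c + d, (add_smul _ _ _).symm⟩
    have tgt : ∀ g : L k p s ⊗ L k p a ⟶ L k p s ⊗ L k p a, ∃ c : k, g = c • 𝟙 _ := fun g => by
      obtain ⟨c, hc⟩ := L_hom_eq_smul k p _ (eX.inv ≫ g ≫ eX.hom)
      refine ⟨c, ?_⟩
      have := congrArg (fun f => eX.hom ≫ f ≫ eX.inv) hc
      simpa using this
    have hne : 𝟙 (L k p s ⊗ L k p a) ≠ 0 := fun h => by
      refine id_L_ne_zero (k := k) (p := p) (s := if a = 1 then s else p - s)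
        (by split_ifs <;> omega) (by split_ifs <;> omega) ?_
      rw [← eX.inv_hom_id, ← Category.id_comp eX.hom, h]
      simp
    have hmap : ∀ c : k, (tensorFunctor k P Q).map (c • 𝟙 (⟨⟨L k p s, hX₁⟩, ⟨L k p a, hX₂⟩⟩ :
        PreProd k P.FullSubcategory Q.FullSubcategory)) = c • 𝟙 (L k p s ⊗ L k p a) := fun c => by
      rw [CategoryTheory.Functor.map_smul, CategoryTheory.Functor.map_id]
      rfl
    constructor
    · intro f g hfg
      obtain ⟨c, rfl⟩ := src f
      obtain ⟨d, rfl⟩ := src g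
      have h1 : c • 𝟙 (L k p s ⊗ L k p a) = d • 𝟙 (L k p s ⊗ L k p a) :=
        (hmap c).symm.trans (hfg.trans (hmap d))
      rw [smul_left_injective k hne h1]
    · intro g
      obtain ⟨c, hc⟩ := tgt g
      exact ⟨c • 𝟙 _, (hmap c).trans hc.symm⟩
  · have src : ∀ f : (⟨⟨L k p s, hX₁⟩, ⟨L k p a, hX₂⟩⟩ :
        PreProd k P.FullSubcategory Q.FullSubcategory) ⟶ ⟨⟨L k p t, hY₁⟩, ⟨L k p b, hY₂⟩⟩,
        f = 0 := by
      intro f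
      induction f using PreProd.hom_induction with
      | zero => rfl
      | pure g h =>
        by_cases hst' : s = t
        · have hh : h = 0 := ObjectProperty.hom_ext _
            (L_hom_eq_zero ha' hb' (fun h => hst ⟨hst', h⟩) h.hom)
          rw [hh]
          exact TensorProduct.tmul_zero _ _
        · have hg : g = 0 := ObjectProperty.hom_ext _
            (L_hom_eq_zero hs.2.le ht.2.le hst' g.hom)
          rw [hg]
          exact TensorProduct.zero_tmul _ _
      | add f f' hf hf' => rw [hf, hf', add_zero]
    -- If `a = b`, the image labels differ because `s ≠ t`; otherwise they differ in parity.
    have tgt : ∀ g : L k p s ⊗ L k p a ⟶ L k p t ⊗ L k p b, g = 0 := fun g => by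
      have h0 := L_hom_eq_zero (k := k) (p := p) (by split_ifs <;> omega)
        (by split_ifs <;> omega) (by
          rcases ha with rfl | rfl <;> rcases hb with rfl | rfl <;> split_ifs <;> omega)
        (eX.inv ≫ g ≫ eY.hom)
      have := congrArg (fun f => eX.hom ≫ f ≫ eY.inv) h0
      simpa using this
    constructor
    · intro f g _
      rw [src f, src g]
    · intro g
      exact ⟨0, (CategoryTheory.Functor.map_zero _ _ _).trans (tgt g).symm⟩

end Ver

/-! ### Statement (iii). -/

section Decomposition

variable {k : Type u} [Field k] {p : ℕ} [Fact p.Prime]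

lemma exists_isSumOf_of_verOf {T : Set ℕ}
    (X : (VerOf k T : ObjectProperty (Ver k p)).FullSubcategory) :
    ∃ (d : ℕ) (S : Fin d → (VerOf k T : ObjectProperty (Ver k p)).FullSubcategory),
      (∀ a, ∃ s ∈ T, (S a).obj = L k p s) ∧ IsSumOf X S := by
  obtain ⟨d, e, he, h⟩ := exists_fin_of_verOf X.property
  have hL : ∀ a, VerOf k T (L k p (e a)) := fun a =>
    (directSums_iff _ _).2 ⟨1, fun _ => L k p (e a), fun _ => ⟨_, he a, rfl⟩,
      fun _ => 𝟙 _, fun _ => 𝟙 _, fun _ => by simp,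
      fun b c hbc => absurd (Subsingleton.elim b c) hbc, by simp⟩
  exact ⟨d, fun a => ⟨L k p (e a), hL a⟩, fun a => ⟨e a, he a, rfl⟩,
    IsSumOf.of_map (ObjectProperty.ι _) h.isSumOf⟩

variable [CharP k p]

lemma bijective_tensorFunctor_map_verOf (hp : Odd p)
    (X Y : PreProd k (VerOf k {s | Odd s ∧ s < p} : ObjectProperty (Ver k p)).FullSubcategory
      (VerOf k {1, p - 1} : ObjectProperty (Ver k p)).FullSubcategory) :
    Function.Bijective ((tensorFunctor k _ _).map : (X ⟶ Y) → _) := by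
  obtain ⟨d, S, hS, hX⟩ := exists_isSumOf_of_verOf X.fst
  obtain ⟨d', S', hS', hX'⟩ := exists_isSumOf_of_verOf X.snd
  obtain ⟨e, T, hT, hY⟩ := exists_isSumOf_of_verOf Y.fst
  obtain ⟨e', T', hT', hY'⟩ := exists_isSumOf_of_verOf Y.snd
  refine bijective_map_of_isSumOf _ (hX.prod hX') (hY.prod hY') fun a b => ?_
  obtain ⟨s, hs, hs'⟩ := hS a.1
  obtain ⟨s₂, hs₂, hs₂'⟩ := hS' a.2
  obtain ⟨t, ht, ht'⟩ := hT b.1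
  obtain ⟨t₂, ht₂, ht₂'⟩ := hT' b.2
  exact bijective_tensorFunctor_map hp hs ht hs₂ ht₂ hs' hs₂' ht' ht₂'

lemma exists_retract_tensor (hp : Odd p) (Z : Ver k p) :
    ∃ A B : Ver k p, VerOf k {s | Odd s ∧ s < p} A ∧ VerOf k {1, p - 1} B ∧
      Nonempty (Retract Z (A ⊗ B)) := by
  classical
  obtain ⟨d, e, he, hZ⟩ := exists_isDirectSum_L k p Z
  have hp' := Nat.odd_iff.1 hp
  have hp1 := (Fact.out : p.Prime).two_le
  -- Exactly one of `e a` and `p - e a` is odd. `A` collects these odd labels, and `B = L_1 ⊕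
  -- L_{p-1}` supplies the factor that turns each back into `e a`.
  obtain ⟨A, hA⟩ := exists_isDirectSum
    (fun a : Fin d => L k p (if Odd (e a) then e a else p - e a))
  obtain ⟨B, hB⟩ := exists_isDirectSum (fun a : Fin 2 => L k p (![1, p - 1] a))
  refine ⟨A, B, (directSums_iff _ _).2 ⟨_, _, fun a => ⟨_, ?_, rfl⟩, hA⟩,
    (directSums_iff _ _).2 ⟨_, _, fun a => ⟨_, ?_, rfl⟩, hB⟩, ?_⟩
  · have := he a
    split_ifs with h
    · exact ⟨h, this.2⟩
    · rw [Nat.odd_iff] at h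
      exact ⟨Nat.odd_iff.2 (by omega), by omega⟩
  · fin_cases a
    · exact Or.inl rfl
    · exact Or.inr rfl
  · have key : ∀ a, ∃ b : Fin 2, Nonempty (L k p (e a) ≅
        L k p (if Odd (e a) then e a else p - e a) ⊗ L k p (![1, p - 1] b)) := by
      intro a
      split_ifs with h
      · exact ⟨0, ⟨(tensorLOneIso k p _).symm⟩⟩
      · obtain ⟨f⟩ := nonempty_tensor_iso (k := k) (s := p - e a) (by have := he a; omega)
          (by have := he a; omega)
        rw [Nat.sub_sub_self (he a).2.le] at f
        exact ⟨1, ⟨f.symm⟩⟩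
    choose b f using key
    obtain ⟨i, q, h₁, h₂, -⟩ := hA
    obtain ⟨j, r, h₃, -, -⟩ := hB
    -- Different summands of `Z` may use the same summand of `B`; their orthogonality comes from the
    -- `A` factor alone.
    refine hZ.nonempty_retract (fun a => (f a).some.hom ≫ (i a ⊗ₘ j (b a)))
      (fun a => (q a ⊗ₘ r (b a)) ≫ (f a).some.inv) (fun a => ?_) fun a a' haa => ?_
    · rw [Category.assoc, MonoidalCategory.tensorHom_comp_tensorHom_assoc, h₁, h₃]
      simp
    · rw [Category.assoc, MonoidalCategory.tensorHom_comp_tensorHom_assoc, h₂ a a' haa]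
      simp [MonoidalCategory.tensorHom_def]

variable (k p) in
/-- The Verlinde category is the external product of its subcategories `Ver_p^+` and `sVec`. -/
theorem exists_symmetricEquivalent (hp : Odd p) :
    ∃ (_ : (VerPlus k p).IsMonoidal) (_ : (VerSVec k p).IsMonoidal),
      SymmetricEquivalent k (Ver k p)
        (ExtProd k (VerPlus k p).FullSubcategory (VerSVec k p).FullSubcategory) := by
  have hp1 := (Fact.out : p.Prime).one_lt
  rw [verPlus_eq, verSVec_eq]
  have h1 := (isFusionClosed_odd hp1).isFusionSubcategory (k := k).toIsMonoidal
  have h2 := (isFusionClosed_pair hp1).isFusionSubcategory (k := k).toIsMonoidal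
  refine ⟨h1, h2, ?_⟩
  have : (tensorFunctor k (VerOf k {s | Odd s ∧ s < p} : ObjectProperty (Ver k p))
      (VerOf k {1, p - 1})).Full := ⟨fun {X Y} => (bijective_tensorFunctor_map_verOf hp X Y).2⟩
  have : (tensorFunctor k (VerOf k {s | Odd s ∧ s < p} : ObjectProperty (Ver k p))
      (VerOf k {1, p - 1})).Faithful := ⟨fun {X Y} => (bijective_tensorFunctor_map_verOf hp X Y).1⟩
  refine symmetricEquivalent_karoubi k (tensorFunctor k _ _) fun Z => ?_
  obtain ⟨A, B, hA, hB, h⟩ := exists_retract_tensor hp Z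
  exact ⟨⟨⟨A, hA⟩, ⟨B, hB⟩⟩, h⟩

end Decomposition

end Verlinde

end

theorem proposition3 (p : ℕ) [Fact p.Prime] (hp : 3 < p)
    (k : Type u) [Field k] [IsAlgClosed k] [CharP k p] :
    IsLeast {P : CategoryTheory.ObjectProperty (Verlinde.Ver k p) |
        Verlinde.IsFusionSubcategory P ∧ P (Verlinde.L k p 3)} (Verlinde.VerPlus k p) ∧
    ((∀ P : CategoryTheory.ObjectProperty (Verlinde.Ver k p),
        Verlinde.IsFusionSubcategory P ↔
        P = Verlinde.VerVec k p ∨ P = Verlinde.VerSVec k p ∨ P = Verlinde.VerPlus k p ∨ P = ⊤) ∧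
      [Verlinde.VerVec k p, Verlinde.VerSVec k p, Verlinde.VerPlus k p, ⊤].Pairwise (· ≠ ·)) ∧
    ∃ (_ : (Verlinde.VerPlus k p).IsMonoidal) (_ : (Verlinde.VerSVec k p).IsMonoidal),
      Verlinde.SymmetricEquivalent k (Verlinde.Ver k p)
        (Verlinde.ExtProd k (Verlinde.VerPlus k p).FullSubcategory
          (Verlinde.VerSVec k p).FullSubcategory) :=
  ⟨Verlinde.isLeast_verPlus k p hp,
    ⟨Verlinde.isFusionSubcategory_iff k p hp, Verlinde.pairwise_ne k p hp⟩,
    Verlinde.exists_symmetricEquivalent k p ((Fact.out : p.Prime).odd_of_ne_two (by omega))⟩
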